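/- **Setting.** There are $N$ sources, $\mathcal N=\{1,\dots,N\}$; at each time $t=0,1,2,\dots$ each source emits a fresh message of $L\ge 1$ bits, all messages being independent and uniform. The user's requests $X_0,X_1,\dots\in\mathcal N$ form a time-invariant Markov chain (any initial law, any transition matrix), independent of the messages. The privacy status $F_t\in\{\mathrm{ON},\mathrm{OFF}\}$ is known to the user and the server up to the current time, does not depend on the requests, and $F_0=\mathrm{ON}$. Put $\mathcal B_t=\{i\le t: F_i=\mathrm{ON}\}$ and $\tau=\tau(t)=\max\mathcal B_t$. In a causal ON-OFF privacy system the user draws local randomness $S_t$ from a law that depends on $X_0,\dots,X_t$, $F_0,\dots,F_t$, $S_0,\dots,S_{t-1}$, sends the query $Q_t$, a function of $X_0,\dots,X_t$, $F_0,\dots,F_t$, $S_0,\dots,S_t$, receives an answer of $\ell(Q_t)\le NL$ bits that is a function of $Q_t$ and the messages at time $t$, and decodes the message of source $X_t$ from the answer, $X_t$ and $S_t$. The system is admissible if, for every privacy status sequence and every $t$, the decoding error has probability $0$ and $I(X_{\mathcal B_t};Q_t\mid Q_{[t-1]})=0$, where $Q_{[t-1]}=(Q_0,\dots,Q_{t-1})$.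 A rate tuple $(R_t)_{t\ge0}$ is achievable if some admissible system has $R_t\le L/\mathbb E[\ell(Q_t)]$ for all $t$. For a row-stochastic table $p(x|u)$, $x,u\in\mathcal N$, let $\lambda_0=0$, let $\lambda_i$ be the sum over $x\in\mathcal N$ of the $i$-th smallest of the numbers $p(x|u)$, $u\in\mathcal N$, and let $\theta_i=\min\{1,\lambda_i\}-\min\{1,\lambda_{i-1}\}$ for $1\le i\le N$. Write $\theta_i(q_{[t-1]})$ for these numbers when the table is $p(X_t=x\mid X_\tau=u,Q_{[t-1]}=q_{[t-1]})$ (any version of this conditional law: where the conditioning event is null, any probability distribution in $x$). An uncoded scheme is one in which $Q_t$ is a subset of $\mathcal N$ drawn from a law that depends on $F_0,\dots,F_t$, $X_\tau$, $X_t$, $Q_{[t-1]}$ only; its answer is the list of the messages of the sources in $Q_t$, so $\ell(Q_t)=|Q_t|L$. **Theorem (inner bound).** (i) There is one deterministic algorithm, on a random access machine that stores real numbers and adds, subtracts and compares them at unit cost, which for every $N$ and every row-stochastic $N\times N$ table $p(x|u)$ runs in $\mathrm{poly}(N)$ steps and outputs a list of $\mathrm{poly}(N)$ weighted triples $(y,x,u)$,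 $y\subseteq\mathcal N$, that represents (weights of equal triples being added, absent triples having value $0$) conditional laws $p(y,x|u)\ge0$ with $\sum_y p(y,x|u)=p(x|u)$ such that $p(y|u)$ does not depend on $u$ (so $Y$ is independent of $U$), $p(y,x|u)=0$ whenever $x\notin y$, $\mathbb P(|Y|\le i)\ge\theta_1+\dots+\theta_i$ for $i=1,\dots,N$, and $\mathbb E|Y|\le\sum_{i=1}^N i\,\theta_i$. (ii) Let $N$, $L\ge1$ and the Markov chain be given, let $t_0\ge0$, and let an uncoded scheme be given that is decodable and private at all times $t<t_0$, for every privacy status sequence. Then there is an admissible uncoded scheme that agrees with it at all times $t<t_0$ and has the following property for every privacy status sequence with $F_0=\mathrm{ON}$. It achieves every rate tuple $(R_t)$ such that $R_t\le L/\mathbb E[\ell(Q_t)]$ for $t<t_0$ and, for all $t\ge t_0$, $R_t>0$ and $$\frac1{R_t}\ \ge\ \sum_{q_{[t-1]}}p(q_{[t-1]})\sum_{i=1}^N i\,\theta_i(q_{[t-1]}),$$ where the law of the past queries on the right is that of the scheme itself (for $t=t_0$ it is determined by the given past). In particular, such rate tuples are achievable. -/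

import Mathlib

/-! ### Finite probability: a mass function `m` on a finite sample space -/

namespace OnOff

open Classical in
/-- Probability of an event under the mass function `m`. -/
noncomputable def prob {Ω : Type} [Fintype Ω] (m : Ω → ℝ) (E : Ω → Prop) : ℝ :=
  ∑ ω, if E ω then m ω else 0

/-- Conditional mutual information `I(A;B|C)` of random variables on a finite sample space:
the expectation of `log (p(a,b,c) p(c) / (p(a,c) p(b,c)))`. -/
noncomputable def condMutualInfo {Ω α β γ : Type} [Fintype Ω] (m : Ω → ℝ)
    (A : Ω → α) (B : Ω → β) (C : Ω → γ) : ℝ :=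
  ∑ ω, m ω * Real.log
    (prob m (fun ω' => A ω' = A ω ∧ B ω' = B ω ∧ C ω' = C ω) * prob m (fun ω' => C ω' = C ω) /
      (prob m (fun ω' => A ω' = A ω ∧ C ω' = C ω) *
        prob m (fun ω' => B ω' = B ω ∧ C ω' = C ω)))

/-! ### Requests, privacy status, ON-OFF privacy systems -/

/-- The requests `X_0, X_1, …` form a time-invariant Markov chain on the `N` sources. -/
structure MarkovSource (N : ℕ) where
  init : Fin N → ℝ
  trans : Fin N → Fin N → ℝ
  init_mem : init ∈ stdSimplex ℝ (Fin N)
  trans_mem : ∀ i, trans i ∈ stdSimplex ℝ (Fin N)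

/-- `𝓑_t`: the times at most `t` at which privacy was ON (`true` means ON). -/
def onTimes {t : ℕ} (f : Fin (t + 1) → Bool) : Finset (Fin (t + 1)) :=
  Finset.univ.filter fun i => f i = true

/-- `τ(t) = max 𝓑_t`: the last time at which privacy was ON
(the status at time `0` is always assumed to be ON, so `𝓑_t` is not empty). -/
noncomputable def lastOn {t : ℕ} (f : Fin (t + 1) → Bool) : Fin (t + 1) :=
  (onTimes f).sup id

/-- The first `t + 1` values of a privacy status sequence. -/
def status (f : ℕ → Bool) (t : ℕ) : Fin (t + 1) → Bool := fun i => f i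

/-- A causal ON-OFF privacy system for `N` sources and messages of `L` bits.
The local randomness `S_t` is drawn from a law that may depend on `X_{[t]}, F_{[t]}, S_{[t-1]}`. -/
structure System (N L : ℕ) where
  S : Type
  Q : Type
  [finS : Fintype S]
  [finQ : Fintype Q]
  randLaw : (t : ℕ) → (Fin (t + 1) → Fin N) → (Fin (t + 1) → Bool) → (Fin t → S) → S → ℝ
  randLaw_mem : ∀ t x f s, randLaw t x f s ∈ stdSimplex ℝ S
  /-- query encoding -/
  query : (t : ℕ) → (Fin (t + 1) → Fin N) → (Fin (t + 1) → Bool) → (Fin (t + 1) → S) → Q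
  /-- answer length -/
  len : Q → ℕ
  len_le : ∀ q, len q ≤ N * L
  /-- answer encoding -/
  answer : (t : ℕ) → (q : Q) → (Fin N → Fin L → Bool) → Fin (len q) → Bool
  /-- message decoding, from the answer (a bit string), the request and the local randomness -/
  decode : (t : ℕ) → List Bool → Fin N → S → Fin L → Bool

attribute [instance] System.finS System.finQ

namespace System

variable {N L : ℕ} (sys : System N L) (src : MarkovSource N) (f : ℕ → Bool)

/-- Joint law of the requests `X_{[t]}` and of the past local randomness `S_{[t-1]}`,
given the privacy status sequence `f`. -/
noncomputable def priorMass (t : ℕ) (ω : (Fin (t + 1) → Fin N) × (Fin t → sys.S)) : ℝ :=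
  src.init (ω.1 0) * (∏ i : Fin t, src.trans (ω.1 i.castSucc) (ω.1 i.succ)) *
    ∏ i : Fin t, sys.randLaw i
      (Fin.take (i + 1) (Nat.succ_le_succ i.isLt.le) ω.1) (status f i)
      (Fin.take i i.isLt.le ω.2) (ω.2 i)

/-- Joint law of the requests `X_{[t]}` and the local randomness `S_{[t]}`. -/
noncomputable def mass (t : ℕ) (ω : (Fin (t + 1) → Fin N) × (Fin (t + 1) → sys.S)) : ℝ :=
  sys.priorMass src f t (ω.1, Fin.init ω.2) *
    sys.randLaw t ω.1 (status f t) (Fin.init ω.2) (ω.2 (Fin.last t))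

/-- The past queries `Q_{[t-1]}`. -/
def pastQueries (t : ℕ) (ω : (Fin (t + 1) → Fin N) × (Fin t → sys.S)) : Fin t → sys.Q :=
  fun i => sys.query i (Fin.take (i + 1) (Nat.succ_le_succ i.isLt.le) ω.1) (status f i)
    (Fin.take (i + 1) i.isLt ω.2)

/-- The current query `Q_t`. -/
def currentQuery (t : ℕ) (ω : (Fin (t + 1) → Fin N) × (Fin (t + 1) → sys.S)) : sys.Q :=
  sys.query t ω.1 (status f t) ω.2

/-- The probability that the decoded message at time `t` differs from the desired one, when the
messages at time `t` are uniform and independent of the requests and of the local randomness. -/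
noncomputable def errorProb (t : ℕ) : ℝ :=
  ∑ ω : (Fin (t + 1) → Fin N) × (Fin (t + 1) → sys.S), ∑ W : Fin N → Fin L → Bool,
    if sys.decode t (List.ofFn (sys.answer t (sys.currentQuery f t ω) W))
        (ω.1 (Fin.last t)) (ω.2 (Fin.last t)) ≠ W (ω.1 (Fin.last t))
    then sys.mass src f t ω * (1 / 2 ^ (N * L)) else 0

/-- Decodability at time `t`. -/
def DecodableAt (t : ℕ) : Prop := sys.errorProb src f t = 0

/-- Privacy at time `t`: `I(X_{𝓑_t}; Q_t | Q_{[t-1]}) = 0`. -/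
def PrivateAt (t : ℕ) : Prop :=
  condMutualInfo (sys.mass src f t)
    (fun ω => fun i : {i // i ∈ onTimes (status f t)} => ω.1 i)
    (fun ω => sys.currentQuery f t ω)
    (fun ω => sys.pastQueries f t (ω.1, Fin.init ω.2)) = 0

/-- The average answer length `ℓ_t = E[ℓ(Q_t)]`. -/
noncomputable def avgLength (t : ℕ) : ℝ :=
  ∑ ω, sys.mass src f t ω * (sys.len (sys.currentQuery f t ω) : ℝ)

/-- The system is decodable and private at all times, whatever the privacy status sequence. -/
def Admissible : Prop :=
  ∀ f : ℕ → Bool, f 0 = true → ∀ t, sys.DecodableAt src f t ∧ sys.PrivateAt src f t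

/-- The system achieves the rate tuple `R` for the privacy status sequence `f`. -/
def Achieves (R : ℕ → ℝ) : Prop :=
  sys.Admissible src ∧ ∀ t, R t ≤ (L : ℝ) / sys.avgLength src f t

/-- `c q u x` is a version of the conditional probability
`p(X_t = x | X_{τ(t)} = u, Q_{[t-1]} = q)`; where the conditioning event is null it can be any
probability distribution in `x`. -/
def IsLikelihood (t : ℕ) (c : (Fin t → sys.Q) → Fin N → Fin N → ℝ) : Prop :=
  (∀ q u, c q u ∈ stdSimplex ℝ (Fin N)) ∧
  ∀ q u x,
    prob (sys.priorMass src f t)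
        (fun ω => ω.1 (lastOn (status f t)) = u ∧ sys.pastQueries f t ω = q) * c q u x =
      prob (sys.priorMass src f t)
        (fun ω => ω.1 (Fin.last t) = x ∧ ω.1 (lastOn (status f t)) = u ∧
          sys.pastQueries f t ω = q)

end System

/-- A rate tuple is achievable if some admissible system, with messages of some length `L`,
achieves it. -/
def Achievable {N : ℕ} (src : MarkovSource N) (f : ℕ → Bool) (R : ℕ → ℝ) : Prop :=
  ∃ L : ℕ, 0 < L ∧ ∃ sys : System N L, sys.Achieves src f R

/-! ### The quantities `λ_i`, `θ_i` and the bound -/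

/-- `λ_i = ∑_x p(x | u^{(x,i)})`, where `u^{(x,1)}, …, u^{(x,N)}` lists all `u` in increasing
order of `p(x | u)`, for `1 ≤ i ≤ N`; and `λ_0 = 0`. -/
noncomputable def lam {N : ℕ} (p : Fin N → Fin N → ℝ) (i : ℕ) : ℝ :=
  if h : 1 ≤ i ∧ i ≤ N then
    ∑ x, p (Tuple.sort (fun u => p u x) ⟨i - 1, by omega⟩) x
  else 0

/-- `θ_i = min {1, λ_i} - min {1, λ_{i-1}}`, for `1 ≤ i ≤ N`. -/
noncomputable def theta {N : ℕ} (p : Fin N → Fin N → ℝ) (i : ℕ) : ℝ :=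
  min 1 (lam p i) - min 1 (lam p (i - 1))

/-- `∑_{i=1}^N i θ_i`. -/
noncomputable def innerCost {N : ℕ} (p : Fin N → Fin N → ℝ) : ℝ :=
  ∑ i ∈ Finset.Icc 1 N, (i : ℝ) * theta p i

/-- `∑_{q_{[t-1]}} p(q_{[t-1]}) ∑_{i=1}^N i θ_i(q_{[t-1]})`, for the conditional
probabilities `c`. -/
noncomputable def System.innerBound {N L : ℕ} (sys : System N L) (src : MarkovSource N)
    (f : ℕ → Bool) (t : ℕ) (c : (Fin t → sys.Q) → Fin N → Fin N → ℝ) : ℝ :=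
  ∑ q : Fin t → sys.Q,
    prob (sys.priorMass src f t) (fun ω => sys.pastQueries f t ω = q) * innerCost (c q)

/-! ### Uncoded schemes -/

/-- An uncoded scheme: the query at time `t` is a set of sources, drawn from a law
`kernel t F_{[t]} X_{τ(t)} X_t Q_{[t-1]}`. -/
structure UncodedScheme (N : ℕ) where
  kernel : (t : ℕ) → (Fin (t + 1) → Bool) → Fin N → Fin N → (Fin t → Finset (Fin N)) →
    Finset (Fin N) → ℝ
  kernel_mem : ∀ t f u x q, kernel t f u x q ∈ stdSimplex ℝ (Finset (Fin N))

/-- The system of an uncoded scheme: the local randomness is the query itself, the answer is the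
concatenation of the queried messages, and the user reads off the desired message. -/
noncomputable def UncodedScheme.system {N : ℕ} (w : UncodedScheme N) (L : ℕ) : System N L where
  S := Finset (Fin N)
  Q := Finset (Fin N)
  randLaw t x f s := w.kernel t f (x (lastOn f)) (x (Fin.last t)) s
  randLaw_mem t x f s := w.kernel_mem t f (x (lastOn f)) (x (Fin.last t)) s
  query t _ _ s := s (Fin.last t)
  len q := q.card * L
  len_le q := Nat.mul_le_mul_right L ((Finset.card_le_univ q).trans_eq (Fintype.card_fin N))
  answer _ q W k :=
    W (q.orderEmbOfFin rfl (finProdFinEquiv.symm k).1) (finProdFinEquiv.symm k).2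
  decode _ a x s j :=
    if h : x ∈ s then
      a.getD (finProdFinEquiv ((s.orderIsoOfFin rfl).symm ⟨x, h⟩, j) : Fin (s.card * L)).val false
    else false

/-- `w u y x = p(y, x | u)` is the law of an uncoded query `Y` and of `X` given `U`, where
`p u x = p(x | u)`: `Y` is independent of `U`, contains `X` almost surely, and its size
satisfies the two bounds in terms of the `θ_i`. -/
structure IsUncodedQuery {N : ℕ} (p : Fin N → Fin N → ℝ)
    (w : Fin N → Finset (Fin N) → Fin N → ℝ) : Prop where
  nonneg : ∀ u y x, 0 ≤ w u y x
  marginal : ∀ u x, ∑ y, w u y x = p u x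
  contains : ∀ u y x, x ∉ y → w u y x = 0
  indep : ∀ y u u', ∑ x, w u y x = ∑ x, w u' y x
  cumulative : ∀ u, ∀ i ∈ Finset.Icc 1 N,
    ∑ j ∈ Finset.Icc 1 i, theta p j ≤
      ∑ y ∈ Finset.univ.filter (fun y : Finset (Fin N) => y.card ≤ i), ∑ x, w u y x
  mean : ∀ u, ∑ y, (y.card : ℝ) * ∑ x, w u y x ≤ innerCost p

/-! ### A real random access machine with structured programs

The memory consists of two-dimensional arrays of natural numbers and of real numbers. Real numbers
can only be added, subtracted and compared, natural numbers can be added, subtracted (with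
truncation) and compared, each at unit cost. The control flow is sequencing, branching and
loops whose number of rounds is fixed when they are entered. -/

/-- The memory: `nat a i j` and `real a i j` are the cells `(i, j)` of the arrays named `a`. -/
structure Store where
  nat : ℕ → ℕ → ℕ → ℕ
  real : ℕ → ℕ → ℕ → ℝ

def Store.setNat (σ : Store) (a i j v : ℕ) : Store :=
  { σ with nat := fun a' i' j' => if a' = a ∧ i' = i ∧ j' = j then v else σ.nat a' i' j' }

def Store.setReal (σ : Store) (a i j : ℕ) (v : ℝ) : Store :=
  { σ with real := fun a' i' j' => if a' = a ∧ i' = i ∧ j' = j then v else σ.real a' i' j' }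

/-- Natural number expressions; `cell a i j` reads the cell `(i, j)` of the array `a`. -/
inductive NExpr where
  | lit : ℕ → NExpr
  | cell : ℕ → NExpr → NExpr → NExpr
  | add : NExpr → NExpr → NExpr
  | sub : NExpr → NExpr → NExpr

def NExpr.eval (σ : Store) : NExpr → ℕ
  | .lit n => n
  | .cell a i j => σ.nat a (i.eval σ) (j.eval σ)
  | .add e e' => e.eval σ + e'.eval σ
  | .sub e e' => e.eval σ - e'.eval σ

/-- The number of operations that an evaluation takes. -/
def NExpr.cost : NExpr → ℕ
  | .lit _ => 1
  | .cell _ i j => i.cost + j.cost + 1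
  | .add e e' => e.cost + e'.cost + 1
  | .sub e e' => e.cost + e'.cost + 1

/-- Real number expressions. -/
inductive RExpr where
  | zero : RExpr
  | one : RExpr
  | cell : ℕ → NExpr → NExpr → RExpr
  | add : RExpr → RExpr → RExpr
  | sub : RExpr → RExpr → RExpr

noncomputable def RExpr.eval (σ : Store) : RExpr → ℝ
  | .zero => 0
  | .one => 1
  | .cell a i j => σ.real a (i.eval σ) (j.eval σ)
  | .add e e' => e.eval σ + e'.eval σ
  | .sub e e' => e.eval σ - e'.eval σ

def RExpr.cost : RExpr → ℕ
  | .zero => 1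
  | .one => 1
  | .cell _ i j => i.cost + j.cost + 1
  | .add e e' => e.cost + e'.cost + 1
  | .sub e e' => e.cost + e'.cost + 1

/-- Tests. -/
inductive Test where
  | natLe : NExpr → NExpr → Test
  | realLe : RExpr → RExpr → Test
  | neg : Test → Test
  | conj : Test → Test → Test

def Test.Holds (σ : Store) : Test → Prop
  | .natLe e e' => e.eval σ ≤ e'.eval σ
  | .realLe e e' => e.eval σ ≤ e'.eval σ
  | .neg b => ¬ b.Holds σ
  | .conj b b' => b.Holds σ ∧ b'.Holds σ

def Test.cost : Test → ℕ
  | .natLe e e' => e.cost + e'.cost + 1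
  | .realLe e e' => e.cost + e'.cost + 1
  | .neg b => b.cost + 1
  | .conj b b' => b.cost + b'.cost + 1

/-- Programs. `loop v e c` evaluates `e` once, to `n`, and then executes `c` for each of the
values `0, …, n - 1` of the cell `(0, 0)` of the array of natural numbers named `v`. -/
inductive Prog where
  | skip : Prog
  | setNat : ℕ → NExpr → NExpr → NExpr → Prog
  | setReal : ℕ → NExpr → NExpr → RExpr → Prog
  | seq : Prog → Prog → Prog
  | cond : Test → Prog → Prog → Prog
  | loop : ℕ → NExpr → Prog → Prog

open Classical in
/-- The final memory and the number of steps of the execution of a program. -/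
noncomputable def Prog.run : Prog → Store → Store × ℕ
  | .skip, σ => (σ, 1)
  | .setNat a i j e, σ =>
      (σ.setNat a (i.eval σ) (j.eval σ) (e.eval σ), i.cost + j.cost + e.cost + 1)
  | .setReal a i j e, σ =>
      (σ.setReal a (i.eval σ) (j.eval σ) (e.eval σ), i.cost + j.cost + e.cost + 1)
  | .seq c c', σ =>
      let r := c.run σ
      let r' := c'.run r.1
      (r'.1, r.2 + r'.2 + 1)
  | .cond b c c', σ =>
      let r := if b.Holds σ then c.run σ else c'.run σ
      (r.1, b.cost + r.2 + 1)
  | .loop v e c, σ =>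
      (List.range (e.eval σ)).foldl
        (fun st k =>
          let r := c.run (st.1.setNat v 0 0 k)
          (r.1, st.2 + r.2 + 1))
        (σ, e.cost + 1)

/-- The input: `N` in the cell `(0, 0)` of the array `0` of natural numbers, `p(x | u)` in the
cell `(u, x)` of the array `0` of real numbers, and `0` everywhere else. -/
noncomputable def inputStore {N : ℕ} (p : Fin N → Fin N → ℝ) : Store where
  nat a i j := if a = 0 ∧ i = 0 ∧ j = 0 then N else 0
  real a i j := if h : a = 0 ∧ i < N ∧ j < N then p ⟨i, h.2.1⟩ ⟨j, h.2.2⟩ else 0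

/-- The number of records of the output: the cell `(0, 0)` of the array `1`. -/
def Store.numRecords (σ : Store) : ℕ := σ.nat 1 0 0

/-- The output lists records `(y, x, u, v)`: the record `k` has `x` and `u` in the cells `(k, 0)`
of the arrays `2` and `3` of natural numbers, `v` in the cell `(k, 0)` of the array `1` of real
numbers, and `y` is the set of all `j` with a `1` in the cell `(k, j)` of the array `4` of
natural numbers. They stand for the function `p(y, x | u)` whose value is the sum of the `v` of the
records of `(y, x, u)`, which is `0` if there are none. -/
noncomputable def Store.output (N : ℕ) (σ : Store) (u : Fin N) (y : Finset (Fin N))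
    (x : Fin N) : ℝ :=
  ∑ k ∈ Finset.range σ.numRecords,
    if (Finset.univ.filter fun j : Fin N => σ.nat 4 k j = 1) = y ∧
        σ.nat 2 k 0 = x ∧ σ.nat 3 k 0 = u
    then σ.real 1 k 0 else 0

end OnOff

/-!
Write `p u x` for `p(x|u)`.

**The query.** Fix `x` and sort the numbers `p u x` increasingly in `u`. The increment from the
`i`-th to the next order statistic, `i = 0, …, N - 1`, is a *common part* `(i, x)`: every `u` of
rank at least `i` in the column `x` has this much mass on the request `x`, and exactly `i` values
of `u` have a smaller rank. The common parts of index below `k` have total mass `λ_k`, and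
`λ_N ≥ 1` since the largest order statistics dominate each row. Taking the common parts row by row
until their total mass is `1` leaves the masses `common`, of which those of index below `k` sum to
`min {1, λ_k}`. What `p u x` has in excess of its common parts is `spare`. For each `u`, the spare
masses sum to the mass of the common parts in which `u` takes no part (`sum_spare`).

A part `(i, x)` is now covered with a query that contains `x`, for those `u` that take part, and
one request with spare mass for each of the other `i` values of `u`. Such a query has at most
`i + 1` elements and its law is the same for all `u`, whence the distribution function of `|Y|` at
`k` is at least `min {1, λ_k} = θ_1 + … + θ_k`. The bound on `𝔼|Y|` follows by summation by parts
(`mean_card_le`). The covering is greedy: a round takes a largest common part and largest spare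
masses, and as much mass as they allow. So it exhausts one of them, and `2 N²` rounds suffice
(`GreedyRound.potential_lt`). What a round preserves is `PartialQuery` (`PartialQuery.next`).

**The running time.** The construction uses only additions, subtractions and comparisons. All
loops of the program `queryProg` have `N` rounds, and the nesting depth is fixed, so the number of
steps is bounded by a polynomial that is computed from the program (`Prog.run_snd_le`). Each round
adds `N` records.

**The scheme.** At each time `t ≥ t₀` the query above is applied, given the past queries, to a
version of the law of `X_t` given `X_τ`, where `τ = τ(t)`. Of the requests up to `τ`, the queries
sent from `τ` on see only `X_τ`. Hence, given `X_τ` and the past queries, `X_t` is independent of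
the requests up to `τ`: in the product of the masses of two paths that meet at `τ`, the parts of
the paths after `τ` can be exchanged (`pathProb_markov`). So the query `Y` is independent not only
of `X_τ`, but of all requests up to `τ`, which include those at the times at which privacy is ON,
and the scheme is private. It is decodable because `Y` contains the request. The bound on `𝔼|Y|`
averages to the bound on the rate. Where the conditioning event is null, the rows of the table are
free. The scheme uses a version of least cost, which exists by compactness, so the bound holds for
the conditional laws of any version.
-/

namespace OnOff

/-! ### Order statistics and the layers of a table -/

/-- The `i`-th smallest value of `v`, counted from `0`. -/
noncomputable def orderStat {N : ℕ} (v : Fin N → ℝ) (i : Fin N) : ℝ := v (Tuple.sort v i)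

theorem orderStat_mono {N : ℕ} (v : Fin N → ℝ) : Monotone (orderStat v) :=
  Tuple.monotone_sort v

theorem orderStat_le_iff {N : ℕ} (v : Fin N → ℝ) (i : Fin N) (a : ℝ) :
    orderStat v i ≤ a ↔ (i : ℕ) < Fintype.card {u // v u ≤ a} := by
  rw [← Fintype.card_congr ((Tuple.sort v).subtypeEquiv (p := fun j => v (Tuple.sort v j) ≤ a)
    (q := fun u => v u ≤ a) fun _ => Iff.rfl)]
  rw [Fintype.card_subtype]
  exact (Tuple.lt_card_le_iff_apply_le_of_monotone
    (f := v ∘ Tuple.sort v) (Tuple.monotone_sort v)).symm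

/-- Order statistics are `1`-Lipschitz in the sup norm. -/
theorem orderStat_le_add {N : ℕ} {v w : Fin N → ℝ} {ε : ℝ} (h : ∀ u, v u ≤ w u + ε) (i : Fin N) :
    orderStat v i ≤ orderStat w i + ε := by
  rw [orderStat_le_iff]
  refine ((orderStat_le_iff w i _).1 le_rfl).trans_le ?_
  exact Fintype.card_subtype_mono _ _ fun u hu => (h u).trans (add_le_add_left hu ε)

theorem continuous_orderStat {N : ℕ} (i : Fin N) : Continuous fun v : Fin N → ℝ => orderStat v i :=
  (LipschitzWith.of_le_add fun v w => orderStat_le_add (fun u => by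
    have h1 := dist_le_pi_dist v w u
    have h2 := le_abs_self (v u - w u)
    rw [Real.dist_eq] at h1
    linarith) i).continuous

/-- The position of `u` in the increasing order of the numbers `p(x|u)` for fixed `x`. -/
noncomputable def rk {N : ℕ} (p : Fin N → Fin N → ℝ) (u x : Fin N) : Fin N :=
  (Tuple.sort fun u => p u x).symm u

/-- Ties between equal values are broken by the index, as in `Tuple.sort`. -/
theorem rk_lt_rk_iff {N : ℕ} (p : Fin N → Fin N → ℝ) (u' u x : Fin N) :
    rk p u' x < rk p u x ↔ p u' x < p u x ∨ p u' x ≤ p u x ∧ u' < u := by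
  set v : Fin N → ℝ := fun u => p u x
  obtain ⟨hm, ht⟩ := Tuple.eq_sort_iff.1 (rfl : Tuple.sort v = Tuple.sort v)
  have key : ∀ a b : Fin N, rk p a x < rk p b x → v a < v b ∨ v a ≤ v b ∧ a < b := by
    intro a b h
    have h1 : v a ≤ v b := by simpa [rk, v] using hm h.le
    rcases h1.lt_or_eq with h2 | h2
    · exact Or.inl h2
    · refine Or.inr ⟨h1, ?_⟩
      simpa [rk, v] using ht _ _ h (by simpa [rk, v] using h2)
  refine ⟨key u' u, fun h => ?_⟩
  by_contra hn
  rcases (not_lt.1 hn).lt_or_eq with h2 | h2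
  · rcases key _ _ h2 with h3 | ⟨h3, h4⟩ <;> rcases h with h5 | ⟨h5, h6⟩
    · exact lt_asymm h3 h5
    · exact absurd h5 (not_le.2 h3)
    · exact absurd h3 (not_le.2 h5)
    · exact lt_asymm h4 h6
  · have : u = u' := (Tuple.sort v).symm.injective h2
    subst this
    simp at h

/-- Exactly `i` values of `u` take no part in the common part `(i, x)`. -/
theorem card_filter_rk_lt {N : ℕ} (p : Fin N → Fin N → ℝ) (x i : Fin N) :
    (Finset.univ.filter fun u => rk p u x < i).card = i := by
  have : (Finset.univ.filter fun u => rk p u x < i) =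
      (Finset.univ.filter fun j : Fin N => j < i).map
        (Tuple.sort fun u => p u x).toEmbedding := by
    ext u
    rw [Finset.mem_map_equiv, Finset.mem_filter_univ, Finset.mem_filter_univ, rk]
  rw [this, Finset.card_map, ← Fin.card_Iio]
  congr 1
  ext j
  rw [Finset.mem_filter_univ, Finset.mem_Iio]

/-- The `i`-th smallest of the numbers `p(x|u)` for `1 ≤ i ≤ N`, and `0` otherwise. -/
noncomputable def layerTop {N : ℕ} (p : Fin N → Fin N → ℝ) (i x : ℕ) : ℝ :=
  if h : (1 ≤ i ∧ i ≤ N) ∧ x < N then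
    orderStat (fun u => p u ⟨x, h.2⟩) ⟨i - 1, by omega⟩ else 0

theorem layerTop_rk {N : ℕ} (p : Fin N → Fin N → ℝ) (u x : Fin N) :
    layerTop p (rk p u x + 1) x = p u x := by
  have := (rk p u x).isLt
  simp [layerTop, orderStat, rk]

theorem layerTop_zero {N : ℕ} (p : Fin N → Fin N → ℝ) (x : ℕ) : layerTop p 0 x = 0 := by
  simp [layerTop]

theorem sum_layerTop {N : ℕ} (p : Fin N → Fin N → ℝ) (i : ℕ) :
    ∑ x ∈ Finset.range N, layerTop p i x = lam p i := by
  rw [← Fin.sum_univ_eq_sum_range]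
  by_cases h : 1 ≤ i ∧ i ≤ N
  · simp [layerTop, lam, h, orderStat]
  · simp [layerTop, lam, h]

theorem layerTop_le_succ {N : ℕ} {p : Fin N → Fin N → ℝ} (hp : ∀ u x, 0 ≤ p u x) {i x : ℕ}
    (hi : i < N) (hx : x < N) : layerTop p i x ≤ layerTop p (i + 1) x := by
  rcases Nat.eq_zero_or_pos i with rfl | h
  · rw [layerTop_zero]
    simp only [layerTop, orderStat]
    split_ifs
    · exact hp _ _
    · exact le_rfl
  · have h1 : (1 ≤ i ∧ i ≤ N) ∧ x < N := ⟨⟨h, hi.le⟩, hx⟩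
    have h2 : (1 ≤ i + 1 ∧ i + 1 ≤ N) ∧ x < N := ⟨⟨by omega, hi⟩, hx⟩
    rw [layerTop, layerTop, dif_pos h1, dif_pos h2]
    exact orderStat_mono _ (Fin.mk_le_mk.2 (by omega))

theorem lam_zero {N : ℕ} (p : Fin N → Fin N → ℝ) : lam p 0 = 0 := by simp [lam]

/-- The largest order statistics dominate every row, so they have total mass at least `1`. -/
theorem one_le_lam {N : ℕ} {p : Fin N → Fin N → ℝ} (u : Fin N)
    (hp : p u ∈ stdSimplex ℝ (Fin N)) : 1 ≤ lam p N := by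
  have hN : 1 ≤ N := by have := u.isLt; omega
  rw [lam, dif_pos ⟨hN, le_rfl⟩, ← hp.2]
  refine Finset.sum_le_sum fun x _ => ?_
  calc p u x = orderStat (fun u => p u x) (rk p u x) := by simp [orderStat, rk]
    _ ≤ _ := orderStat_mono _ (Nat.le_sub_one_of_lt (rk p u x).isLt)

theorem continuous_innerCost {N : ℕ} :
    Continuous fun p : Fin N → Fin N → ℝ => innerCost p := by
  have h : ∀ i, Continuous fun p : Fin N → Fin N → ℝ => lam p i := by
    intro i
    by_cases h : 1 ≤ i ∧ i ≤ N
    · simp only [lam, h, and_self, dite_true]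
      refine continuous_finsetSum _ fun x _ => ?_
      exact (continuous_orderStat (⟨i - 1, by omega⟩ : Fin N)).comp
        (f := fun p : Fin N → Fin N → ℝ => fun u => p u x) (by fun_prop)
    · simp only [lam, h, dite_false]
      exact continuous_const
  unfold innerCost theta
  have := h
  fun_prop

theorem sum_theta {N : ℕ} (p : Fin N → Fin N → ℝ) (i : ℕ) :
    ∑ j ∈ Finset.Icc 1 i, theta p j = min 1 (lam p i) := by
  induction i with
  | zero => simp [lam_zero]
  | succ i ih => rw [Finset.sum_Icc_succ_top (by omega), ih, theta, Nat.add_sub_cancel]; ring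

/-- Summation by parts. -/
theorem innerCost_eq {N : ℕ} {p : Fin N → Fin N → ℝ} (h : 1 ≤ lam p N) :
    innerCost p = ∑ i ∈ Finset.range N, (1 - min 1 (lam p i)) := by
  have key : ∀ n : ℕ, ∑ i ∈ Finset.Icc 1 n, (i : ℝ) * theta p i =
      ∑ i ∈ Finset.range n, (min 1 (lam p n) - min 1 (lam p i)) := by
    intro n
    induction n with
    | zero => simp
    | succ n ih =>
      rw [Finset.sum_Icc_succ_top (by omega), ih, Finset.sum_range_succ, theta,
        Nat.add_sub_cancel]
      simp only [Finset.sum_sub_distrib, Finset.sum_const, Finset.card_range, nsmul_eq_mul]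
      push_cast
      ring
  rw [innerCost, key, min_eq_left h]

/-! ### Truncating the layers to total mass one -/

/-- The sum of `D` over the pairs that precede `(i, x)` in the row by row order. -/
noncomputable def rowAcc (N : ℕ) (D : ℕ → ℕ → ℝ) (i x : ℕ) : ℝ :=
  ∑ i' ∈ Finset.range i, ∑ x' ∈ Finset.range N, D i' x' + ∑ x' ∈ Finset.range x, D i x'

theorem rowAcc_succ (N : ℕ) (D : ℕ → ℕ → ℝ) (i x : ℕ) :
    rowAcc N D i (x + 1) = rowAcc N D i x + D i x := by
  rw [rowAcc, rowAcc, Finset.sum_range_succ, add_assoc]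

theorem rowAcc_full (N : ℕ) (D : ℕ → ℕ → ℝ) (i : ℕ) : rowAcc N D i N = rowAcc N D (i + 1) 0 := by
  simp [rowAcc, Finset.sum_range_succ]

/-- The part of the mass `D i x` that survives when the pairs are taken row by row until the
total mass is `1`. -/
noncomputable def truncMass (N : ℕ) (D : ℕ → ℕ → ℝ) (i x : ℕ) : ℝ :=
  min 1 (rowAcc N D i (x + 1)) - min 1 (rowAcc N D i x)

theorem truncMass_nonneg {N : ℕ} {D : ℕ → ℕ → ℝ} {i x : ℕ} (h : 0 ≤ D i x) :
    0 ≤ truncMass N D i x := by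
  rw [truncMass, rowAcc_succ, sub_nonneg]
  exact min_le_min_left _ (by linarith)

theorem truncMass_le {N : ℕ} {D : ℕ → ℕ → ℝ} {i x : ℕ} (h : 0 ≤ D i x) :
    truncMass N D i x ≤ D i x := by
  rw [truncMass, rowAcc_succ, sub_le_iff_le_add', ← min_add_add_right]
  exact min_le_min_right _ (by linarith)

theorem sum_truncMass (N : ℕ) (D : ℕ → ℕ → ℝ) (n : ℕ) :
    ∑ i ∈ Finset.range n, ∑ x ∈ Finset.range N, truncMass N D i x =
      min 1 (∑ i ∈ Finset.range n, ∑ x ∈ Finset.range N, D i x) := by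
  have h : ∀ i, ∑ x ∈ Finset.range N, truncMass N D i x =
      min 1 (rowAcc N D (i + 1) 0) - min 1 (rowAcc N D i 0) := by
    intro i
    rw [← rowAcc_full]
    exact Finset.sum_range_sub (fun x => min 1 (rowAcc N D i x)) N
  rw [Finset.sum_congr rfl fun i _ => h i,
    Finset.sum_range_sub (fun i => min 1 (rowAcc N D i 0)) n]
  simp [rowAcc]

/-- The increment from the `i`-th to the `i + 1`-st smallest of the numbers `p(x|u)`. -/
noncomputable def layer {N : ℕ} (p : Fin N → Fin N → ℝ) (i x : ℕ) : ℝ :=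
  layerTop p (i + 1) x - layerTop p i x

theorem layer_nonneg {N : ℕ} {p : Fin N → Fin N → ℝ} (hp : ∀ u x, 0 ≤ p u x) {i x : ℕ}
    (hi : i < N) (hx : x < N) : 0 ≤ layer p i x :=
  sub_nonneg.2 (layerTop_le_succ hp hi hx)

/-- The masses of the common parts `(i, x)`: in such a part all `u` with `i ≤ rk p u x` request
`x`. -/
noncomputable def common {N : ℕ} (p : Fin N → Fin N → ℝ) (i x : Fin N) : ℝ :=
  truncMass N (layer p) i x

/-- The part of `p(x|u)` that is not used up by the common parts. -/
noncomputable def spare {N : ℕ} (p : Fin N → Fin N → ℝ) (u x : Fin N) : ℝ :=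
  p u x - ∑ i, if i ≤ rk p u x then common p i x else 0

theorem sum_fin_ite_le {N : ℕ} (f : ℕ → ℝ) (k : Fin N) :
    (∑ i : Fin N, if i ≤ k then f i else 0) = ∑ i ∈ Finset.range (k + 1), f i := by
  have h := Fin.sum_univ_eq_sum_range (fun i => if i ≤ (k : ℕ) then f i else 0) N
  simp only [Fin.le_def]
  rw [h, ← Finset.sum_filter]
  congr 1
  ext i
  have := k.isLt
  simp only [Finset.mem_filter, Finset.mem_range]
  omega

theorem sum_layer_sum {N : ℕ} (p : Fin N → Fin N → ℝ) (n : ℕ) :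
    ∑ i ∈ Finset.range n, ∑ x ∈ Finset.range N, layer p i x = lam p n := by
  rw [Finset.sum_comm, ← sum_layerTop]
  refine Finset.sum_congr rfl fun x _ => ?_
  rw [← sub_zero (layerTop p n x), ← layerTop_zero p x]
  exact Finset.sum_range_sub (fun i => layerTop p i x) n

theorem sum_common {N : ℕ} (p : Fin N → Fin N → ℝ) (k : Fin N) :
    (∑ i : Fin N, if i ≤ k then ∑ x, common p i x else 0) = min 1 (lam p (k + 1)) := by
  rw [← sum_layer_sum, ← sum_truncMass]
  rw [← sum_fin_ite_le (fun i => ∑ x ∈ Finset.range N, truncMass N (layer p) i x) k]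
  refine Finset.sum_congr rfl fun i _ => ?_
  rw [← Fin.sum_univ_eq_sum_range]
  rfl

theorem common_nonneg {N : ℕ} {p : Fin N → Fin N → ℝ} (hp : ∀ u x, 0 ≤ p u x) (i x : Fin N) :
    0 ≤ common p i x := truncMass_nonneg (layer_nonneg hp i.isLt x.isLt)

theorem spare_nonneg {N : ℕ} {p : Fin N → Fin N → ℝ} (hp : ∀ u x, 0 ≤ p u x) (u x : Fin N) :
    0 ≤ spare p u x := by
  rw [spare, sub_nonneg]
  calc (∑ i, if i ≤ rk p u x then common p i x else 0)
      ≤ ∑ i : Fin N, if i ≤ rk p u x then layer p i x else 0 := by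
        refine Finset.sum_le_sum fun i _ => ?_
        split_ifs
        · exact truncMass_le (layer_nonneg hp i.isLt x.isLt)
        · exact le_rfl
    _ = layerTop p (rk p u x + 1) x - layerTop p 0 x := by
        rw [sum_fin_ite_le (fun i => layer p i x)]
        exact Finset.sum_range_sub (fun i => layerTop p i x) _
    _ = p u x := by rw [layerTop_rk, layerTop_zero, sub_zero]

theorem sum_common_univ {N : ℕ} {p : Fin N → Fin N → ℝ} (h : 1 ≤ lam p N) :
    ∑ i, ∑ x, common p i x = 1 := by
  have h2 := sum_truncMass N (layer p) N
  rw [sum_layer_sum, min_eq_left h, ← Fin.sum_univ_eq_sum_range] at h2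
  rw [← h2]
  refine Finset.sum_congr rfl fun i _ => ?_
  rw [← Fin.sum_univ_eq_sum_range]
  rfl

theorem sum_spare {N : ℕ} {p : Fin N → Fin N → ℝ} (u : Fin N)
    (hp : p u ∈ stdSimplex ℝ (Fin N)) :
    ∑ x, spare p u x = ∑ i, ∑ x, if i ≤ rk p u x then 0 else common p i x := by
  simp only [spare, Finset.sum_sub_distrib, hp.2, ← sum_common_univ (one_le_lam u hp)]
  rw [sub_eq_iff_eq_add, Finset.sum_comm (f := fun x i => if i ≤ rk p u x then common p i x else 0),
    ← Finset.sum_add_distrib]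
  refine Finset.sum_congr rfl fun i _ => ?_
  rw [← Finset.sum_add_distrib]
  refine Finset.sum_congr rfl fun x _ => ?_
  split_ifs <;> simp

/-! ### The greedy coupling -/

/-- A state of the greedy construction: `w` is the law built so far, `C` the masses of the common
parts `(i, x)` that are not yet covered, and `L u` the mass that `u` can still spend in those
common parts in which it does not take part. -/
structure PartialQuery {N : ℕ} (p C L : Fin N → Fin N → ℝ)
    (w : Fin N → Finset (Fin N) → Fin N → ℝ) : Prop where
  common_nonneg : ∀ i x, 0 ≤ C i x
  spare_nonneg : ∀ u x, 0 ≤ L u x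
  balance : ∀ u, ∑ x, L u x = ∑ i, ∑ x, if i ≤ rk p u x then 0 else C i x
  nonneg : ∀ u y x, 0 ≤ w u y x
  marginal : ∀ u x, ∑ y, w u y x + L u x + (∑ i, if i ≤ rk p u x then C i x else 0) = p u x
  contains : ∀ u y x, x ∉ y → w u y x = 0
  indep : ∀ y u u', ∑ x, w u y x = ∑ x, w u' y x
  cumulative : ∀ (u k : Fin N), min 1 (lam p (k + 1)) ≤
    ∑ y ∈ Finset.univ.filter (fun y : Finset (Fin N) => y.card ≤ k + 1), ∑ x, w u y x +
      ∑ i : Fin N, if i ≤ k then ∑ x, C i x else 0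

theorem partialQuery_zero {N : ℕ} {p : Fin N → Fin N → ℝ}
    (hp : ∀ u, p u ∈ stdSimplex ℝ (Fin N)) :
    PartialQuery p (common p) (spare p) fun _ _ _ => 0 where
  common_nonneg := common_nonneg fun u => (hp u).1
  spare_nonneg := spare_nonneg fun u => (hp u).1
  balance u := sum_spare u (hp u)
  nonneg _ _ _ := le_rfl
  marginal u x := by simp [spare]
  contains _ _ _ _ := rfl
  indep _ _ _ := rfl
  cumulative u k := by
    rw [sum_common]
    simp

/-- The expected size is determined by the distribution function of the size. -/
theorem mean_card_le {N : ℕ} {p : Fin N → Fin N → ℝ} (hl : 1 ≤ lam p N)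
    {g : Finset (Fin N) → ℝ} (hg : ∀ y, 0 ≤ g y) (h1 : ∑ y, g y = 1)
    (hc : ∀ i ∈ Finset.Icc 1 N, min 1 (lam p i) ≤
      ∑ y ∈ Finset.univ.filter (fun y : Finset (Fin N) => y.card ≤ i), g y) :
    ∑ y, (y.card : ℝ) * g y ≤ innerCost p := by
  rw [innerCost_eq hl]
  have hcard : ∀ y : Finset (Fin N), (y.card : ℝ) * g y =
      ∑ i ∈ Finset.range N, (g y - if y.card ≤ i then g y else 0) := by
    intro y
    have hy : y.card ≤ N := (Finset.card_le_univ y).trans_eq (Fintype.card_fin N)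
    have : ∀ i ∈ Finset.range N, (g y - if y.card ≤ i then g y else 0) =
        if i < y.card then g y else 0 := by
      intro i _
      by_cases h : y.card ≤ i
      · simp [h, not_lt.2 h]
      · simp [h, not_le.1 h]
    rw [Finset.sum_congr rfl this, ← Finset.sum_filter]
    have : (Finset.range N).filter (fun i => i < y.card) = Finset.range y.card := by
      ext i
      simp only [Finset.mem_filter, Finset.mem_range]
      omega
    rw [this]
    simp
  rw [Finset.sum_congr rfl fun y _ => hcard y, Finset.sum_comm]
  refine Finset.sum_le_sum fun i hi => ?_
  rw [Finset.sum_sub_distrib, h1, ← Finset.sum_filter]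
  refine sub_le_sub_left ?_ 1
  rcases Nat.eq_zero_or_pos i with rfl | hi'
  · rw [lam_zero, min_eq_right zero_le_one]
    exact Finset.sum_nonneg fun y _ => hg y
  · exact hc i (Finset.mem_Icc.2 ⟨hi', (Finset.mem_range.1 hi).le⟩)

/-- When all common parts are covered, the balance leaves no spare mass. -/
theorem PartialQuery.isUncodedQuery {N : ℕ} {p C L : Fin N → Fin N → ℝ}
    {w : Fin N → Finset (Fin N) → Fin N → ℝ} (h : PartialQuery p C L w)
    (hp : ∀ u, p u ∈ stdSimplex ℝ (Fin N)) (hC : ∀ i x, C i x = 0) : IsUncodedQuery p w := by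
  have hL : ∀ u x, L u x = 0 := by
    intro u x
    have := h.balance u
    simp only [hC, ite_self, Finset.sum_const_zero] at this
    exact (Finset.sum_eq_zero_iff_of_nonneg fun x _ => h.spare_nonneg u x).1 this x
      (Finset.mem_univ x)
  have hm : ∀ u x, ∑ y, w u y x = p u x := by
    intro u x
    simpa [hC, hL] using h.marginal u x
  have hc : ∀ u, ∀ i ∈ Finset.Icc 1 N, min 1 (lam p i) ≤
      ∑ y ∈ Finset.univ.filter (fun y : Finset (Fin N) => y.card ≤ i), ∑ x, w u y x := by
    intro u i hi
    rw [Finset.mem_Icc] at hi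
    have := h.cumulative u ⟨i - 1, by omega⟩
    simpa [hC, Nat.sub_add_cancel hi.1] using this
  refine ⟨h.nonneg, hm, h.contains, h.indep, ?_, ?_⟩
  · intro u i hi
    rw [sum_theta]
    exact hc u i hi
  · intro u
    refine mean_card_le (one_le_lam u (hp u))
      (fun y => Finset.sum_nonneg fun x _ => h.nonneg u y x) ?_ (hc u)
    rw [Finset.sum_comm, Finset.sum_congr rfl fun x _ => hm u x]
    exact (hp u).2

/-- One round of the greedy construction: mass `v` of the common part `(i₀, x₀)` is covered by the
query `{ch u | u}`, where `ch u` is `x₀` if `u` takes part, and is a request with spare mass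
otherwise. The mass `v` is as large as possible, so it exhausts the common part or a spare mass. -/
structure GreedyRound {N : ℕ} (p C L : Fin N → Fin N → ℝ) (i₀ x₀ : Fin N) (ch : Fin N → Fin N)
    (v : ℝ) : Prop where
  max_common : ∀ i x, C i x ≤ C i₀ x₀
  own : ∀ u, i₀ ≤ rk p u x₀ → ch u = x₀
  max_spare : ∀ u, ¬ i₀ ≤ rk p u x₀ → ∀ x, L u x ≤ L u (ch u)
  le_common : v ≤ C i₀ x₀
  le_spare : ∀ u, ¬ i₀ ≤ rk p u x₀ → v ≤ L u (ch u)
  exhausts : v = C i₀ x₀ ∨ ∃ u, ¬ i₀ ≤ rk p u x₀ ∧ v = L u (ch u)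

/-- The common parts after a round. -/
noncomputable def nextCommon {N : ℕ} (C : Fin N → Fin N → ℝ) (i₀ x₀ : Fin N) (v : ℝ)
    (i x : Fin N) : ℝ := if i = i₀ ∧ x = x₀ then C i x - v else C i x

/-- The spare masses after a round. -/
noncomputable def nextSpare {N : ℕ} (p L : Fin N → Fin N → ℝ) (i₀ x₀ : Fin N)
    (ch : Fin N → Fin N) (v : ℝ) (u x : Fin N) : ℝ :=
  if ¬ i₀ ≤ rk p u x₀ ∧ x = ch u then L u x - v else L u x

/-- The law after a round. -/
noncomputable def nextLaw {N : ℕ} (w : Fin N → Finset (Fin N) → Fin N → ℝ)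
    (ch : Fin N → Fin N) (v : ℝ) (u : Fin N) (y : Finset (Fin N)) (x : Fin N) : ℝ :=
  w u y x + if Finset.univ.image ch = y ∧ ch u = x then v else 0

section Round

variable {N : ℕ} {p C L : Fin N → Fin N → ℝ} {w : Fin N → Finset (Fin N) → Fin N → ℝ}
  {i₀ x₀ : Fin N} {ch : Fin N → Fin N} {v : ℝ}

theorem GreedyRound.nonneg (h : GreedyRound p C L i₀ x₀ ch v) (hC : ∀ i x, 0 ≤ C i x)
    (hL : ∀ u x, 0 ≤ L u x) : 0 ≤ v := by
  rcases h.exhausts with h | ⟨u, -, h⟩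
  · exact h ▸ hC _ _
  · exact h ▸ hL _ _

theorem GreedyRound.card_image_le (h : GreedyRound p C L i₀ x₀ ch v) :
    (Finset.univ.image ch).card ≤ i₀ + 1 := by
  have hsub : Finset.univ.image ch ⊆
      insert x₀ ((Finset.univ.filter fun u => rk p u x₀ < i₀).image ch) := by
    intro x hx
    obtain ⟨u, -, rfl⟩ := Finset.mem_image.1 hx
    by_cases hu : i₀ ≤ rk p u x₀
    · rw [h.own u hu]
      exact Finset.mem_insert_self _ _
    · exact Finset.mem_insert_of_mem (Finset.mem_image_of_mem _ (by simpa using hu))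
  refine (Finset.card_le_card hsub).trans ((Finset.card_insert_le _ _).trans ?_)
  have := Finset.card_image_le (s := Finset.univ.filter fun u => rk p u x₀ < i₀) (f := ch)
  rw [card_filter_rk_lt] at this
  omega

theorem nextCommon_eq (C : Fin N → Fin N → ℝ) (i₀ x₀ : Fin N) (v : ℝ) (i x : Fin N) :
    nextCommon C i₀ x₀ v i x = C i x - if i = i₀ then if x = x₀ then v else 0 else 0 := by
  unfold nextCommon
  by_cases h1 : i = i₀ <;> by_cases h2 : x = x₀ <;> simp [h1, h2]

theorem sum_nextLaw (w : Fin N → Finset (Fin N) → Fin N → ℝ) (ch : Fin N → Fin N) (v : ℝ)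
    (u : Fin N) (y : Finset (Fin N)) :
    ∑ x, nextLaw w ch v u y x =
      ∑ x, w u y x + if Finset.univ.image ch = y then v else 0 := by
  simp only [nextLaw, Finset.sum_add_distrib, add_right_inj]
  by_cases h : Finset.univ.image ch = y <;> simp [h]

/-- The law of the query stays independent of `u` since the round adds the same query for all `u`,
and it stays small since `i₀` values of `u` at most take no part. -/
theorem PartialQuery.next (h : PartialQuery p C L w) (hr : GreedyRound p C L i₀ x₀ ch v) :
    PartialQuery p (nextCommon C i₀ x₀ v) (nextSpare p L i₀ x₀ ch v) (nextLaw w ch v) := by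
  have hv : 0 ≤ v := hr.nonneg h.common_nonneg h.spare_nonneg
  refine ⟨?_, ?_, ?_, ?_, ?_, ?_, ?_, ?_⟩
  · intro i x
    unfold nextCommon
    split_ifs with h1
    · rw [h1.1, h1.2]
      exact sub_nonneg.2 hr.le_common
    · exact h.common_nonneg i x
  · intro u x
    unfold nextSpare
    split_ifs with h1
    · rw [h1.2]
      exact sub_nonneg.2 (hr.le_spare u h1.1)
    · exact h.spare_nonneg u x
  · intro u
    have e1 : ∀ x, nextSpare p L i₀ x₀ ch v u x =
        L u x - if x = ch u then if i₀ ≤ rk p u x₀ then 0 else v else 0 := by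
      intro x
      unfold nextSpare
      by_cases h1 : i₀ ≤ rk p u x₀ <;> by_cases h2 : x = ch u <;> simp [h1, h2]
    have e2 : ∀ i x, (if i ≤ rk p u x then 0 else nextCommon C i₀ x₀ v i x) =
        (if i ≤ rk p u x then 0 else C i x) -
          if i = i₀ then if x = x₀ then if i₀ ≤ rk p u x₀ then 0 else v else 0 else 0 := by
      intro i x
      rw [nextCommon_eq]
      by_cases h1 : i = i₀
      · by_cases h2 : x = x₀
        · subst h1 h2
          by_cases h3 : i ≤ rk p u x <;> simp [h3]
        · simp [h2]
      · simp [h1]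
    simp only [e1, e2, Finset.sum_sub_distrib, h.balance u]
    simp
  · intro u y x
    unfold nextLaw
    have := h.nonneg u y x
    split_ifs <;> linarith
  · intro u x
    have e1 : ∑ y, nextLaw w ch v u y x = ∑ y, w u y x + if ch u = x then v else 0 := by
      simp only [nextLaw, Finset.sum_add_distrib, add_right_inj]
      by_cases h : ch u = x <;> simp [h]
    have e2 : ∀ i, (if i ≤ rk p u x then nextCommon C i₀ x₀ v i x else 0) =
        (if i ≤ rk p u x then C i x else 0) -
          if i = i₀ then if x = x₀ ∧ i₀ ≤ rk p u x₀ then v else 0 else 0 := by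
      intro i
      rw [nextCommon_eq]
      by_cases h1 : i = i₀
      · by_cases h2 : x = x₀
        · subst h1 h2
          by_cases h3 : i ≤ rk p u x <;> simp [h3]
        · simp [h2]
      · simp [h1]
    rw [e1, ← h.marginal u x]
    simp only [e2, Finset.sum_sub_distrib]
    unfold nextSpare
    by_cases h1 : i₀ ≤ rk p u x₀
    · have := hr.own u h1
      by_cases h2 : x = x₀
      · subst h2
        simp [h1, this]
        ring
      · simp [h1, this, Ne.symm h2, h2]
    · by_cases h2 : ch u = x
      · subst h2
        simp only [h1]
        simp
      · simp [h1, h2, Ne.symm h2]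
  · intro u y x hx
    rw [nextLaw, h.contains u y x hx, zero_add]
    refine if_neg ?_
    rintro ⟨rfl, rfl⟩
    exact hx (Finset.mem_image_of_mem _ (Finset.mem_univ u))
  · intro y u u'
    rw [sum_nextLaw, sum_nextLaw, h.indep y u u']
  · intro u k
    refine (h.cumulative u k).trans ?_
    simp only [sum_nextLaw, Finset.sum_add_distrib, nextCommon_eq, Finset.sum_sub_distrib]
    have e1 : (∑ i : Fin N, if i ≤ k then (∑ x, C i x) -
          ∑ x, (if i = i₀ then if x = x₀ then v else 0 else 0) else 0) =
        (∑ i : Fin N, if i ≤ k then ∑ x, C i x else 0) - if i₀ ≤ k then v else 0 := by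
      rw [eq_sub_iff_add_eq]
      have : (if i₀ ≤ k then v else 0) =
          ∑ i : Fin N, if i = i₀ then if i₀ ≤ k then v else 0 else 0 := by simp
      rw [this, ← Finset.sum_add_distrib]
      refine Finset.sum_congr rfl fun i _ => ?_
      by_cases h1 : i = i₀
      · subst h1
        by_cases h2 : i ≤ k <;> simp [h2]
      · by_cases h2 : i ≤ k <;> simp [h1, h2]
    have e2 : (if i₀ ≤ k then v else 0) ≤
        ∑ y ∈ Finset.univ.filter (fun y : Finset (Fin N) => y.card ≤ k + 1),
          if Finset.univ.image ch = y then v else 0 := by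
      split_ifs with h1
      · rw [Finset.sum_ite_eq, if_pos]
        simp only [Finset.mem_filter, Finset.mem_univ, true_and]
        have := hr.card_image_le
        have : (i₀ : ℕ) ≤ k := h1
        omega
      · exact Finset.sum_nonneg fun y _ => by split_ifs <;> simp [hv]
    rw [e1]
    linarith

open Classical in
/-- The number of common parts and of spare masses that are not exhausted. -/
noncomputable def potential (C L : Fin N → Fin N → ℝ) : ℕ :=
  (Finset.univ.filter fun s : Fin N × Fin N => C s.1 s.2 ≠ 0).card +
    (Finset.univ.filter fun s : Fin N × Fin N => L s.1 s.2 ≠ 0).card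

theorem potential_le (C L : Fin N → Fin N → ℝ) : potential C L ≤ 2 * (N * N) := by
  unfold potential
  have h : ∀ s : Finset (Fin N × Fin N), s.card ≤ N * N := fun s =>
    (Finset.card_le_univ s).trans_eq (by simp)
  have h1 := h (Finset.univ.filter fun s : Fin N × Fin N => C s.1 s.2 ≠ 0)
  have h2 := h (Finset.univ.filter fun s : Fin N × Fin N => L s.1 s.2 ≠ 0)
  omega

/-- A round exhausts a common part or a spare mass, and it revives none. -/
theorem GreedyRound.potential_lt (h : PartialQuery p C L w) (hr : GreedyRound p C L i₀ x₀ ch v)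
    (hC : ∃ i x, C i x ≠ 0) :
    potential (nextCommon C i₀ x₀ v) (nextSpare p L i₀ x₀ ch v) < potential C L := by
  classical
  have hpos : 0 < C i₀ x₀ := by
    obtain ⟨i, x, hix⟩ := hC
    exact ((h.common_nonneg i x).lt_of_ne' hix).trans_le (hr.max_common i x)
  -- the balance provides spare mass to every `u` that takes no part
  have hLpos : ∀ u, ¬ i₀ ≤ rk p u x₀ → 0 < L u (ch u) := by
    intro u hu
    by_contra hn
    have h0 : ∀ x, L u x = 0 := fun x =>
      le_antisymm ((hr.max_spare u hu x).trans (not_lt.1 hn)) (h.spare_nonneg u x)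
    have hb := h.balance u
    simp only [h0, Finset.sum_const_zero] at hb
    have hnn : ∀ i x, 0 ≤ if i ≤ rk p u x then 0 else C i x := by
      intro i x
      split_ifs
      · exact le_rfl
      · exact h.common_nonneg i x
    have h1 := (Finset.sum_eq_zero_iff_of_nonneg
      fun i _ => Finset.sum_nonneg fun x _ => hnn i x).1 hb.symm i₀ (Finset.mem_univ _)
    have h2 := (Finset.sum_eq_zero_iff_of_nonneg fun x _ => hnn i₀ x).1 h1 x₀ (Finset.mem_univ _)
    rw [if_neg hu] at h2
    exact hpos.ne' h2
  have hsubC : (Finset.univ.filter fun s : Fin N × Fin N => nextCommon C i₀ x₀ v s.1 s.2 ≠ 0) ⊆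
      Finset.univ.filter fun s : Fin N × Fin N => C s.1 s.2 ≠ 0 := by
    rintro ⟨i, x⟩ hs
    rw [Finset.mem_filter_univ] at hs ⊢
    unfold nextCommon at hs
    split_ifs at hs with h1
    · dsimp only at h1 ⊢
      rw [h1.1, h1.2]
      exact hpos.ne'
    · exact hs
  have hsubL : (Finset.univ.filter fun s : Fin N × Fin N =>
      nextSpare p L i₀ x₀ ch v s.1 s.2 ≠ 0) ⊆
      Finset.univ.filter fun s : Fin N × Fin N => L s.1 s.2 ≠ 0 := by
    rintro ⟨u, x⟩ hs
    rw [Finset.mem_filter_univ] at hs ⊢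
    unfold nextSpare at hs
    split_ifs at hs with h1
    · dsimp only at h1 ⊢
      rw [h1.2]
      exact (hLpos u h1.1).ne'
    · exact hs
  unfold potential
  rcases hr.exhausts with hv | ⟨u, hu, hv⟩
  · refine add_lt_add_of_lt_of_le (Finset.card_lt_card ⟨hsubC, fun hs => ?_⟩)
      (Finset.card_le_card hsubL)
    have := hs ((Finset.mem_filter_univ (i₀, x₀)).2 hpos.ne')
    rw [Finset.mem_filter_univ] at this
    simp [nextCommon, hv] at this
  · refine add_lt_add_of_le_of_lt (Finset.card_le_card hsubC)
      (Finset.card_lt_card ⟨hsubL, fun hs => ?_⟩)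
    have := hs ((Finset.mem_filter_univ (u, ch u)).2 (hLpos u hu).ne')
    rw [Finset.mem_filter_univ] at this
    simp [nextSpare, hu, hv] at this

/-- Once the common parts are exhausted, a round changes nothing. -/
theorem GreedyRound.nextCommon_eq_zero (h : PartialQuery p C L w)
    (hr : GreedyRound p C L i₀ x₀ ch v) (hC : ∀ i x, C i x = 0) (i x : Fin N) :
    nextCommon C i₀ x₀ v i x = 0 := by
  have h1 := hr.le_common
  rw [hC] at h1
  have h2 : v = 0 := le_antisymm h1 (hr.nonneg h.common_nonneg h.spare_nonneg)
  simp [nextCommon, hC, h2]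

end Round

/-! ### Reasoning about programs -/

/-- The final memory of an execution, without the step count. -/
noncomputable def Prog.exec : Prog → Store → Store
  | .skip, σ => σ
  | .setNat a i j e, σ => σ.setNat a (i.eval σ) (j.eval σ) (e.eval σ)
  | .setReal a i j e, σ => σ.setReal a (i.eval σ) (j.eval σ) (e.eval σ)
  | .seq c c', σ => c'.exec (c.exec σ)
  | .cond b c c', σ => open Classical in if b.Holds σ then c.exec σ else c'.exec σ
  | .loop v e c, σ =>
      (List.range (e.eval σ)).foldl (fun st k => c.exec (st.setNat v 0 0 k)) σ

theorem Prog.exec_seq (c c' : Prog) (σ : Store) :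
    (Prog.seq c c').exec σ = c'.exec (c.exec σ) := rfl

theorem Prog.exec_cond (b : Test) (c c' : Prog) (σ : Store) : (Prog.cond b c c').exec σ =
    open Classical in if b.Holds σ then c.exec σ else c'.exec σ := rfl

theorem Prog.run_fst (c : Prog) (σ : Store) : (c.run σ).1 = c.exec σ := by
  induction c generalizing σ with
  | skip | setNat | setReal => rfl
  | seq c c' h h' => simp only [Prog.run, Prog.exec, h, h']
  | cond b c c' h h' =>
    simp only [Prog.run, Prog.exec]
    split_ifs
    · exact h σ
    · exact h' σ
  | loop v e c h =>
    simp only [Prog.run, Prog.exec]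
    generalize List.range (e.eval σ) = l
    generalize e.cost + 1 = n
    induction l generalizing σ n with
    | nil => rfl
    | cons k l ih => rw [List.foldl_cons, List.foldl_cons, ih, h]

/-- The names of the arrays of natural numbers that a program may change. -/
def Prog.natWrites : Prog → List ℕ
  | .skip => []
  | .setNat a _ _ _ => [a]
  | .setReal _ _ _ _ => []
  | .seq c c' => c.natWrites ++ c'.natWrites
  | .cond _ c c' => c.natWrites ++ c'.natWrites
  | .loop v _ c => v :: c.natWrites

/-- The names of the arrays of real numbers that a program may change. -/
def Prog.realWrites : Prog → List ℕ
  | .skip => []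
  | .setNat _ _ _ _ => []
  | .setReal a _ _ _ => [a]
  | .seq c c' => c.realWrites ++ c'.realWrites
  | .cond _ c c' => c.realWrites ++ c'.realWrites
  | .loop _ _ c => c.realWrites

/-- Two memories agree outside the arrays of natural numbers named in `A` and the arrays of real
numbers named in `B`. -/
structure Agree (A B : List ℕ) (σ τ : Store) : Prop where
  nat : ∀ a ∉ A, τ.nat a = σ.nat a
  real : ∀ a ∉ B, τ.real a = σ.real a

theorem Agree.trans {A B : List ℕ} {σ τ υ : Store} (h : Agree A B σ τ) (h' : Agree A B τ υ) :
    Agree A B σ υ :=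
  ⟨fun a ha => (h'.nat a ha).trans (h.nat a ha), fun a ha => (h'.real a ha).trans (h.real a ha)⟩

theorem Agree.mono {A B A' B' : List ℕ} {σ τ : Store} (h : Agree A B σ τ) (hA : A ⊆ A')
    (hB : B ⊆ B') : Agree A' B' σ τ :=
  ⟨fun a ha => h.nat a fun h' => ha (hA h'), fun a ha => h.real a fun h' => ha (hB h')⟩

theorem Agree.refl (A B : List ℕ) (σ : Store) : Agree A B σ σ :=
  ⟨fun _ _ => rfl, fun _ _ => rfl⟩

theorem agree_setNat (σ : Store) (a i j v : ℕ) : Agree [a] [] σ (σ.setNat a i j v) := by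
  refine ⟨fun b hb => ?_, fun _ _ => rfl⟩
  simp only [List.mem_singleton] at hb
  funext i' j'
  simp [Store.setNat, hb]

theorem agree_setReal (σ : Store) (a i j : ℕ) (v : ℝ) : Agree [] [a] σ (σ.setReal a i j v) := by
  refine ⟨fun _ _ => rfl, fun b hb => ?_⟩
  simp only [List.mem_singleton] at hb
  funext i' j'
  simp [Store.setReal, hb]

/-- An execution leaves alone all arrays that do not occur as targets in the program. -/
theorem Prog.exec_agree (c : Prog) (σ : Store) :
    Agree c.natWrites c.realWrites σ (c.exec σ) := by
  induction c generalizing σ with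
  | skip => exact Agree.refl _ _ _
  | setNat a i j e => exact agree_setNat _ _ _ _ _
  | setReal a i j e => exact agree_setReal _ _ _ _ _
  | seq c c' h h' =>
    exact ((h σ).mono (by simp [natWrites]) (by simp [realWrites])).trans
      ((h' _).mono (by simp [natWrites]) (by simp [realWrites]))
  | cond b c c' h h' =>
    unfold exec
    split_ifs
    · exact (h σ).mono (by simp [natWrites]) (by simp [realWrites])
    · exact (h' σ).mono (by simp [natWrites]) (by simp [realWrites])
  | loop v e c h =>
    unfold exec
    generalize List.range (e.eval σ) = l
    induction l generalizing σ with
    | nil => exact Agree.refl _ _ _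
    | cons k l ih =>
      rw [List.foldl_cons]
      refine Agree.trans (Agree.trans ((agree_setNat σ v 0 0 k).mono ?_ ?_)
        ((h _).mono ?_ ?_)) (ih _) <;> simp [natWrites, realWrites]

/-- The invariant rule for loops. The memory at the start of a round may be taken to agree with the
initial one outside the arrays that the loop writes. -/
theorem Prog.exec_loop_inv {v : ℕ} {e : NExpr} {c : Prog} {σ : Store} (Inv : ℕ → Store → Prop)
    (h0 : Inv 0 σ)
    (hs : ∀ k < e.eval σ, ∀ τ, Agree (v :: c.natWrites) c.realWrites σ τ → Inv k τ →
      Inv (k + 1) (c.exec (τ.setNat v 0 0 k))) :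
    Inv (e.eval σ) ((Prog.loop v e c).exec σ) := by
  have key : ∀ n ≤ e.eval σ,
      Agree (v :: c.natWrites) c.realWrites σ
        ((List.range n).foldl (fun st k => c.exec (st.setNat v 0 0 k)) σ) ∧
      Inv n ((List.range n).foldl (fun st k => c.exec (st.setNat v 0 0 k)) σ) := by
    intro n hn
    induction n with
    | zero => exact ⟨Agree.refl _ _ _, h0⟩
    | succ n ih =>
      obtain ⟨h1, h2⟩ := ih (by omega)
      rw [List.range_succ, List.foldl_append]
      refine ⟨(h1.trans ((agree_setNat _ v 0 0 n).mono ?_ ?_)).trans ((c.exec_agree _).mono ?_ ?_),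
        hs n hn _ h1 h2⟩ <;> simp
  exact (key _ le_rfl).2

/-- The cell that holds the number `N` of sources. -/
def size : NExpr := .cell 0 (.lit 0) (.lit 0)

/-- The value of a variable, which is stored in the cell `(0, 0)` of the array of that name. -/
def var (v : ℕ) : NExpr := .cell v (.lit 0) (.lit 0)

/-- Execution of `c` for all values of `v` below `N`. -/
def forAll (v : ℕ) (c : Prog) : Prog := .loop v size c

@[simp] theorem eval_size (σ : Store) : size.eval σ = σ.nat 0 0 0 := rfl

@[simp] theorem eval_var (σ : Store) (v : ℕ) : (var v).eval σ = σ.nat v 0 0 := rfl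

/-- All loops have `N` rounds. -/
def Prog.SizeLoops : Prog → Prop
  | .skip => True
  | .setNat _ _ _ _ => True
  | .setReal _ _ _ _ => True
  | .seq c c' => c.SizeLoops ∧ c'.SizeLoops
  | .cond _ c c' => c.SizeLoops ∧ c'.SizeLoops
  | .loop _ e c => e = size ∧ c.SizeLoops

/-- A bound on the number of steps of a program all of whose loops have `N` rounds. -/
noncomputable def Prog.costPoly : Prog → Polynomial ℕ
  | .skip => 1
  | .setNat _ i j e => Polynomial.C (i.cost + j.cost + e.cost + 1)
  | .setReal _ i j e => Polynomial.C (i.cost + j.cost + e.cost + 1)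
  | .seq c c' => c.costPoly + c'.costPoly + 1
  | .cond b c c' => Polynomial.C b.cost + (c.costPoly + c'.costPoly) + 1
  | .loop _ e c => Polynomial.C (e.cost + 1) + Polynomial.X * (c.costPoly + 1)

theorem Prog.run_snd_le (c : Prog) (hc : c.SizeLoops) (h0 : 0 ∉ c.natWrites) (σ : Store) :
    (c.run σ).2 ≤ c.costPoly.eval (σ.nat 0 0 0) := by
  induction c generalizing σ with
  | skip => simp [run, costPoly]
  | setNat | setReal => simp [run, costPoly]
  | seq c c' h h' =>
    simp only [natWrites, List.mem_append, not_or] at h0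
    have h1 := h hc.1 h0.1 σ
    have h2 := h' hc.2 h0.2 (c.exec σ)
    rw [(c.exec_agree σ).nat 0 h0.1] at h2
    simp only [run, costPoly, run_fst, Polynomial.eval_add, Polynomial.eval_one]
    omega
  | cond b c c' h h' =>
    simp only [natWrites, List.mem_append, not_or] at h0
    have h1 := h hc.1 h0.1 σ
    have h2 := h' hc.2 h0.2 σ
    simp only [run, costPoly, Polynomial.eval_add, Polynomial.eval_one, Polynomial.eval_C]
    split_ifs <;> omega
  | loop v e c h =>
    obtain ⟨rfl, hc⟩ := hc
    simp only [natWrites, List.mem_cons, not_or] at h0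
    simp only [run, costPoly, Polynomial.eval_add, Polynomial.eval_one, Polynomial.eval_C,
      Polynomial.eval_mul, Polynomial.eval_X, eval_size]
    have key : ∀ (l : List ℕ) (τ : Store) (n : ℕ), τ.nat 0 0 0 = σ.nat 0 0 0 →
        (l.foldl (fun (st : Store × ℕ) k => ((c.run (st.1.setNat v 0 0 k)).1,
          st.2 + (c.run (st.1.setNat v 0 0 k)).2 + 1)) (τ, n)).2 ≤
          n + l.length * (c.costPoly.eval (σ.nat 0 0 0) + 1) := by
      intro l
      induction l with
      | nil => intro τ n _; simp
      | cons k l ih =>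
        intro τ n hτ
        have e0 : (τ.setNat v 0 0 k).nat 0 0 0 = σ.nat 0 0 0 := by
          rw [(agree_setNat τ v 0 0 k).nat 0 (by simpa using h0.1), hτ]
        have h1 := h hc h0.2 (τ.setNat v 0 0 k)
        rw [e0] at h1
        rw [List.foldl_cons]
        refine (ih _ _ ?_).trans ?_
        · rw [run_fst, (c.exec_agree _).nat 0 h0.2, e0]
        · rw [List.length_cons, add_mul, one_mul]
          dsimp only
          omega
    simpa using key (List.range (σ.nat 0 0 0)) σ (size.cost + 1) rfl

theorem forAll_inv {v : ℕ} {c : Prog} {σ : Store} {N : ℕ} (hN : σ.nat 0 0 0 = N)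
    (Inv : ℕ → Store → Prop) (h0 : Inv 0 σ)
    (hs : ∀ k < N, ∀ τ, Agree (v :: c.natWrites) c.realWrites σ τ → Inv k τ →
      Inv (k + 1) (c.exec (τ.setNat v 0 0 k))) :
    Inv N ((forAll v c).exec σ) := by
  subst hN
  exact Prog.exec_loop_inv (v := v) (e := size) (c := c) Inv h0 hs

/-- The invariant rule for two nested loops, which visit the pairs `(i, j)` row by row. -/
theorem forAll_forAll_inv {v v' : ℕ} {c : Prog} {σ : Store} {N : ℕ} (hN : σ.nat 0 0 0 = N)
    (hv : v ∉ 0 :: v' :: c.natWrites) (hv' : 0 ∉ v' :: c.natWrites)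
    (Inv : ℕ → ℕ → Store → Prop) (h0 : Inv 0 0 σ)
    (hset : ∀ i k τ, Inv i 0 τ → Inv i 0 (τ.setNat v 0 0 k))
    (hs : ∀ i < N, ∀ j < N, ∀ τ, Agree (v :: v' :: c.natWrites) c.realWrites σ τ →
      τ.nat v 0 0 = i → Inv i j τ → Inv i (j + 1) (c.exec (τ.setNat v' 0 0 j)))
    (hrow : ∀ i τ, Inv i N τ → Inv (i + 1) 0 τ) :
    Inv N 0 ((forAll v (forAll v' c)).exec σ) := by
  refine forAll_inv hN (fun i => Inv i 0) h0 fun i hi τ hτ hI => hrow i _ ?_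
  simp only [List.mem_cons, not_or] at hv hv'
  have e0 : (τ.setNat v 0 0 i).nat 0 0 0 = N := by
    rw [(agree_setNat τ v 0 0 i).nat 0 (by simpa using Ne.symm hv.1), ← hN,
      hτ.nat 0 (by simp [forAll, Prog.natWrites, hv', Ne.symm hv.1])]
  refine forAll_inv e0 (Inv i) (hset _ _ _ hI) fun j hj υ hυ hI' => ?_
  refine hs i hi j hj υ ((hτ.trans ((agree_setNat τ v 0 0 i).mono ?_ ?_)).trans
    (hυ.mono ?_ ?_)) ?_ hI'
  · simp
  · simp
  · simp [forAll, Prog.natWrites]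
  · simp [forAll, Prog.realWrites]
  · rw [hυ.nat v (by simp [hv])]
    simp [Store.setNat]

@[simp] theorem setNat_nat (σ : Store) (a i j v a' i' j' : ℕ) :
    (σ.setNat a i j v).nat a' i' j' = if a' = a ∧ i' = i ∧ j' = j then v else σ.nat a' i' j' :=
  rfl

@[simp] theorem setNat_real (σ : Store) (a i j v : ℕ) : (σ.setNat a i j v).real = σ.real := rfl

@[simp] theorem setReal_nat (σ : Store) (a i j : ℕ) (v : ℝ) :
    (σ.setReal a i j v).nat = σ.nat := rfl

@[simp] theorem setReal_real (σ : Store) (a i j : ℕ) (v : ℝ) (a' i' j' : ℕ) :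
    (σ.setReal a i j v).real a' i' j' =
      if a' = a ∧ i' = i ∧ j' = j then v else σ.real a' i' j' :=
  rfl

/-! ### The program: ranks, common parts and spare masses -/

/-!
The program keeps its data in the following arrays. Natural numbers: `0` holds `N`, `1` the number
of records, `2`, `3`, `4` their entries `x`, `u`, `y`, `5` the ranks, `6` the requests chosen in a
round, `7` and `8` the common part picked in a round, and `10` to `14` the loop variables. Real
numbers: `0` is the input, `1` the masses of the records, `2` the order statistics, `3` the common
parts, `4` the spare masses, `5` and `6` running sums, and `7` the mass of a round.
-/

/-- Adds one to the rank of the entry `(u, x)` if the entry `(u', x)` precedes it in its column;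
here `u`, `x`, `u'` are the variables `10`, `11`, `12`. -/
def rankStep : Prog :=
  .cond
    (.neg (.conj (.realLe (.cell 0 (var 10) (var 11)) (.cell 0 (var 12) (var 11)))
      (.neg (.conj (.realLe (.cell 0 (var 12) (var 11)) (.cell 0 (var 10) (var 11)))
        (.natLe (.add (var 12) (.lit 1)) (var 10))))))
    (.setNat 5 (var 10) (var 11) (.add (.cell 5 (var 10) (var 11)) (.lit 1)))
    .skip

/-- Computes the ranks of the entries in their columns (array `5`) and the order statistics of the
columns (array `2`, from row `1` on). -/
def rankProg : Prog :=
  forAll 10 (forAll 11 (.seq (forAll 12 rankStep)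
    (.setReal 2 (.add (.cell 5 (var 10) (var 11)) (.lit 1)) (var 11) (.cell 0 (var 10) (var 11)))))

theorem card_filter_lt_succ {N : ℕ} (P : Fin N → Prop) [DecidablePred P] {k : ℕ} (hk : k < N) :
    (Finset.univ.filter fun u : Fin N => (u : ℕ) < k + 1 ∧ P u).card =
      (Finset.univ.filter fun u : Fin N => (u : ℕ) < k ∧ P u).card +
        if P ⟨k, hk⟩ then 1 else 0 := by
  have h : ∀ n : ℕ, (Finset.univ.filter fun u : Fin N => (u : ℕ) < n ∧ P u) =
      (Finset.univ.filter P).filter fun u : Fin N => (u : ℕ) < n := by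
    intro n
    ext u
    simp [and_comm]
  have h2 : (Finset.univ.filter fun u : Fin N => (u : ℕ) < k + 1 ∧ P u) =
      (Finset.univ.filter fun u : Fin N => (u : ℕ) < k ∧ P u) ∪
        (Finset.univ.filter fun u : Fin N => u = ⟨k, hk⟩ ∧ P u) := by
    ext u
    simp only [Finset.mem_filter_univ, Finset.mem_union, Fin.ext_iff, Nat.lt_succ_iff_lt_or_eq,
      or_and_right]
  rw [h2, Finset.card_union_of_disjoint]
  · congr 1
    split_ifs with hP
    · rw [Finset.card_eq_one]
      refine ⟨⟨k, hk⟩, ?_⟩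
      ext u
      simp only [Finset.mem_filter_univ, Finset.mem_singleton, and_iff_left_iff_imp]
      rintro rfl
      exact hP
    · rw [Finset.card_eq_zero, Finset.filter_eq_empty_iff]
      rintro u - ⟨rfl, hu⟩
      exact hP hu
  · rw [Finset.disjoint_left]
    intro u hu hu'
    rw [Finset.mem_filter_univ] at hu hu'
    rw [hu'.1] at hu
    exact lt_irrefl _ hu.1

theorem rank_inner {N : ℕ} (p : Fin N → Fin N → ℝ) (u x : Fin N) {σ : Store}
    (hN : σ.nat 0 0 0 = N) (hp : ∀ u x : Fin N, σ.real 0 u x = p u x)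
    (hu : σ.nat 10 0 0 = u) (hx : σ.nat 11 0 0 = x) (h0 : σ.nat 5 u x = 0) :
    ((forAll 12 rankStep).exec σ).nat 5 u x = rk p u x ∧
    ∀ i j, ¬ (i = (u : ℕ) ∧ j = (x : ℕ)) →
      ((forAll 12 rankStep).exec σ).nat 5 i j = σ.nat 5 i j := by
  have key := forAll_inv (v := 12) (σ := σ) hN
    (c := rankStep)
    (fun k τ => τ.nat 5 u x =
        (Finset.univ.filter fun u' : Fin N => (u' : ℕ) < k ∧ rk p u' x < rk p u x).card ∧
      ∀ i j, ¬ (i = (u : ℕ) ∧ j = (x : ℕ)) → τ.nat 5 i j = σ.nat 5 i j) ?_ ?_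
  · refine ⟨?_, key.2⟩
    rw [key.1]
    simp only [Fin.is_lt, true_and]
    exact card_filter_rk_lt p x _
  · simp [h0]
  · rintro k hk τ hτ ⟨h1, h2⟩
    have e1 : τ.nat 10 0 0 = u := by rw [hτ.nat 10 (by decide), hu]
    have e2 : τ.nat 11 0 0 = x := by rw [hτ.nat 11 (by decide), hx]
    have e3 : ∀ u x : Fin N, τ.real 0 u x = p u x := by
      intro u x
      rw [hτ.real 0 (by decide), hp]
    have ek : τ.real 0 k x = p ⟨k, hk⟩ x := e3 ⟨k, hk⟩ x
    have hlt : rk p ⟨k, hk⟩ x < rk p u x ↔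
        p u x ≤ p ⟨k, hk⟩ x → p ⟨k, hk⟩ x ≤ p u x ∧ k + 1 ≤ u := by
      rw [rk_lt_rk_iff, ← not_le, Fin.lt_def]
      change _ ∨ _ ∧ k < (u : ℕ) ↔ _
      rw [Nat.succ_le_iff]
      tauto
    rw [card_filter_lt_succ _ hk]
    simp only [hlt, rankStep, Prog.exec, Test.Holds, RExpr.eval, NExpr.eval, eval_var,
      setNat_nat, setNat_real]
    simp only [e1, e2]
    norm_num [e1, e2, e3, ek]
    split_ifs with h
    · simp only [setNat_nat, h1]
      norm_num
      intro i j hij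
      rw [if_neg fun h => hij h.1 h.2]
      exact h2 i j fun h => hij h.1 h.2
    · simpa [h1] using h2

theorem rankProg_spec {N : ℕ} (p : Fin N → Fin N → ℝ) {σ : Store}
    (hN : σ.nat 0 0 0 = N) (hp : ∀ u x : Fin N, σ.real 0 u x = p u x)
    (h5 : ∀ i j, σ.nat 5 i j = 0) (h2 : ∀ i j, σ.real 2 i j = 0) :
    (∀ u x : Fin N, (rankProg.exec σ).nat 5 u x = rk p u x) ∧
    ∀ i ≤ N, ∀ x < N, (rankProg.exec σ).real 2 i x = layerTop p i x := by
  have key := forAll_forAll_inv (v := 10) (v' := 11) (σ := σ) hN (by decide) (by decide)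
    (c := .seq (forAll 12 rankStep)
      (.setReal 2 (.add (.cell 5 (var 10) (var 11)) (.lit 1)) (var 11)
        (.cell 0 (var 10) (var 11))))
    (fun k l τ => (∀ x, τ.real 2 0 x = 0) ∧ ∀ u x : Fin N,
      if (u : ℕ) < k ∨ (u : ℕ) = k ∧ (x : ℕ) < l then
        τ.nat 5 u x = rk p u x ∧ τ.real 2 (rk p u x + 1) x = p u x
      else τ.nat 5 u x = 0) ?_ ?_ ?_ ?_
  · obtain ⟨k0, key⟩ := key
    refine ⟨fun u x => ?_, fun i hi x hx => ?_⟩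
    · have := key u x
      rw [if_pos (Or.inl u.isLt)] at this
      exact this.1
    · rcases Nat.eq_zero_or_pos i with rfl | hpos
      · rw [layerTop_zero]
        exact k0 x
      · set u : Fin N := Tuple.sort (fun u => p u ⟨x, hx⟩) ⟨i - 1, by omega⟩ with hu
        have hrk : rk p u ⟨x, hx⟩ = ⟨i - 1, by omega⟩ := by simp [rk, hu]
        have := key u ⟨x, hx⟩
        rw [if_pos (Or.inl u.isLt)] at this
        have e := layerTop_rk p u ⟨x, hx⟩
        rw [← this.2, hrk] at e
        simp only [Nat.sub_add_cancel hpos] at e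
        exact e.symm
  · refine ⟨h2 0, fun u x => ?_⟩
    simp [h5]
  · intro i k τ h
    simpa using h
  · rintro i hi j hj τ hτ hv ⟨k0, h⟩
    have hN' : τ.nat 0 0 0 = N := by rw [hτ.nat 0 (by decide), hN]
    have hp' : ∀ u x : Fin N, τ.real 0 u x = p u x := by
      intro u x
      rw [hτ.real 0 (by decide), hp]
    have hz : τ.nat 5 i j = 0 := by
      have := h ⟨i, hi⟩ ⟨j, hj⟩
      rwa [if_neg (by simp)] at this
    obtain ⟨r1, r2⟩ := rank_inner p ⟨i, hi⟩ ⟨j, hj⟩ (σ := τ.setNat 11 0 0 j) (by simpa using hN')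
      hp' (by simpa using hv) (by simp) (by simpa using hz)
    set υ := (forAll 12 rankStep).exec (τ.setNat 11 0 0 j) with hυ
    have ha := (forAll 12 rankStep).exec_agree (τ.setNat 11 0 0 j)
    rw [← hυ] at ha
    have e10 : υ.nat 10 0 0 = i := by
      rw [ha.nat 10 (by decide)]
      simpa using hv
    have e11 : υ.nat 11 0 0 = j := by
      rw [ha.nat 11 (by decide)]
      simp
    have er : ∀ a, υ.real a = τ.real a := fun a => by
      rw [ha.real a (by simp [forAll, rankStep, Prog.realWrites])]
      rfl
    have ep : τ.real 0 i j = p ⟨i, hi⟩ ⟨j, hj⟩ := hp' ⟨i, hi⟩ ⟨j, hj⟩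
    dsimp only at r1 r2
    simp only [Prog.exec, RExpr.eval, NExpr.eval, eval_var, setReal_real, setReal_nat, ← hυ,
      e10, e11, er, r1, ep, true_and]
    refine ⟨fun x => by simpa using k0 x, fun u x => ?_⟩
    by_cases hux : (u : ℕ) = i ∧ (x : ℕ) = j
    · obtain ⟨rfl, rfl⟩ := hux
      rw [if_pos (Or.inr ⟨rfl, Nat.lt_succ_self _⟩), if_pos ⟨rfl, rfl⟩]
      exact ⟨r1, rfl⟩
    · have hcond : ((u : ℕ) < i ∨ (u : ℕ) = i ∧ (x : ℕ) < j + 1) ↔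
          ((u : ℕ) < i ∨ (u : ℕ) = i ∧ (x : ℕ) < j) := by omega
      have h' := h u x
      rw [r2 u x hux]
      simp only [hcond]
      split_ifs at h' ⊢ with h3 h4
      · obtain ⟨h4, h5⟩ := h4
        have hx : x = ⟨j, hj⟩ := Fin.ext h5
        subst hx
        have h6 : rk p u ⟨j, hj⟩ = rk p ⟨i, hi⟩ ⟨j, hj⟩ := Fin.ext (Nat.succ_injective h4)
        have h7 : u = ⟨i, hi⟩ := (Tuple.sort fun u => p u ⟨j, hj⟩).symm.injective h6
        subst h7
        exact absurd ⟨rfl, rfl⟩ hux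
      · exact ⟨by simpa using h'.1, h'.2⟩
      · simpa using h'
  · rintro i τ ⟨h1, h⟩
    refine ⟨h1, fun u x => ?_⟩
    have hcond : ((u : ℕ) < i + 1 ∨ (u : ℕ) = i + 1 ∧ (x : ℕ) < 0) ↔
        ((u : ℕ) < i ∨ (u : ℕ) = i ∧ (x : ℕ) < N) := by
      have := x.isLt
      omega
    simp only [hcond]
    exact h u x

/-- Computes the common part of the variables `10` and `11` (array `3`). The cells `(0, 0)` of the
arrays `5` and `6` hold the mass of the preceding layers and its minimum with `1`. -/
def commonStep : Prog :=
  .seq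
    (.setReal 5 (.lit 0) (.lit 0) (.add (.cell 5 (.lit 0) (.lit 0))
      (.sub (.cell 2 (.add (var 10) (.lit 1)) (var 11)) (.cell 2 (var 10) (var 11)))))
    (.seq
      (.cond (.realLe .one (.cell 5 (.lit 0) (.lit 0)))
        (.setReal 3 (var 10) (var 11) (.sub .one (.cell 6 (.lit 0) (.lit 0))))
        (.setReal 3 (var 10) (var 11)
          (.sub (.cell 5 (.lit 0) (.lit 0)) (.cell 6 (.lit 0) (.lit 0)))))
      (.setReal 6 (.lit 0) (.lit 0)
        (.add (.cell 6 (.lit 0) (.lit 0)) (.cell 3 (var 10) (var 11)))))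

/-- Computes all common parts. -/
def commonProg : Prog := forAll 10 (forAll 11 commonStep)

theorem commonProg_spec {N : ℕ} (p : Fin N → Fin N → ℝ) {σ : Store}
    (hN : σ.nat 0 0 0 = N) (h2 : ∀ i ≤ N, ∀ x < N, σ.real 2 i x = layerTop p i x)
    (h5 : σ.real 5 0 0 = 0) (h6 : σ.real 6 0 0 = 0) (i x : Fin N) :
    (commonProg.exec σ).real 3 i x = common p i x := by
  have key := forAll_forAll_inv (v := 10) (v' := 11) (σ := σ) hN (by decide) (by decide)
    (c := commonStep)
    (fun k l τ => τ.real 5 0 0 = rowAcc N (layer p) k l ∧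
      τ.real 6 0 0 = min 1 (rowAcc N (layer p) k l) ∧
      ∀ i x, x < N → i < k ∨ i = k ∧ x < l → τ.real 3 i x = truncMass N (layer p) i x) ?_ ?_ ?_ ?_
  · exact key.2.2 i x x.isLt (Or.inl i.isLt)
  · simp [h5, h6, rowAcc]
  · intro i k τ h
    simpa using h
  · rintro i hi j hj τ hτ hv ⟨r5, r6, r3⟩
    have e2 : ∀ i ≤ N, ∀ x < N, τ.real 2 i x = layerTop p i x := by
      rw [hτ.real 2 (by decide)]
      exact h2
    have hacc : rowAcc N (layer p) i j + (layerTop p (i + 1) j - layerTop p i j) =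
        rowAcc N (layer p) i (j + 1) := (rowAcc_succ _ _ _ _).symm
    simp only [commonStep, Prog.exec, Test.Holds, RExpr.eval, NExpr.eval, eval_var, setReal_real,
      setReal_nat, setNat_nat, setNat_real]
    norm_num [hv, e2 i hi.le j hj, e2 (i + 1) hi j hj, r5, r6, hacc]
    have htr : ∀ i' x, x < N → i' < i ∨ i' = i ∧ x ≤ j →
        (if i' = i ∧ x = j then truncMass N (layer p) i j else τ.real 3 i' x) =
          truncMass N (layer p) i' x := by
      intro i' x hx h
      split_ifs with h'
      · rw [h'.1, h'.2]
      · exact r3 i' x hx (by omega)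
    by_cases h : 1 ≤ rowAcc N (layer p) i (j + 1)
    · have ht : 1 - min 1 (rowAcc N (layer p) i j) = truncMass N (layer p) i j := by
        rw [truncMass, min_eq_left h]
      simp only [h, if_true]
      norm_num [r5, r6, hacc, hv]
      rw [ht]
      exact ⟨h, htr⟩
    · have ht : rowAcc N (layer p) i (j + 1) - min 1 (rowAcc N (layer p) i j) =
          truncMass N (layer p) i j := by
        rw [truncMass, min_eq_right (not_le.1 h).le]
      simp only [h, if_false]
      norm_num [r5, r6, hacc, hv]
      rw [ht]
      exact ⟨(not_le.1 h).le, htr⟩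
  · rintro i τ ⟨r5, r6, r3⟩
    rw [← rowAcc_full]
    exact ⟨r5, r6, fun i' x hx h => r3 i' x hx (by omega)⟩

/-- Subtracts the common part of the variables `12` and `11` from the spare mass of the variables
`10` and `11` if `10` takes part in it. -/
def spareStep : Prog :=
  .cond (.natLe (var 12) (.cell 5 (var 10) (var 11)))
    (.setReal 4 (var 10) (var 11) (.sub (.cell 4 (var 10) (var 11)) (.cell 3 (var 12) (var 11))))
    .skip

/-- Computes the spare masses (array `4`). -/
def spareProg : Prog :=
  forAll 10 (forAll 11 (.seq (.setReal 4 (var 10) (var 11) (.cell 0 (var 10) (var 11)))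
    (forAll 12 spareStep)))

theorem spareProg_spec {N : ℕ} (p : Fin N → Fin N → ℝ) {σ : Store}
    (hN : σ.nat 0 0 0 = N) (hp : ∀ u x : Fin N, σ.real 0 u x = p u x)
    (h5 : ∀ u x : Fin N, σ.nat 5 u x = rk p u x)
    (h3 : ∀ i x : Fin N, σ.real 3 i x = common p i x) (u x : Fin N) :
    (spareProg.exec σ).real 4 u x = spare p u x := by
  have key := forAll_forAll_inv (v := 10) (v' := 11) (σ := σ) hN (by decide) (by decide)
    (c := .seq (.setReal 4 (var 10) (var 11) (.cell 0 (var 10) (var 11)))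
      (forAll 12 spareStep))
    (fun k l τ => ∀ u x : Fin N, (u : ℕ) < k ∨ (u : ℕ) = k ∧ (x : ℕ) < l →
      τ.real 4 u x = spare p u x) ?_ ?_ ?_ ?_
  · exact key u x (Or.inl u.isLt)
  · simp
  · intro i k τ h
    simpa using h
  · intro i hi j hj τ hτ hv h
    have hN' : τ.nat 0 0 0 = N := by rw [hτ.nat 0 (by decide), hN]
    have e0 : τ.real 0 i j = p ⟨i, hi⟩ ⟨j, hj⟩ := by
      rw [hτ.real 0 (by decide)]
      exact hp ⟨i, hi⟩ ⟨j, hj⟩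
    have e5 : τ.nat 5 i j = rk p ⟨i, hi⟩ ⟨j, hj⟩ := by
      rw [hτ.nat 5 (by decide)]
      exact h5 ⟨i, hi⟩ ⟨j, hj⟩
    have e3 : ∀ i x : Fin N, τ.real 3 i x = common p i x := by
      rw [hτ.real 3 (by decide)]
      exact h3
    rw [Prog.exec]
    set υ := (Prog.setReal 4 (var 10) (var 11) (.cell 0 (var 10) (var 11))).exec
      (τ.setNat 11 0 0 j) with hυ
    have hυn : υ.nat = (τ.setNat 11 0 0 j).nat := rfl
    have hυr : ∀ a b c, υ.real a b c = if a = 4 ∧ b = i ∧ c = j then p ⟨i, hi⟩ ⟨j, hj⟩ else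
        τ.real a b c := by
      intro a b c
      simp [hυ, Prog.exec, RExpr.eval, hv, e0]
    have inner := forAll_inv (v := 12) (σ := υ) (N := N) (by simp [hυn, hN'])
      (c := spareStep)
      (fun m ρ => ρ.real 4 i j = p ⟨i, hi⟩ ⟨j, hj⟩ -
          (∑ a : Fin N, if (a : ℕ) < m then if a ≤ rk p ⟨i, hi⟩ ⟨j, hj⟩ then
            common p a ⟨j, hj⟩ else 0 else 0) ∧
        ∀ b c, ¬ (b = i ∧ c = j) → ρ.real 4 b c = τ.real 4 b c) ?_ ?_
    · intro u x hux
      by_cases hu : (u : ℕ) = i ∧ (x : ℕ) = j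
      · obtain ⟨rfl, rfl⟩ := hu
        rw [inner.1, spare]
        simp
      · rw [inner.2 _ _ hu]
        exact h u x (by omega)
    · simp only [hυr]
      refine ⟨by simp, fun b c hbc => by simp [hbc]⟩
    · rintro m hm ρ hρ ⟨g1, g2⟩
      have f10 : ρ.nat 10 0 0 = i := by rw [hρ.nat 10 (by decide), hυn]; simpa using hv
      have f11 : ρ.nat 11 0 0 = j := by rw [hρ.nat 11 (by decide), hυn]; simp
      have f5 : ρ.nat 5 i j = rk p ⟨i, hi⟩ ⟨j, hj⟩ := by
        rw [hρ.nat 5 (by decide), hυn]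
        simpa using e5
      have f3 : ρ.real 3 m j = common p ⟨m, hm⟩ ⟨j, hj⟩ := by
        rw [hρ.real 3 (by decide), hυr]
        simpa using e3 ⟨m, hm⟩ ⟨j, hj⟩
      have hsum : ∀ f : Fin N → ℝ, (∑ a : Fin N, if (a : ℕ) < m + 1 then f a else 0) =
          (∑ a : Fin N, if (a : ℕ) < m then f a else 0) + f ⟨m, hm⟩ := by
        intro f
        have : f ⟨m, hm⟩ = ∑ a : Fin N, if a = ⟨m, hm⟩ then f a else 0 := by simp
        rw [this, ← Finset.sum_add_distrib]
        refine Finset.sum_congr rfl fun a _ => ?_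
        rcases lt_trichotomy (a : ℕ) m with h' | h' | h'
        · have : a ≠ ⟨m, hm⟩ := fun e => by simp [e] at h'
          simp [this, h', h'.trans (Nat.lt_succ_self m)]
        · have : a = ⟨m, hm⟩ := Fin.ext h'
          simp [this]
        · have : a ≠ ⟨m, hm⟩ := fun e => by simp [e] at h'
          simp [this, h'.not_gt, (Nat.succ_le_of_lt h').not_gt]
      rw [hsum]
      simp only [spareStep, Prog.exec, Test.Holds, RExpr.eval, NExpr.eval, eval_var, setNat_nat,
        setNat_real]
      norm_num [f10, f11, f5, f3, g1]
      have hle : m ≤ (rk p ⟨i, hi⟩ ⟨j, hj⟩ : ℕ) ↔ ⟨m, hm⟩ ≤ rk p ⟨i, hi⟩ ⟨j, hj⟩ := Iff.rfl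
      by_cases hm' : (⟨m, hm⟩ : Fin N) ≤ rk p ⟨i, hi⟩ ⟨j, hj⟩
      · simp only [hle, hm', if_true]
        norm_num [f10, f11, f3, g1]
        refine ⟨by ring, fun b c hbc => ?_⟩
        rw [if_neg (by simpa using hbc)]
        exact g2 b c (by simpa using hbc)
      · simp only [hle, hm', if_false]
        norm_num [g1]
        simpa using g2
  · intro i τ h u x hux
    exact h u x (by have := x.isLt; omega)

/-! ### The program: the rounds of the greedy coupling -/

/-- The request chosen for the variable `10` in a round. -/
def chosen : NExpr := .cell 6 (var 10) (.lit 0)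

/-- The common part that is covered in a round. -/
def picked : RExpr := .cell 3 (var 7) (var 8)

/-- The spare mass of the chosen request. -/
def chosenSpare : RExpr := .cell 4 (var 10) chosen

/-- The mass of a round. -/
def roundMass : RExpr := .cell 7 (.lit 0) (.lit 0)

/-- The variable `10` takes part in the common part that is covered. -/
def takesPart : Test := .natLe (var 7) (.cell 5 (var 10) (var 8))

/-- Replaces the picked common part by the one of the variables `10` and `11` if that one is not
smaller. -/
def pickStep : Prog :=
  .cond (.realLe picked (.cell 3 (var 10) (var 11)))
    (.seq (.setNat 7 (.lit 0) (.lit 0) (var 10)) (.setNat 8 (.lit 0) (.lit 0) (var 11))) .skip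

/-- Picks a largest common part. -/
def pickProg : Prog :=
  .seq (.setNat 7 (.lit 0) (.lit 0) (.lit 0)) (.seq (.setNat 8 (.lit 0) (.lit 0) (.lit 0))
    (forAll 10 (forAll 11 pickStep)))

/-- Replaces the chosen request by the variable `11` if its spare mass is not smaller. -/
def maxStep : Prog :=
  .cond (.realLe chosenSpare (.cell 4 (var 10) (var 11)))
    (.setNat 6 (var 10) (.lit 0) (var 11)) .skip

/-- Chooses the request of the variable `10`, and adapts the mass of the round. -/
def chooseStep : Prog :=
  .seq (.setNat 6 (var 10) (.lit 0) (var 8)) (.cond takesPart .skip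
    (.seq (forAll 11 maxStep)
      (.cond (.realLe roundMass chosenSpare) .skip (.setReal 7 (.lit 0) (.lit 0) chosenSpare))))

/-- Chooses the requests and the mass of a round. -/
def chooseProg : Prog :=
  .seq (.setReal 7 (.lit 0) (.lit 0) picked) (forAll 10 chooseStep)

/-- Adds the record of the variable `10`, and updates its spare mass. -/
def emitStep : Prog :=
  .seq (.setNat 2 (var 1) (.lit 0) chosen) (.seq (.setNat 3 (var 1) (.lit 0) (var 10))
    (.seq (.setReal 1 (var 1) (.lit 0) roundMass)
      (.seq (forAll 11 (.setNat 4 (var 1) (.cell 6 (var 11) (.lit 0)) (.lit 1)))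
        (.seq (.setNat 1 (.lit 0) (.lit 0) (.add (var 1) (.lit 1)))
          (.cond takesPart .skip
            (.setReal 4 (var 10) chosen (.sub chosenSpare roundMass)))))))

/-- Adds the records of a round, and updates the common parts and the spare masses. -/
def emitProg : Prog :=
  .seq (.setReal 3 (var 7) (var 8) (.sub picked roundMass)) (forAll 10 emitStep)

/-- A round of the greedy coupling. -/
def roundProg : Prog := .seq pickProg (.seq chooseProg emitProg)

theorem pickProg_spec {N : ℕ} (hpos : 0 < N) {σ : Store} (hN : σ.nat 0 0 0 = N) :
    ∃ i₀ x₀ : Fin N, (pickProg.exec σ).nat 7 0 0 = i₀ ∧ (pickProg.exec σ).nat 8 0 0 = x₀ ∧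
      ∀ i x : Fin N, σ.real 3 i x ≤ σ.real 3 i₀ x₀ := by
  rw [pickProg, Prog.exec_seq, Prog.exec_seq]
  set ρ := Prog.exec (.setNat 8 (.lit 0) (.lit 0) (.lit 0))
    (Prog.exec (.setNat 7 (.lit 0) (.lit 0) (.lit 0)) σ) with hρ
  have hn : ∀ a i j, ρ.nat a i j = if a = 8 ∧ i = 0 ∧ j = 0 then 0 else
      if a = 7 ∧ i = 0 ∧ j = 0 then 0 else σ.nat a i j := fun _ _ _ => rfl
  have hr : ρ.real = σ.real := rfl
  have key := forAll_forAll_inv (v := 10) (v' := 11) (σ := ρ) (N := N) (by simpa [hn] using hN)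
    (by decide) (by decide) (c := pickStep)
    (fun k l τ => ∃ i₀ x₀ : Fin N, τ.nat 7 0 0 = i₀ ∧ τ.nat 8 0 0 = x₀ ∧
      ∀ i x : Fin N, (i : ℕ) < k ∨ (i : ℕ) = k ∧ (x : ℕ) < l → σ.real 3 i x ≤ σ.real 3 i₀ x₀)
    ?_ ?_ ?_ ?_
  · obtain ⟨i₀, x₀, h1, h2, h3⟩ := key
    exact ⟨i₀, x₀, h1, h2, fun i x => h3 i x (Or.inl i.isLt)⟩
  · exact ⟨⟨0, hpos⟩, ⟨0, hpos⟩, by simp [hn], by simp [hn], by simp⟩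
  · intro i k τ h
    simpa using h
  · rintro i hi j hj τ hτ hv ⟨i₀, x₀, h1, h2, h3⟩
    have e3 : τ.real 3 = σ.real 3 := by rw [hτ.real 3 (by decide), hr]
    have hcond : ∀ i' x' : Fin N, (i' : ℕ) < i ∨ (i' : ℕ) = i ∧ (x' : ℕ) < j + 1 →
        ((i' : ℕ) < i ∨ (i' : ℕ) = i ∧ (x' : ℕ) < j) ∨ (i' : ℕ) = i ∧ (x' : ℕ) = j := by
      intro i' x' h
      omega
    simp only [pickStep, picked, Prog.exec, Test.Holds, RExpr.eval, NExpr.eval, eval_var,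
      setNat_nat, setNat_real]
    norm_num [hv, h1, h2, e3]
    split_ifs with h
    · refine ⟨⟨i, hi⟩, by simp, ⟨j, hj⟩, by simp, fun i' x' h' => ?_⟩
      rcases hcond i' x' (by omega) with h'' | ⟨h4, h5⟩
      · exact (h3 i' x' h'').trans h
      · rw [h4, h5]
    · refine ⟨i₀, by simp [h1], x₀, by simp [h2], fun i' x' h' => ?_⟩
      rcases hcond i' x' (by omega) with h'' | ⟨h4, h5⟩
      · exact h3 i' x' h''
      · rw [h4, h5]
        exact (not_le.1 h).le
  · rintro i τ ⟨i₀, x₀, h1, h2, h3⟩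
    refine ⟨i₀, x₀, h1, h2, fun i' x' h => h3 i' x' ?_⟩
    have := x'.isLt
    omega

theorem maxStep_spec {N : ℕ} (u c₀ : Fin N) {σ : Store} (hN : σ.nat 0 0 0 = N)
    (hu : σ.nat 10 0 0 = u) (h6 : σ.nat 6 u 0 = c₀) :
    ∃ c : Fin N, ((forAll 11 maxStep).exec σ).nat 6 u 0 = c ∧
      (∀ i ≠ (u : ℕ), ∀ j, ((forAll 11 maxStep).exec σ).nat 6 i j = σ.nat 6 i j) ∧
      ∀ x : Fin N, σ.real 4 u x ≤ σ.real 4 u c := by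
  have key := forAll_inv (v := 11) (c := maxStep) hN
    (fun k τ => ∃ c : Fin N, τ.nat 6 u 0 = c ∧
      (∀ i ≠ (u : ℕ), ∀ j, τ.nat 6 i j = σ.nat 6 i j) ∧
      ∀ x : Fin N, (x : ℕ) < k → σ.real 4 u x ≤ σ.real 4 u c) ?_ ?_
  · obtain ⟨c, h1, h2, h3⟩ := key
    exact ⟨c, h1, h2, fun x => h3 x x.isLt⟩
  · exact ⟨c₀, h6, fun _ _ _ => rfl, by simp⟩
  · rintro k hk τ hτ ⟨c, h1, h2, h3⟩
    have e4 : τ.real 4 = σ.real 4 := hτ.real 4 (by decide)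
    have e10 : τ.nat 10 0 0 = u := by rw [hτ.nat 10 (by decide), hu]
    simp only [maxStep, chosenSpare, chosen, Prog.exec, Test.Holds, RExpr.eval, NExpr.eval,
      eval_var, setNat_nat, setNat_real]
    norm_num [e10, h1, e4]
    split_ifs with h
    · refine ⟨⟨k, hk⟩, by simp, fun i hi j => ?_, fun x hx => ?_⟩
      · simp [hi, h2 i hi j]
      · rcases hx.lt_or_eq with hx | hx
        · exact (h3 x hx).trans h
        · rw [hx]
    · refine ⟨c, by simp [h1], fun i hi j => ?_, fun x hx => ?_⟩
      · simp [h2 i hi j]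
      · rcases hx.lt_or_eq with hx | hx
        · exact h3 x hx
        · rw [hx]
          exact (not_le.1 h).le

theorem chooseStep_spec {N : ℕ} (p : Fin N → Fin N → ℝ) (i₀ x₀ u : Fin N) {σ : Store}
    (hN : σ.nat 0 0 0 = N) (hu : σ.nat 10 0 0 = u) (h5 : ∀ u x : Fin N, σ.nat 5 u x = rk p u x)
    (h7 : σ.nat 7 0 0 = i₀) (h8 : σ.nat 8 0 0 = x₀) :
    ∃ c : Fin N, (chooseStep.exec σ).nat 6 u 0 = c ∧
      (∀ i ≠ (u : ℕ), ∀ j, (chooseStep.exec σ).nat 6 i j = σ.nat 6 i j) ∧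
      (i₀ ≤ rk p u x₀ → c = x₀ ∧ (chooseStep.exec σ).real 7 0 0 = σ.real 7 0 0) ∧
      (¬ i₀ ≤ rk p u x₀ → (∀ x : Fin N, σ.real 4 u x ≤ σ.real 4 u c) ∧
        (chooseStep.exec σ).real 7 0 0 = min (σ.real 7 0 0) (σ.real 4 u c)) := by
  rw [chooseStep, Prog.exec_seq, Prog.exec_cond, Prog.exec_seq]
  set ρ := Prog.exec (.setNat 6 (var 10) (.lit 0) (var 8)) σ with hρ
  have hn : ∀ a i j, ρ.nat a i j = if a = 6 ∧ i = u ∧ j = 0 then (x₀ : ℕ) else σ.nat a i j := by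
    intro a i j
    simp only [hρ, Prog.exec, NExpr.eval, eval_var, setNat_nat, hu, h8]
  have hr : ρ.real = σ.real := rfl
  have ht : takesPart.Holds ρ ↔ i₀ ≤ rk p u x₀ := by
    simp [takesPart, Test.Holds, NExpr.eval, hn, h7, h8, hu, h5]
  by_cases h : i₀ ≤ rk p u x₀
  · rw [if_pos (ht.2 h)]
    refine ⟨x₀, by simp [Prog.exec, hn], fun i hi j => by simp [Prog.exec, hn, hi],
      fun _ => ⟨rfl, rfl⟩, fun h' => absurd h h'⟩
  · rw [if_neg (fun h' => h (ht.1 h'))]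
    obtain ⟨c, h1, h2, h3⟩ := maxStep_spec u x₀ (σ := ρ) (by simpa [hn] using hN)
      (by simpa [hn] using hu) (by simp [hn])
    have ha := (forAll 11 maxStep).exec_agree ρ
    set υ := (forAll 11 maxStep).exec ρ with hυ
    have e10 : υ.nat 10 0 0 = u := by
      rw [ha.nat 10 (by decide)]
      simpa [hn] using hu
    have er : υ.real = σ.real := by
      funext a
      rw [ha.real a (by simp [forAll, maxStep, Prog.realWrites]), hr]
    rw [hr] at h3
    refine ⟨c, ?_, fun i hi j => ?_, fun h' => absurd h' h, fun _ => ⟨h3, ?_⟩⟩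
    · rw [← h1]
      simp only [Prog.exec]
      split_ifs <;> rfl
    · have : υ.nat 6 i j = σ.nat 6 i j := by
        rw [h2 i hi j, hn]
        simp [hi]
      rw [← this]
      simp only [Prog.exec]
      split_ifs <;> rfl
    · simp only [Prog.exec, Test.Holds, roundMass, chosenSpare, chosen, RExpr.eval,
        NExpr.eval, eval_var, e10, h1, er]
      split_ifs with h4
      · rw [er, min_eq_left h4]
      · simp [(not_le.1 h4).le]

/-- The memory represents a state of the greedy construction. The rows of the array `4` beyond the
last record are zero, so that a new record has only to mark the elements of its query. -/
structure Represents {N : ℕ} (p C L : Fin N → Fin N → ℝ)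
    (w : Fin N → Finset (Fin N) → Fin N → ℝ) (σ : Store) : Prop where
  size : σ.nat 0 0 0 = N
  rank : ∀ u x : Fin N, σ.nat 5 u x = rk p u x
  common : ∀ i x : Fin N, σ.real 3 i x = C i x
  spare : ∀ u x : Fin N, σ.real 4 u x = L u x
  clean : ∀ k, σ.numRecords ≤ k → ∀ j, σ.nat 4 k j = 0
  output : ∀ u y x, σ.output N u y x = w u y x

theorem chooseProg_spec {N : ℕ} {p C L : Fin N → Fin N → ℝ} {i₀ x₀ : Fin N} {σ : Store}
    (hN : σ.nat 0 0 0 = N) (h5 : ∀ u x : Fin N, σ.nat 5 u x = rk p u x)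
    (h3 : ∀ i x : Fin N, σ.real 3 i x = C i x) (h4 : ∀ u x : Fin N, σ.real 4 u x = L u x)
    (h7 : σ.nat 7 0 0 = i₀) (h8 : σ.nat 8 0 0 = x₀) (hmax : ∀ i x, C i x ≤ C i₀ x₀) :
    ∃ ch : Fin N → Fin N, (∀ u : Fin N, (chooseProg.exec σ).nat 6 u 0 = ch u) ∧
      GreedyRound p C L i₀ x₀ ch ((chooseProg.exec σ).real 7 0 0) := by
  rw [chooseProg, Prog.exec_seq]
  set ρ := Prog.exec (.setReal 7 (.lit 0) (.lit 0) picked) σ with hρ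
  have hn : ρ.nat = σ.nat := rfl
  have hr : ∀ a i j, ρ.real a i j = if a = 7 ∧ i = 0 ∧ j = 0 then C i₀ x₀ else σ.real a i j := by
    intro a i j
    simp [hρ, Prog.exec, picked, RExpr.eval, NExpr.eval, h7, h8, h3]
  have key := forAll_inv (v := 10) (σ := ρ) (c := chooseStep) (N := N) (by rw [hn, hN])
    (fun k τ => (∀ u : Fin N, (u : ℕ) < k → ∃ c : Fin N, τ.nat 6 u 0 = c ∧
        (i₀ ≤ rk p u x₀ → c = x₀) ∧
        (¬ i₀ ≤ rk p u x₀ → (∀ x, L u x ≤ L u c) ∧ τ.real 7 0 0 ≤ L u c)) ∧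
      τ.real 7 0 0 ≤ C i₀ x₀ ∧
      (τ.real 7 0 0 = C i₀ x₀ ∨ ∃ u c : Fin N, (u : ℕ) < k ∧ ¬ i₀ ≤ rk p u x₀ ∧
        τ.nat 6 u 0 = c ∧ τ.real 7 0 0 = L u c)) ?_ ?_
  · obtain ⟨g1, g2, g3⟩ := key
    choose ch hch hown hspare using fun u : Fin N => g1 u u.isLt
    refine ⟨ch, hch, hmax, hown, fun u hu => (hspare u hu).1, g2, fun u hu => (hspare u hu).2, ?_⟩
    rcases g3 with g3 | ⟨u, c, -, hu, hc, g3⟩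
    · exact Or.inl g3
    · have : ch u = c := Fin.ext ((hch u).symm.trans hc)
      exact Or.inr ⟨u, hu, this ▸ g3⟩
  · refine ⟨by simp, ?_, ?_⟩ <;> simp [hr]
  · rintro k hk τ hτ ⟨g1, g2, g3⟩
    set τ' := τ.setNat 10 0 0 k with hτ'
    have er : τ'.real = τ.real := rfl
    have e4 : ∀ u x : Fin N, τ'.real 4 u x = L u x := by
      intro u x
      rw [er, hτ.real 4 (by decide), hr]
      simp [h4]
    have e6 : ∀ i j, τ'.nat 6 i j = τ.nat 6 i j := by simp [hτ']
    obtain ⟨c, s1, s2, s3, s4⟩ := chooseStep_spec p i₀ x₀ ⟨k, hk⟩ (σ := τ')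
      (by simp [hτ', hτ.nat 0 (by decide), hn, hN]) (by simp [hτ'])
      (fun u x => by simp [hτ', hτ.nat 5 (by decide), hn, h5])
      (by simp [hτ', hτ.nat 7 (by decide), hn, h7]) (by simp [hτ', hτ.nat 8 (by decide), hn, h8])
    set υ := chooseStep.exec τ' with hυ
    have hle : υ.real 7 0 0 ≤ τ.real 7 0 0 := by
      by_cases h : i₀ ≤ rk p ⟨k, hk⟩ x₀
      · exact (s3 h).2.le
      · rw [(s4 h).2]
        exact min_le_left _ _
    have hold : ∀ u : Fin N, (u : ℕ) < k → υ.nat 6 u 0 = τ.nat 6 u 0 := fun u hu => by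
      rw [s2 u hu.ne, e6]
    refine ⟨fun u hu => ?_, hle.trans g2, ?_⟩
    · rcases (Nat.lt_succ_iff.1 hu).lt_or_eq with hu | hu
      · obtain ⟨c', q1, q2, q3⟩ := g1 u hu
        exact ⟨c', (hold u hu).trans q1, q2, fun h => ⟨(q3 h).1, hle.trans (q3 h).2⟩⟩
      · obtain rfl : u = ⟨k, hk⟩ := Fin.ext hu
        refine ⟨c, s1, fun h => (s3 h).1, fun h => ⟨fun x => ?_, ?_⟩⟩
        · rw [← e4, ← e4]
          exact (s4 h).1 x
        · rw [← e4, (s4 h).2]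
          exact min_le_right _ _
    · have hkeep : υ.real 7 0 0 = τ.real 7 0 0 → (υ.real 7 0 0 = C i₀ x₀ ∨
          ∃ u c : Fin N, (u : ℕ) < k + 1 ∧ ¬ i₀ ≤ rk p u x₀ ∧
            υ.nat 6 u 0 = c ∧ υ.real 7 0 0 = L u c) := by
        intro he
        rcases g3 with g3 | ⟨u, c', hu, q1, q2, q3⟩
        · exact Or.inl (he.trans g3)
        · exact Or.inr ⟨u, c', hu.trans (Nat.lt_succ_self k), q1, (hold u hu).trans q2,
            he.trans q3⟩
      by_cases h : i₀ ≤ rk p ⟨k, hk⟩ x₀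
      · exact hkeep (s3 h).2
      · rcases min_choice (τ'.real 7 0 0) (τ'.real 4 k c) with hm | hm
        · exact hkeep ((s4 h).2.trans hm)
        · exact Or.inr ⟨⟨k, hk⟩, c, Nat.lt_succ_self k, h, s1,
            (s4 h).2.trans (hm.trans (e4 ⟨k, hk⟩ c))⟩

/-- The contribution of the record `k` to the output. -/
noncomputable def recordAt (N : ℕ) (σ : Store) (k : ℕ) (u : Fin N) (y : Finset (Fin N))
    (x : Fin N) : ℝ :=
  if (Finset.univ.filter fun j : Fin N => σ.nat 4 k j = 1) = y ∧
      σ.nat 2 k 0 = x ∧ σ.nat 3 k 0 = u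
  then σ.real 1 k 0 else 0

theorem output_succ {N : ℕ} {σ τ : Store} (hk : τ.numRecords = σ.numRecords + 1)
    (h2 : ∀ k ≠ σ.numRecords, τ.nat 2 k 0 = σ.nat 2 k 0)
    (h3 : ∀ k ≠ σ.numRecords, τ.nat 3 k 0 = σ.nat 3 k 0)
    (h4 : ∀ k ≠ σ.numRecords, ∀ j, τ.nat 4 k j = σ.nat 4 k j)
    (h1 : ∀ k ≠ σ.numRecords, τ.real 1 k 0 = σ.real 1 k 0)
    (u : Fin N) (y : Finset (Fin N)) (x : Fin N) :
    τ.output N u y x = σ.output N u y x + recordAt N τ σ.numRecords u y x := by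
  unfold Store.output
  rw [hk, Finset.sum_range_succ]
  refine congrArg₂ (· + ·) (Finset.sum_congr rfl fun k hk => ?_) rfl
  have hne : k ≠ σ.numRecords := (Finset.mem_range.1 hk).ne
  simp only [h1 k hne, h2 k hne, h3 k hne, h4 k hne]

theorem emitStep_spec {N : ℕ} (p : Fin N → Fin N → ℝ) (i₀ x₀ u : Fin N) (ch : Fin N → Fin N)
    {σ : Store} (hN : σ.nat 0 0 0 = N) (hu : σ.nat 10 0 0 = u)
    (h5 : ∀ u x : Fin N, σ.nat 5 u x = rk p u x)
    (h6 : ∀ u : Fin N, σ.nat 6 u 0 = ch u)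
    (h7 : σ.nat 7 0 0 = i₀) (h8 : σ.nat 8 0 0 = x₀)
    (hcl : ∀ k, σ.numRecords ≤ k → ∀ j, σ.nat 4 k j = 0) :
    (emitStep.exec σ).numRecords = σ.numRecords + 1 ∧
    (∀ k, σ.numRecords + 1 ≤ k → ∀ j, (emitStep.exec σ).nat 4 k j = 0) ∧
    (∀ u' y x, (emitStep.exec σ).output N u' y x = σ.output N u' y x +
      if Finset.univ.image ch = y ∧ ch u = x ∧ u = u' then σ.real 7 0 0 else 0) ∧
    ∀ i j, (emitStep.exec σ).real 4 i j =
      if i = u ∧ ¬ i₀ ≤ rk p u x₀ ∧ j = ch u then σ.real 4 i j - σ.real 7 0 0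
        else σ.real 4 i j := by
  set K := σ.numRecords with hK
  have hK' : σ.nat 1 0 0 = K := rfl
  rw [emitStep]
  iterate 5 rw [Prog.exec_seq]
  set ρ := Prog.exec (.setReal 1 (var 1) (.lit 0) roundMass)
    (Prog.exec (.setNat 3 (var 1) (.lit 0) (var 10))
      (Prog.exec (.setNat 2 (var 1) (.lit 0) chosen) σ)) with hρ
  have hn : ∀ a i j, ρ.nat a i j = if a = 3 ∧ i = K ∧ j = 0 then (u : ℕ) else
      if a = 2 ∧ i = K ∧ j = 0 then (ch u : ℕ) else σ.nat a i j := by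
    intro a i j
    simp [hρ, Prog.exec, NExpr.eval, chosen, hK', hu, h6]
  have hr : ∀ a i j, ρ.real a i j = if a = 1 ∧ i = K ∧ j = 0 then σ.real 7 0 0 else
      σ.real a i j := by
    intro a i j
    simp [hρ, Prog.exec, RExpr.eval, NExpr.eval, roundMass, hK']
  have inner := forAll_inv (v := 11) (σ := ρ) (N := N) (by simpa [hn] using hN)
    (c := .setNat 4 (var 1) (.cell 6 (var 11) (.lit 0)) (.lit 1))
    (fun k τ => (∀ j : Fin N, τ.nat 4 K j = if ∃ u' : Fin N, (u' : ℕ) < k ∧ ch u' = j then 1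
        else 0) ∧ ∀ i ≠ K, ∀ j, τ.nat 4 i j = σ.nat 4 i j) ?_ ?_
  · have ha := (forAll 11 (.setNat 4 (var 1) (.cell 6 (var 11) (.lit 0)) (.lit 1))).exec_agree ρ
    set τ := (forAll 11 (.setNat 4 (var 1) (.cell 6 (var 11) (.lit 0)) (.lit 1))).exec ρ with hτ
    have en : ∀ a ∉ [11, 4], τ.nat a = ρ.nat a := ha.nat
    have er : τ.real = ρ.real := funext fun a => ha.real a (by simp [forAll, Prog.realWrites])
    set υ := Prog.exec (.setNat 1 (.lit 0) (.lit 0) (.add (var 1) (.lit 1))) τ with hυ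
    have hυn : ∀ a i j, υ.nat a i j = if a = 1 ∧ i = 0 ∧ j = 0 then K + 1 else τ.nat a i j := by
      intro a i j
      simp [hυ, Prog.exec, NExpr.eval, en 1 (by decide), hn, hK']
    have hυr : υ.real = ρ.real := er
    have ht : takesPart.Holds υ ↔ i₀ ≤ rk p u x₀ := by
      simp [takesPart, Test.Holds, NExpr.eval, hυn, en 7 (by decide), en 8 (by decide),
        en 5 (by decide), en 10 (by decide), hn, h7, h8, hu, h5]
    set φ := Prog.exec (.cond takesPart .skip
      (.setReal 4 (var 10) chosen (.sub chosenSpare roundMass))) υ with hφ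
    have hφn : φ.nat = υ.nat := by
      rw [hφ, Prog.exec]
      split_ifs <;> rfl
    have hφr : ∀ a i j, φ.real a i j = if a = 4 ∧ i = u ∧ ¬ i₀ ≤ rk p u x₀ ∧ j = ch u then
        σ.real 4 i j - σ.real 7 0 0 else ρ.real a i j := by
      intro a i j
      rw [hφ, Prog.exec, ht]
      have e10 : υ.nat 10 0 0 = u := by simp [hυn, en 10 (by decide), hn, hu]
      have e6 : υ.nat 6 u 0 = ch u := by simp [hυn, en 6 (by decide), hn, h6]
      by_cases h : i₀ ≤ rk p u x₀
      · simp [h, Prog.exec, hυr]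
      · simp only [h, if_false, Prog.exec, RExpr.eval, chosenSpare, chosen, roundMass, NExpr.eval,
          eval_var, e10, e6, hυr, hr, setReal_real]
        by_cases h' : a = 4 ∧ i = u ∧ j = ch u
        · obtain ⟨rfl, rfl, rfl⟩ := h'
          simp
        · have h'' : ¬ (a = 4 ∧ i = u ∧ ¬ False ∧ j = ch u) := by tauto
          rw [if_neg h', if_neg h'']
    refine ⟨?_, ?_, ?_, ?_⟩
    · rw [Store.numRecords, hφn, hυn]
      simp
    · intro k hk j
      rw [hφn, hυn]
      simp only [show ¬ ((4 : ℕ) = 1 ∧ k = 0 ∧ j = 0) by omega, if_false]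
      rw [inner.2 k (by omega) j, hcl k (by omega)]
    · intro u' y x
      rw [output_succ (σ := σ) (τ := φ)]
      · rw [← hK, recordAt]
        have e4 : (Finset.univ.filter fun j : Fin N => φ.nat 4 K j = 1) =
            Finset.univ.image ch := by
          ext j
          rw [Finset.mem_filter_univ, hφn, hυn]
          have := inner.1 j
          simp only [Fin.is_lt, true_and] at this
          simp [this]
        rw [e4]
        simp [hφn, hφr, hυn, en 2 (by decide), en 3 (by decide), hn, hr, Fin.val_inj]
      · rw [Store.numRecords, hφn, hυn, ← hK]
        simp
      · intro k hk
        simp [hφn, hυn, en 2 (by decide), hn, show k ≠ K from hk]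
      · intro k hk
        simp [hφn, hυn, en 3 (by decide), hn, show k ≠ K from hk]
      · intro k hk j
        rw [hφn, hυn]
        simp [inner.2 k hk j]
      · intro k hk
        simp [hφr, hr, show k ≠ K from hk]
    · intro i j
      rw [hφr, hr]
      simp
  · refine ⟨fun j => ?_, fun i hi j => by simp [hn]⟩
    simp [hn, hcl K le_rfl]
  · rintro k hk τ hτ ⟨g1, g2⟩
    have e1 : τ.nat 1 0 0 = K := by rw [hτ.nat 1 (by decide), hn]; simp [hK']
    have e6 : τ.nat 6 k 0 = ch ⟨k, hk⟩ := by
      rw [hτ.nat 6 (by decide), hn]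
      simpa using h6 ⟨k, hk⟩
    simp only [Prog.exec, NExpr.eval, eval_var, setNat_nat]
    norm_num [e1, e6]
    refine ⟨fun j => ?_, fun i hi j => by simp [hi, g2 i hi j]⟩
    rw [g1 j]
    by_cases hj : (j : ℕ) = ch ⟨k, hk⟩
    · have hex : ∃ u' : Fin N, (u' : ℕ) < k + 1 ∧ ch u' = j :=
        ⟨⟨k, hk⟩, Nat.lt_succ_self k, (Fin.ext hj).symm⟩
      simp only [Nat.lt_succ_iff] at hex
      simp [hj, hex]
    · have hiff : (∃ u' : Fin N, (u' : ℕ) ≤ k ∧ ch u' = j) ↔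
          ∃ u' : Fin N, (u' : ℕ) < k ∧ ch u' = j := by
        constructor
        · rintro ⟨u', h1, h2⟩
          rcases h1.lt_or_eq with h1 | h1
          · exact ⟨u', h1, h2⟩
          · obtain rfl : u' = ⟨k, hk⟩ := Fin.ext h1
            exact absurd (congrArg Fin.val h2).symm hj
        · rintro ⟨u', h1, h2⟩
          exact ⟨u', h1.le, h2⟩
      simp [hj, hiff]

theorem roundProg_spec {N : ℕ} (hpos : 0 < N) {p C L : Fin N → Fin N → ℝ}
    {w : Fin N → Finset (Fin N) → Fin N → ℝ} {σ : Store} (h : Represents p C L w σ) :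
    ∃ (i₀ x₀ : Fin N) (ch : Fin N → Fin N) (v : ℝ), GreedyRound p C L i₀ x₀ ch v ∧
      Represents p (nextCommon C i₀ x₀ v) (nextSpare p L i₀ x₀ ch v) (nextLaw w ch v)
        (roundProg.exec σ) ∧
      (roundProg.exec σ).numRecords = σ.numRecords + N := by
  obtain ⟨i₀, x₀, a1, a2, a3⟩ := pickProg_spec hpos h.size
  have ha := pickProg.exec_agree σ
  rw [roundProg, Prog.exec_seq, Prog.exec_seq]
  set σ₁ := pickProg.exec σ with hσ₁
  have n1 : ∀ a ∉ [7, 8, 10, 11], σ₁.nat a = σ.nat a := fun a ha' => ha.nat a (by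
    simp only [List.mem_cons, List.not_mem_nil, not_or] at ha'
    simp [pickProg, pickStep, forAll, Prog.natWrites, ha'])
  have r1 : σ₁.real = σ.real := funext fun a => ha.real a (by
    simp [pickProg, pickStep, forAll, Prog.realWrites])
  obtain ⟨ch, b1, b2⟩ := chooseProg_spec (p := p) (C := C) (L := L) (σ := σ₁)
    (by rw [n1 0 (by decide), h.size]) (by rw [n1 5 (by decide)]; exact h.rank)
    (by rw [r1]; exact h.common) (by rw [r1]; exact h.spare) a1 a2
    (fun i x => by simpa [h.common] using a3 i x)
  have hb := chooseProg.exec_agree σ₁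
  set σ₂ := chooseProg.exec σ₁ with hσ₂
  set v := σ₂.real 7 0 0 with hv
  have n2 : ∀ a ∉ [6, 10, 11], σ₂.nat a = σ₁.nat a := fun a ha' => hb.nat a (by
    simp only [List.mem_cons, List.not_mem_nil, not_or] at ha'
    simp [chooseProg, chooseStep, maxStep, forAll, Prog.natWrites, ha'])
  have r2 : ∀ a ≠ 7, σ₂.real a = σ.real a := fun a ha' => by
    rw [hb.real a (by simpa [chooseProg, chooseStep, maxStep, forAll, Prog.realWrites]
      using ha'), r1]
  have n12 : ∀ a ∉ [6, 7, 8, 10, 11], σ₂.nat a = σ.nat a := by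
    intro a ha'
    simp only [List.mem_cons, List.not_mem_nil, not_or] at ha'
    rw [n2 a (by simp [ha']), n1 a (by simp [ha'])]
  refine ⟨i₀, x₀, ch, v, b2, ?_⟩
  have e7 : σ₂.nat 7 0 0 = i₀ := by rw [n2 7 (by decide), a1]
  have e8 : σ₂.nat 8 0 0 = x₀ := by rw [n2 8 (by decide), a2]
  have hc := emitProg.exec_agree σ₂
  have hK : σ₂.numRecords = σ.numRecords := by
    rw [Store.numRecords, n12 1 (by decide)]
    rfl
  have hout : ∀ u y x, σ₂.output N u y x = w u y x := by
    intro u y x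
    rw [← h.output]
    unfold Store.output
    rw [hK, n12 2 (by decide), n12 3 (by decide), n12 4 (by decide), r2 1 (by decide)]
  rw [emitProg, Prog.exec_seq]
  set ρ := Prog.exec (.setReal 3 (var 7) (var 8) (.sub picked roundMass)) σ₂ with hρ
  have hρn : ρ.nat = σ₂.nat := rfl
  have hρr : ∀ a i j, ρ.real a i j = if a = 3 ∧ i = i₀ ∧ j = x₀ then C i₀ x₀ - v else
      σ₂.real a i j := by
    intro a i j
    simp [hρ, Prog.exec, RExpr.eval, NExpr.eval, picked, roundMass, e7, e8, r2 3 (by decide),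
      h.common, hv]
  have hK' : ρ.numRecords = σ.numRecords := hK
  have hout' : ∀ u y x, ρ.output N u y x = w u y x := by
    intro u y x
    rw [← hout]
    unfold Store.output
    simp only [hρn, hρr, hK', hK]
    simp
  have key := forAll_inv (v := 10) (σ := ρ) (N := N) (c := emitStep)
    (by rw [hρn, n12 0 (by decide), h.size])
    (fun k τ => τ.numRecords = σ.numRecords + k ∧
      (∀ k', σ.numRecords + k ≤ k' → ∀ j, τ.nat 4 k' j = 0) ∧
      (∀ u y x, τ.output N u y x = w u y x +
        if (u : ℕ) < k ∧ Finset.univ.image ch = y ∧ ch u = x then v else 0) ∧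
      ∀ u x : Fin N, τ.real 4 u x =
        if (u : ℕ) < k ∧ ¬ i₀ ≤ rk p u x₀ ∧ x = ch u then L u x - v else L u x) ?_ ?_
  · obtain ⟨k1, k2, k3, k4⟩ := key
    have hd := (forAll 10 emitStep).exec_agree ρ
    refine ⟨⟨?_, ?_, ?_, ?_, ?_, ?_⟩, k1⟩
    · rw [hd.nat 0 (by decide), hρn, n12 0 (by decide), h.size]
    · rw [hd.nat 5 (by decide), hρn, n12 5 (by decide)]
      exact h.rank
    · intro i x
      rw [hd.real 3 (by decide), hρr, r2 3 (by decide), h.common, nextCommon]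
      by_cases hix : i = i₀ ∧ x = x₀
      · rw [if_pos hix, hix.1, hix.2]
        simp
      · rw [if_neg hix, if_neg]
        rintro ⟨-, q1, q2⟩
        exact hix ⟨Fin.ext q1, Fin.ext q2⟩
    · intro u x
      rw [k4 u x, nextSpare]
      simp
    · rw [k1]
      exact k2
    · intro u y x
      rw [k3, nextLaw]
      simp
  · refine ⟨hK', ?_, ?_, ?_⟩
    · rw [hρn, n12 4 (by decide)]
      exact h.clean
    · simp [hout']
    · intro u x
      rw [hρr, r2 4 (by decide), h.spare]
      simp
  · rintro k hk τ hτ ⟨g1, g2, g3, g4⟩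
    set τ' := τ.setNat 10 0 0 k with hτ'
    have er : τ'.real = τ.real := rfl
    have hv' : τ'.real 7 0 0 = v := by
      rw [er, hτ.real 7 (by decide), hρr, hv]
      simp
    have hnr : τ'.numRecords = σ.numRecords + k := by
      rw [← g1]
      simp [hτ', Store.numRecords]
    have hto : ∀ u y x, τ'.output N u y x = τ.output N u y x := by
      intro u y x
      unfold Store.output
      rw [hnr, g1]
      simp [hτ']
    obtain ⟨s1, s2, s3, s4⟩ := emitStep_spec p i₀ x₀ ⟨k, hk⟩ ch (σ := τ')
      (by simp [hτ', hτ.nat 0 (by decide), hρn, n12 0 (by decide), h.size]) (by simp [hτ'])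
      (fun u x => by simp [hτ', hτ.nat 5 (by decide), hρn, n12 5 (by decide), h.rank])
      (fun u => by simp [hτ', hτ.nat 6 (by decide), hρn, b1])
      (by simp [hτ', hτ.nat 7 (by decide), hρn, e7])
      (by simp [hτ', hτ.nat 8 (by decide), hρn, e8])
      (by rw [hnr]; simpa [hτ'] using g2)
    rw [hnr] at s1 s2
    rw [hv'] at s3 s4
    refine ⟨s1, s2, fun u y x => ?_, fun u x => ?_⟩
    · rw [s3, hto, g3, add_assoc, add_right_inj]
      rcases lt_trichotomy (u : ℕ) k with hu | hu | hu
      · have : (⟨k, hk⟩ : Fin N) ≠ u := fun e => by simp [← e] at hu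
        simp [hu, this, hu.trans (Nat.lt_succ_self k)]
      · obtain rfl : u = ⟨k, hk⟩ := Fin.ext hu
        simp
      · have : (⟨k, hk⟩ : Fin N) ≠ u := fun e => by simp [← e] at hu
        simp [this, hu.not_gt, (Nat.succ_le_of_lt hu).not_gt]
    · rw [s4, er, g4]
      rcases lt_trichotomy (u : ℕ) k with hu | hu | hu
      · simp [hu, hu.ne, hu.trans (Nat.lt_succ_self k)]
      · obtain rfl : u = ⟨k, hk⟩ := Fin.ext hu
        simp [Fin.val_inj]
      · simp [hu.ne', hu.not_gt, (Nat.succ_le_of_lt hu).not_gt]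

/-! ### The program: correctness and running time -/

/-- The construction of the uncoded query. There are `2 N²` rounds, the maximum of the potential.
-/
def queryProg : Prog :=
  .seq rankProg (.seq commonProg (.seq spareProg
    (forAll 13 (forAll 14 (.seq roundProg roundProg)))))

theorem Represents.setNat {N : ℕ} {p C L : Fin N → Fin N → ℝ}
    {w : Fin N → Finset (Fin N) → Fin N → ℝ} {σ : Store} (h : Represents p C L w σ) {a : ℕ}
    (ha : a ∉ [0, 1, 2, 3, 4, 5]) (i j k : ℕ) : Represents p C L w (σ.setNat a i j k) := by
  have e : ∀ b ∈ [0, 1, 2, 3, 4, 5], (σ.setNat a i j k).nat b = σ.nat b := fun b hb =>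
    (agree_setNat σ a i j k).nat b (by
      rw [List.mem_singleton]
      rintro rfl
      exact ha hb)
  have hn : (σ.setNat a i j k).numRecords = σ.numRecords := by
    rw [Store.numRecords, e 1 (by decide)]
    rfl
  refine ⟨?_, ?_, h.common, h.spare, ?_, ?_⟩
  · rw [e 0 (by decide)]
    exact h.size
  · rw [e 5 (by decide)]
    exact h.rank
  · rw [hn, e 4 (by decide)]
    exact h.clean
  · intro u y x
    rw [← h.output]
    unfold Store.output
    rw [hn, e 2 (by decide), e 3 (by decide), e 4 (by decide)]
    rfl

/-- The memory holds a state of the greedy construction after `k` rounds: either the common parts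
are covered, or each round has decreased the potential. -/
def AfterRounds {N : ℕ} (p : Fin N → Fin N → ℝ) (k : ℕ) (σ : Store) : Prop :=
  ∃ C L w, PartialQuery p C L w ∧ Represents p C L w σ ∧ σ.numRecords = k * N ∧
    ((∀ i x, C i x = 0) ∨ potential C L + k ≤ 2 * (N * N))

theorem AfterRounds.setNat {N : ℕ} {p : Fin N → Fin N → ℝ} {k : ℕ} {σ : Store}
    (h : AfterRounds p k σ) {a : ℕ} (ha : a ∉ [0, 1, 2, 3, 4, 5]) (i j v : ℕ) :
    AfterRounds p k (σ.setNat a i j v) := by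
  obtain ⟨C, L, w, h1, h2, h3, h4⟩ := h
  refine ⟨C, L, w, h1, h2.setNat ha i j v, ?_, h4⟩
  rw [← h3, Store.numRecords, (agree_setNat σ a i j v).nat 1]
  · rfl
  · rw [List.mem_singleton]
    rintro rfl
    exact ha (by decide)

theorem AfterRounds.round {N : ℕ} (hpos : 0 < N) {p : Fin N → Fin N → ℝ} {k : ℕ} {σ : Store}
    (h : AfterRounds p k σ) : AfterRounds p (k + 1) (roundProg.exec σ) := by
  obtain ⟨C, L, w, h1, h2, h3, h4⟩ := h
  obtain ⟨i₀, x₀, ch, v, g1, g2, g3⟩ := roundProg_spec hpos h2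
  refine ⟨_, _, _, h1.next g1, g2, by rw [g3, h3]; ring, ?_⟩
  by_cases hC : ∀ i x, C i x = 0
  · exact Or.inl (g1.nextCommon_eq_zero h1 hC)
  · have h5 := h4.resolve_left hC
    have h6 := g1.potential_lt h1 (by simpa using hC)
    right
    omega

theorem queryProg_spec {N : ℕ} {p : Fin N → Fin N → ℝ}
    (hp : ∀ u, p u ∈ stdSimplex ℝ (Fin N)) :
    (queryProg.exec (inputStore p)).numRecords = 2 * (N * N) * N ∧
    IsUncodedQuery p ((queryProg.exec (inputStore p)).output N) := by
  set σ := inputStore p with hσ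
  have n0 : ∀ a i j, a ≠ 0 → σ.nat a i j = 0 := by
    intro a i j ha
    simp [hσ, inputStore, ha]
  have r0 : ∀ a i j, a ≠ 0 → σ.real a i j = 0 := by
    intro a i j ha
    simp [hσ, inputStore, ha]
  have hN : σ.nat 0 0 0 = N := by simp [hσ, inputStore]
  have hr : ∀ u x : Fin N, σ.real 0 u x = p u x := by
    intro u x
    simp [hσ, inputStore]
  obtain ⟨a5, a2⟩ := rankProg_spec p hN hr (fun i j => n0 5 i j (by decide))
    (fun i j => r0 2 i j (by decide))
  have ha := rankProg.exec_agree σ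
  rw [queryProg, Prog.exec_seq, Prog.exec_seq, Prog.exec_seq]
  set σ₁ := rankProg.exec σ with hσ₁
  have b3 := commonProg_spec p (σ := σ₁) (by rw [ha.nat 0 (by decide), hN]) a2
    (by rw [ha.real 5 (by decide), r0 5 _ _ (by decide)])
    (by rw [ha.real 6 (by decide), r0 6 _ _ (by decide)])
  have hb := commonProg.exec_agree σ₁
  set σ₂ := commonProg.exec σ₁ with hσ₂
  have c4 := spareProg_spec p (σ := σ₂)
    (by rw [hb.nat 0 (by decide), ha.nat 0 (by decide), hN])
    (by rw [hb.real 0 (by decide), ha.real 0 (by decide)]; exact hr)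
    (by rw [hb.nat 5 (by decide)]; exact a5) b3
  have hc := spareProg.exec_agree σ₂
  set σ₃ := spareProg.exec σ₂ with hσ₃
  have n3 : ∀ a ∉ [5, 10, 11, 12], σ₃.nat a = σ.nat a := by
    intro a ha'
    simp only [List.mem_cons, List.not_mem_nil, not_or] at ha'
    rw [hc.nat a (by simp [spareProg, spareStep, forAll, Prog.natWrites, ha']),
      hb.nat a (by simp [commonProg, commonStep, forAll, Prog.natWrites, ha']),
      ha.nat a (by simp [rankProg, rankStep, forAll, Prog.natWrites, ha'])]
  have hK : σ₃.numRecords = 0 := by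
    rw [Store.numRecords, n3 1 (by decide), n0 1 _ _ (by decide)]
  have hrep : Represents p (common p) (spare p) (fun _ _ _ => 0) σ₃ := by
    refine ⟨?_, ?_, ?_, c4, ?_, ?_⟩
    · rw [n3 0 (by decide), hN]
    · rw [hc.nat 5 (by decide), hb.nat 5 (by decide)]
      exact a5
    · rw [hc.real 3 (by decide)]
      exact b3
    · intro k _ j
      rw [n3 4 (by decide), n0 4 _ _ (by decide)]
    · intro u y x
      simp [Store.output, hK]
  have key := forAll_forAll_inv (v := 13) (v' := 14) (σ := σ₃) (N := N)
    (c := .seq roundProg roundProg) hrep.size (by decide) (by decide)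
    (fun i j τ => AfterRounds p (2 * (i * N + j)) τ) ?_ ?_ ?_ ?_
  · obtain ⟨C, L, w, h1, h2, h3, h4⟩ := key
    refine ⟨by rw [h3]; ring, ?_⟩
    have hw : ((forAll 13 (forAll 14 (.seq roundProg roundProg))).exec σ₃).output N = w := by
      funext u y x
      exact h2.output u y x
    rw [hw]
    refine h1.isUncodedQuery hp ?_
    rcases h4 with h4 | h4
    · exact h4
    · have h5 : potential C L = 0 := by
        rw [add_zero] at h4
        omega
      rw [potential, Nat.add_eq_zero_iff, Finset.card_eq_zero, Finset.filter_eq_empty_iff] at h5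
      intro i x
      simpa using h5.1 (Finset.mem_univ (i, x))
  · refine ⟨_, _, _, partialQuery_zero hp, hrep, by simp [hK], Or.inr ?_⟩
    simpa using potential_le (common p) (spare p)
  · intro i k τ h
    exact h.setNat (by decide) _ _ _
  · intro i hi j hj τ _ _ h
    have hpos : 0 < N := i.zero_le.trans_lt hi
    have := ((h.setNat (a := 14) (by decide) 0 0 j).round hpos).round hpos
    rw [Prog.exec_seq]
    convert this using 1
    ring
  · intro i τ h
    convert h using 1
    ring

theorem queryProg_polynomial : ∃ T : Polynomial ℕ, ∀ (N : ℕ) (p : Fin N → Fin N → ℝ),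
    (∀ u, p u ∈ stdSimplex ℝ (Fin N)) →
      (queryProg.run (inputStore p)).2 ≤ T.eval N ∧
      (queryProg.run (inputStore p)).1.numRecords ≤ T.eval N ∧
      IsUncodedQuery p ((queryProg.run (inputStore p)).1.output N) := by
  refine ⟨queryProg.costPoly + 2 * (Polynomial.X * Polynomial.X) * Polynomial.X,
    fun N p hp => ?_⟩
  have hcost := queryProg.run_snd_le (by
    simp [queryProg, rankProg, rankStep, commonProg, commonStep, spareProg, spareStep, roundProg,
      pickProg, pickStep, chooseProg, chooseStep, maxStep, emitProg, emitStep, forAll,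
      Prog.SizeLoops]) (by decide) (inputStore p)
  rw [show (inputStore p).nat 0 0 0 = N by simp [inputStore]] at hcost
  have heval : (queryProg.costPoly + 2 * (Polynomial.X * Polynomial.X) * Polynomial.X).eval N =
      queryProg.costPoly.eval N + 2 * (N * N) * N := by
    simp
  rw [heval, Prog.run_fst]
  obtain ⟨h1, h2⟩ := queryProg_spec hp
  exact ⟨hcost.trans (Nat.le_add_right _ _), h1.le.trans (Nat.le_add_left _ _), h2⟩

/-! ### The law of the requests and queries of an uncoded scheme -/

/-- The joint mass of the requests `x` up to the time `t` and the past queries `q`. -/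
noncomputable def UncodedScheme.pathMass {N : ℕ} (w : UncodedScheme N) (src : MarkovSource N)
    (f : ℕ → Bool) (t : ℕ) (x : Fin (t + 1) → Fin N) (q : Fin t → Finset (Fin N)) : ℝ :=
  src.init (x 0) * (∏ i : Fin t, src.trans (x i.castSucc) (x i.succ)) *
    ∏ i : Fin t, w.kernel i (status f i)
      (x (Fin.castLE (Nat.succ_le_succ i.isLt.le) (lastOn (status f i)))) (x i.castSucc)
      (fun j => q (Fin.castLE i.isLt.le j)) (q i)

open Classical in
/-- The probability that the past queries are `q` and that the requests satisfy `E`. -/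
noncomputable def UncodedScheme.pathProb {N : ℕ} (w : UncodedScheme N) (src : MarkovSource N)
    (f : ℕ → Bool) (t : ℕ) (E : (Fin (t + 1) → Fin N) → Prop) (q : Fin t → Finset (Fin N)) : ℝ :=
  ∑ x, if E x then w.pathMass src f t x q else 0

open Classical in
/-- The probability that the past queries are `q`, the present query is `y`, and the requests
satisfy `E`. -/
noncomputable def UncodedScheme.queryProb {N : ℕ} (w : UncodedScheme N) (src : MarkovSource N)
    (f : ℕ → Bool) (t : ℕ) (E : (Fin (t + 1) → Fin N) → Prop) (q : Fin t → Finset (Fin N))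
    (y : Finset (Fin N)) : ℝ :=
  ∑ x, if E x then w.pathMass src f t x q *
    w.kernel t (status f t) (x (lastOn (status f t))) (x (Fin.last t)) q y else 0

theorem prob_eq {Ω : Type} [Fintype Ω] (m : Ω → ℝ) (E : Ω → Prop) [DecidablePred E] :
    prob m E = ∑ ω, if E ω then m ω else 0 :=
  Finset.sum_congr rfl fun ω _ => by congr

theorem pathProb_eq {N : ℕ} (w : UncodedScheme N) (src : MarkovSource N) (f : ℕ → Bool) (t : ℕ)
    (E : (Fin (t + 1) → Fin N) → Prop) [DecidablePred E] (q : Fin t → Finset (Fin N)) :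
    w.pathProb src f t E q = ∑ x, if E x then w.pathMass src f t x q else 0 :=
  Finset.sum_congr rfl fun x _ => by congr

section Laws

variable {N : ℕ} (w : UncodedScheme N) (L : ℕ) (src : MarkovSource N) (f : ℕ → Bool) (t : ℕ)

theorem mass_eq (x : Fin (t + 1) → Fin N) (s : Fin (t + 1) → Finset (Fin N)) :
    (w.system L).mass src f t (x, s) = w.pathMass src f t x (Fin.init s) *
      w.kernel t (status f t) (x (lastOn (status f t))) (x (Fin.last t)) (Fin.init s)
        (s (Fin.last t)) := rfl

theorem prob_priorMass (E : (Fin (t + 1) → Fin N) → Prop) (q : Fin t → Finset (Fin N)) :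
    prob ((w.system L).priorMass src f t)
      (fun ω => E ω.1 ∧ (w.system L).pastQueries f t ω = q) = w.pathProb src f t E q := by
  classical
  change prob (Ω := (Fin (t + 1) → Fin N) × (Fin t → Finset (Fin N)))
    (fun ω => w.pathMass src f t ω.1 ω.2) (fun ω => E ω.1 ∧ ω.2 = q) = _
  rw [prob_eq, Fintype.sum_prod_type, UncodedScheme.pathProb]
  refine Finset.sum_congr rfl fun x _ => ?_
  by_cases h : E x <;> simp [h]

theorem sum_snoc {n : ℕ} {α : Type} [Fintype α] (g : (Fin (n + 1) → α) → ℝ) :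
    ∑ s, g s = ∑ q : Fin n → α, ∑ y, g (Fin.snoc q y) := by
  rw [← (Fin.snocEquiv fun _ : Fin (n + 1) => α).sum_comp, Fintype.sum_prod_type,
    Finset.sum_comm]
  rfl

theorem prob_mass (E : (Fin (t + 1) → Fin N) → Prop) (q : Fin t → Finset (Fin N))
    (y : Finset (Fin N)) :
    prob ((w.system L).mass src f t)
      (fun ω => E ω.1 ∧ (w.system L).currentQuery f t ω = y ∧
        (w.system L).pastQueries f t (ω.1, Fin.init ω.2) = q) = w.queryProb src f t E q y := by
  classical
  change prob (Ω := (Fin (t + 1) → Fin N) × (Fin (t + 1) → Finset (Fin N)))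
    (fun ω => w.pathMass src f t ω.1 (Fin.init ω.2) *
      w.kernel t (status f t) (ω.1 (lastOn (status f t))) (ω.1 (Fin.last t)) (Fin.init ω.2)
        (ω.2 (Fin.last t)))
    (fun ω => E ω.1 ∧ ω.2 (Fin.last t) = y ∧ Fin.init ω.2 = q) = _
  rw [prob_eq, Fintype.sum_prod_type, UncodedScheme.queryProb]
  refine Finset.sum_congr rfl fun x _ => ?_
  by_cases h : E x
  · simp only [h, true_and, if_true]
    rw [sum_snoc]
    simp only [Fin.snoc_last, Fin.init_snoc]
    rw [Finset.sum_eq_single q, Finset.sum_eq_single y]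
    · simp
    · intro y' _ hy
      simp [hy]
    · simp
    · intro q' _ hq
      simp [hq]
    · simp
  · simp [h]

theorem prob_mass_past (E : (Fin (t + 1) → Fin N) → Prop) (q : Fin t → Finset (Fin N)) :
    prob ((w.system L).mass src f t)
      (fun ω => E ω.1 ∧ (w.system L).pastQueries f t (ω.1, Fin.init ω.2) = q) =
      w.pathProb src f t E q := by
  classical
  change prob (Ω := (Fin (t + 1) → Fin N) × (Fin (t + 1) → Finset (Fin N)))
    (fun ω => w.pathMass src f t ω.1 (Fin.init ω.2) *
      w.kernel t (status f t) (ω.1 (lastOn (status f t))) (ω.1 (Fin.last t)) (Fin.init ω.2)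
        (ω.2 (Fin.last t)))
    (fun ω => E ω.1 ∧ Fin.init ω.2 = q) = _
  rw [prob_eq, Fintype.sum_prod_type, UncodedScheme.pathProb]
  refine Finset.sum_congr rfl fun x _ => ?_
  by_cases h : E x
  · simp only [h, true_and, if_true]
    rw [sum_snoc]
    simp only [Fin.snoc_last, Fin.init_snoc]
    rw [Finset.sum_eq_single q]
    · simp only [if_true]
      rw [← Finset.mul_sum, (w.kernel_mem _ _ _ _ _).2, mul_one]
    · intro q' _ hq
      simp [hq]
    · simp
  · simp [h]

variable {w src f t}

theorem pathMass_nonneg (x : Fin (t + 1) → Fin N) (q : Fin t → Finset (Fin N)) :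
    0 ≤ w.pathMass src f t x q :=
  mul_nonneg (mul_nonneg (src.init_mem.1 _) (Finset.prod_nonneg fun _ _ => (src.trans_mem _).1 _))
    (Finset.prod_nonneg fun _ _ => (w.kernel_mem _ _ _ _ _).1 _)

theorem pathProb_nonneg (E : (Fin (t + 1) → Fin N) → Prop) (q : Fin t → Finset (Fin N)) :
    0 ≤ w.pathProb src f t E q :=
  Finset.sum_nonneg fun x _ => by
    split_ifs
    · exact pathMass_nonneg x q
    · exact le_rfl

theorem pathProb_mono {E E' : (Fin (t + 1) → Fin N) → Prop} (h : ∀ x, E x → E' x)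
    (q : Fin t → Finset (Fin N)) : w.pathProb src f t E q ≤ w.pathProb src f t E' q := by
  refine Finset.sum_le_sum fun x _ => ?_
  by_cases h1 : E x
  · rw [if_pos h1, if_pos (h x h1)]
  · rw [if_neg h1]
    split_ifs
    · exact pathMass_nonneg x q
    · exact le_rfl

theorem sum_pathProb_and {α : Type} [Fintype α] (E : (Fin (t + 1) → Fin N) → Prop)
    (g : (Fin (t + 1) → Fin N) → α) (q : Fin t → Finset (Fin N)) :
    ∑ a, w.pathProb src f t (fun x => E x ∧ g x = a) q = w.pathProb src f t E q := by
  classical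
  unfold UncodedScheme.pathProb
  rw [Finset.sum_comm]
  refine Finset.sum_congr rfl fun x _ => ?_
  by_cases h : E x <;> simp [h]

theorem sum_queryProb_and {α : Type} [Fintype α] (E : (Fin (t + 1) → Fin N) → Prop)
    (g : (Fin (t + 1) → Fin N) → α) (q : Fin t → Finset (Fin N)) (y : Finset (Fin N)) :
    ∑ a, w.queryProb src f t (fun x => E x ∧ g x = a) q y = w.queryProb src f t E q y := by
  classical
  unfold UncodedScheme.queryProb
  rw [Finset.sum_comm]
  refine Finset.sum_congr rfl fun x _ => ?_
  by_cases h : E x <;> simp [h]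

theorem pathMass_snoc (x : Fin (t + 1) → Fin N) (z : Fin N) (q : Fin t → Finset (Fin N))
    (y : Finset (Fin N)) :
    w.pathMass src f (t + 1) (Fin.snoc x z) (Fin.snoc q y) =
      w.pathMass src f t x q *
        w.kernel t (status f t) (x (lastOn (status f t))) (x (Fin.last t)) q y *
        src.trans (x (Fin.last t)) z := by
  have hx : ∀ i : Fin (t + 1), (Fin.snoc x z : Fin (t + 2) → Fin N) i.castSucc = x i :=
    fun i => Fin.snoc_castSucc (α := fun _ => Fin N) _ _ _
  have hq : ∀ i : Fin t, (Fin.snoc q y : Fin (t + 1) → Finset (Fin N)) i.castSucc = q i :=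
    fun i => Fin.snoc_castSucc (α := fun _ => Finset (Fin N)) _ _ _
  have e0 : (Fin.snoc x z : Fin (t + 2) → Fin N) 0 = x 0 := hx 0
  have el : (Fin.snoc x z : Fin (t + 2) → Fin N) (Fin.last (t + 1)) = z :=
    Fin.snoc_last (α := fun _ => Fin N) _ _
  have eq : (Fin.snoc q y : Fin (t + 1) → Finset (Fin N)) (Fin.last t) = y :=
    Fin.snoc_last (α := fun _ => Finset (Fin N)) _ _
  unfold UncodedScheme.pathMass
  rw [Fin.prod_univ_castSucc, Fin.prod_univ_castSucc, e0]
  have h1 : ∀ i : Fin t, src.trans ((Fin.snoc x z : Fin (t + 2) → Fin N) i.castSucc.castSucc)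
      ((Fin.snoc x z : Fin (t + 2) → Fin N) i.castSucc.succ) =
      src.trans (x i.castSucc) (x i.succ) := by
    intro i
    rw [hx, ← Fin.castSucc_succ, hx]
  have h2 : ∀ i : Fin t, w.kernel i.castSucc (status f i.castSucc)
      ((Fin.snoc x z : Fin (t + 2) → Fin N)
        (Fin.castLE (Nat.succ_le_succ i.castSucc.isLt.le) (lastOn (status f i.castSucc))))
      ((Fin.snoc x z : Fin (t + 2) → Fin N) i.castSucc.castSucc)
      (fun j => (Fin.snoc q y : Fin (t + 1) → Finset (Fin N)) (Fin.castLE i.castSucc.isLt.le j))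
      ((Fin.snoc q y : Fin (t + 1) → Finset (Fin N)) i.castSucc) =
      w.kernel i (status f i)
        (x (Fin.castLE (Nat.succ_le_succ i.isLt.le) (lastOn (status f i)))) (x i.castSucc)
        (fun j => q (Fin.castLE i.isLt.le j)) (q i) := by
    intro i
    rw [hx, hq]
    exact congrArg₂ (fun a c => w.kernel i (status f i) a (x i.castSucc) c (q i))
      (hx (Fin.castLE (Nat.succ_le_succ i.isLt.le) (lastOn (status f i))))
      (funext fun j => hq (Fin.castLE i.isLt.le j))
  rw [Finset.prod_congr rfl fun i _ => h1 i, Finset.prod_congr rfl fun i _ => h2 i]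
  have h3 : w.kernel (Fin.last t) (status f (Fin.last t))
      ((Fin.snoc x z : Fin (t + 2) → Fin N)
        (Fin.castLE (Nat.succ_le_succ (Fin.last t).isLt.le) (lastOn (status f (Fin.last t)))))
      ((Fin.snoc x z : Fin (t + 2) → Fin N) (Fin.last t).castSucc)
      (fun j => (Fin.snoc q y : Fin (t + 1) → Finset (Fin N))
        (Fin.castLE (Fin.last t).isLt.le j))
      ((Fin.snoc q y : Fin (t + 1) → Finset (Fin N)) (Fin.last t)) =
      w.kernel t (status f t) (x (lastOn (status f t))) (x (Fin.last t)) q y := by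
    rw [hx, eq]
    exact congrArg₂ (fun a c => w.kernel t (status f t) a (x (Fin.last t)) c y)
      (hx (lastOn (status f t))) (funext hq)
  rw [h3, hx, Fin.succ_last, el]
  ring

variable (w src f)

theorem sum_pathMass (t : ℕ) : ∑ x, ∑ q, w.pathMass src f t x q = 1 := by
  induction t with
  | zero =>
    have : ∀ (x : Fin 1 → Fin N) (q : Fin 0 → Finset (Fin N)),
        w.pathMass src f 0 x q = src.init (x 0) := by
      intro x q
      simp [UncodedScheme.pathMass]
    simp only [this, Finset.sum_const, Finset.card_univ, Fintype.card_fun, Fintype.card_fin]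
    rw [← src.init_mem.2]
    refine Fintype.sum_equiv (Equiv.funUnique (Fin 1) (Fin N)) _ _ fun x => ?_
    simp
  | succ t ih =>
    rw [sum_snoc, ← ih]
    refine Finset.sum_congr rfl fun x _ => ?_
    simp only [sum_snoc (fun s => w.pathMass src f (t + 1) _ s), pathMass_snoc]
    rw [Finset.sum_comm]
    refine Finset.sum_congr rfl fun q _ => ?_
    rw [Finset.sum_comm]
    simp only [← Finset.mul_sum, (src.trans_mem _).2, mul_one, (w.kernel_mem _ _ _ _ _).2]

theorem sum_pathProb_true (t : ℕ) : ∑ q, w.pathProb src f t (fun _ => True) q = 1 := by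
  rw [← sum_pathMass w src f t, Finset.sum_comm]
  simp [UncodedScheme.pathProb]

end Laws

/-! ### The Markov property at the last time at which privacy was ON -/

theorem status_lastOn {f : ℕ → Bool} (hf : f 0 = true) (t : ℕ) :
    lastOn (status f t) ∈ onTimes (status f t) := by
  have hne : (onTimes (status f t)).Nonempty :=
    ⟨0, Finset.mem_filter.2 ⟨Finset.mem_univ _, hf⟩⟩
  obtain ⟨i, hi, h⟩ := Finset.exists_mem_eq_sup _ hne id
  rw [lastOn, h]
  exact hi

theorem le_lastOn {f : ℕ → Bool} {t : ℕ} {i : Fin (t + 1)} (hi : i ∈ onTimes (status f t)) :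
    i ≤ lastOn (status f t) :=
  Finset.le_sup (f := id) hi

/-- Between `τ(t)` and `t` the last time at which privacy was ON does not change. -/
theorem lastOn_eq {f : ℕ → Bool} (hf : f 0 = true) {s t : ℕ} (hst : s ≤ t)
    (h : (lastOn (status f t) : ℕ) ≤ s) :
    (lastOn (status f s) : ℕ) = lastOn (status f t) := by
  apply le_antisymm
  · have h1 := status_lastOn hf s
    have : (⟨lastOn (status f s), by omega⟩ : Fin (t + 1)) ∈ onTimes (status f t) :=
      Finset.mem_filter.2 ⟨Finset.mem_univ _, (Finset.mem_filter.1 h1).2⟩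
    exact le_lastOn this
  · have h1 := status_lastOn hf t
    have : (⟨lastOn (status f t), by omega⟩ : Fin (s + 1)) ∈ onTimes (status f s) :=
      Finset.mem_filter.2 ⟨Finset.mem_univ _, (Finset.mem_filter.1 h1).2⟩
    exact le_lastOn this

/-- The path that follows `x` until the time `k`, and then follows `x'`. -/
def splice {N n : ℕ} (k : Fin n) (x x' : Fin n → Fin N) : Fin n → Fin N :=
  fun i => if i ≤ k then x i else x' i

/-- The factors up to the time `τ(t)` see only the first part of a spliced path, the later ones see
only its second part: the queries after `τ(t)` do not depend on earlier requests. -/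
theorem pathMass_mul_pathMass {N : ℕ} (w : UncodedScheme N) (src : MarkovSource N) {f : ℕ → Bool}
    (hf : f 0 = true) {t : ℕ} {x x' : Fin (t + 1) → Fin N}
    (h : x (lastOn (status f t)) = x' (lastOn (status f t))) (q : Fin t → Finset (Fin N)) :
    w.pathMass src f t (splice (lastOn (status f t)) x x') q *
      w.pathMass src f t (splice (lastOn (status f t)) x' x) q =
    w.pathMass src f t x q * w.pathMass src f t x' q := by
  set k := lastOn (status f t) with hk
  have early : ∀ (x x' : Fin (t + 1) → Fin N) (i : Fin (t + 1)), i ≤ k → splice k x x' i = x i :=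
    fun x x' i hi => if_pos hi
  have late : ∀ x x' : Fin (t + 1) → Fin N, x k = x' k → ∀ i : Fin (t + 1), k ≤ i →
      splice k x x' i = x' i := by
    intro x x' h i hi
    rcases hi.eq_or_lt with hi | hi
    · rw [← hi, early x x' k le_rfl, h]
    · exact if_neg (not_le.2 hi)
  have htrans : ∀ x x' : Fin (t + 1) → Fin N, x k = x' k → ∀ i : Fin t,
      src.trans (splice k x x' i.castSucc) (splice k x x' i.succ) =
        if i.castSucc < k then src.trans (x i.castSucc) (x i.succ)
        else src.trans (x' i.castSucc) (x' i.succ) := by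
    intro x x' h i
    split_ifs with hi
    · rw [early _ _ _ hi.le, early _ _ i.succ (Fin.castSucc_lt_iff_succ_le.1 hi)]
    · have h2 : k ≤ i.castSucc := not_lt.1 hi
      rw [late _ _ h _ h2, late _ _ h _ (h2.trans (Fin.castSucc_lt_succ).le)]
  have hkernel : ∀ x x' : Fin (t + 1) → Fin N, x k = x' k → ∀ i : Fin t,
      w.kernel i (status f i)
        (splice k x x' (Fin.castLE (Nat.succ_le_succ i.isLt.le) (lastOn (status f i))))
        (splice k x x' i.castSucc) (fun j => q (Fin.castLE i.isLt.le j)) (q i) =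
      if i.castSucc < k then w.kernel i (status f i)
        (x (Fin.castLE (Nat.succ_le_succ i.isLt.le) (lastOn (status f i))))
        (x i.castSucc) (fun j => q (Fin.castLE i.isLt.le j)) (q i)
      else w.kernel i (status f i)
        (x' (Fin.castLE (Nat.succ_le_succ i.isLt.le) (lastOn (status f i))))
        (x' i.castSucc) (fun j => q (Fin.castLE i.isLt.le j)) (q i) := by
    intro x x' h i
    split_ifs with hi
    · have h1 : Fin.castLE (Nat.succ_le_succ i.isLt.le) (lastOn (status f i)) ≤ k := by
        have h2 : (lastOn (status f i) : ℕ) ≤ i := Nat.lt_succ_iff.1 (lastOn (status f i)).isLt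
        have h3 : (i : ℕ) < k := hi
        exact (h2.trans h3.le : (lastOn (status f i) : ℕ) ≤ k)
      rw [early _ _ _ hi.le, early _ _ _ h1]
    · have h2 : k ≤ i.castSucc := not_lt.1 hi
      have h3 : Fin.castLE (Nat.succ_le_succ i.isLt.le) (lastOn (status f i)) = k :=
        Fin.ext (lastOn_eq hf i.isLt.le h2)
      rw [late _ _ h _ h2, h3, late _ _ h _ le_rfl]
  have hswap : ∀ a b c d : Fin t → ℝ, (∀ i, a i * b i = c i * d i) →
      (∏ i, a i) * ∏ i, b i = (∏ i, c i) * ∏ i, d i := by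
    intro a b c d h
    rw [← Finset.prod_mul_distrib, ← Finset.prod_mul_distrib]
    exact Finset.prod_congr rfl fun i _ => h i
  have e1 := hswap (fun i => src.trans (splice k x x' i.castSucc) (splice k x x' i.succ))
    (fun i => src.trans (splice k x' x i.castSucc) (splice k x' x i.succ))
    (fun i => src.trans (x i.castSucc) (x i.succ))
    (fun i => src.trans (x' i.castSucc) (x' i.succ)) (by
      intro i
      rw [htrans x x' h, htrans x' x h.symm]
      split_ifs
      · rfl
      · exact mul_comm _ _)
  have e2 := hswap _ _ _ _ (fun i => by
    have h1 := hkernel x x' h i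
    have h2 := hkernel x' x h.symm i
    refine (congrArg₂ (· * ·) h1 h2).trans (?_ : _ =
      w.kernel i (status f i)
        (x (Fin.castLE (Nat.succ_le_succ i.isLt.le) (lastOn (status f i))))
        (x i.castSucc) (fun j => q (Fin.castLE i.isLt.le j)) (q i) *
      w.kernel i (status f i)
        (x' (Fin.castLE (Nat.succ_le_succ i.isLt.le) (lastOn (status f i))))
        (x' i.castSucc) (fun j => q (Fin.castLE i.isLt.le j)) (q i))
    split_ifs
    · rfl
    · exact mul_comm _ _)
  have e0 : ∀ x x' : Fin (t + 1) → Fin N, splice k x x' 0 = x 0 :=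
    fun x x' => early x x' 0 (Fin.zero_le _)
  unfold UncodedScheme.pathMass
  have e3 : ∀ a b c d e g : ℝ, a * b * c * (d * e * g) = a * d * (b * e) * (c * g) := by
    intros
    ring
  rw [e0, e0, e3, e1, e2, e3]

/-- Given the request at the time `τ(t)` and the past queries, the present request is independent
of the requests up to `τ(t)`. The event `E` concerns the latter and fixes the request at `τ(t)`.
-/
theorem pathProb_markov {N : ℕ} (w : UncodedScheme N) (src : MarkovSource N) {f : ℕ → Bool}
    (hf : f 0 = true) {t : ℕ} {E : (Fin (t + 1) → Fin N) → Prop} {u : Fin N}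
    (hE : ∀ x, E x → x (lastOn (status f t)) = u)
    (hdep : ∀ x x', (∀ i ≤ lastOn (status f t), x i = x' i) → E x → E x')
    (z : Fin N) (q : Fin t → Finset (Fin N)) :
    w.pathProb src f t (fun x => E x ∧ x (Fin.last t) = z) q *
      w.pathProb src f t (fun x => x (lastOn (status f t)) = u) q =
    w.pathProb src f t E q *
      w.pathProb src f t (fun x => x (Fin.last t) = z ∧ x (lastOn (status f t)) = u) q := by
  classical
  set k := lastOn (status f t) with hk
  rw [pathProb_eq, pathProb_eq, pathProb_eq, pathProb_eq]
  rw [Finset.sum_mul_sum, Finset.sum_mul_sum, ← Finset.sum_product', ← Finset.sum_product']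
  -- splicing exchanges the parts after the time `τ(t)` of two paths
  have hinv : Function.Involutive fun r : (Fin (t + 1) → Fin N) × (Fin (t + 1) → Fin N) =>
      (splice k r.1 r.2, splice k r.2 r.1) := by
    rintro ⟨x, x'⟩
    refine Prod.ext ?_ ?_ <;> funext i <;> by_cases hi : i ≤ k <;> simp [splice, hi]
  refine Fintype.sum_equiv hinv.toPerm _ _ ?_
  rintro ⟨x, x'⟩
  change (if E x ∧ x (Fin.last t) = z then w.pathMass src f t x q else 0) *
      (if x' k = u then w.pathMass src f t x' q else 0) =
    (if E (splice k x x') then w.pathMass src f t (splice k x x') q else 0) *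
      if splice k x' x (Fin.last t) = z ∧ splice k x' x k = u then
        w.pathMass src f t (splice k x' x) q else 0
  have hE' : E (splice k x x') ↔ E x :=
    ⟨hdep _ _ fun i hi => if_pos hi, hdep _ _ fun i hi => (if_pos hi).symm⟩
  have hk' : splice k x' x k = x' k := if_pos le_rfl
  rw [hE', hk']
  by_cases h1 : E x
  · by_cases h2 : x' k = u
    · have hxx : x k = x' k := (hE x h1).trans h2.symm
      have hl : splice k x' x (Fin.last t) = x (Fin.last t) := by
        by_cases h3 : Fin.last t ≤ k
        · rw [splice, if_pos h3, ← le_antisymm (Fin.le_last k) h3, hxx]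
        · exact if_neg h3
      rw [hl]
      by_cases h3 : x (Fin.last t) = z
      · simp only [h1, h2, h3, and_self, if_true]
        exact (pathMass_mul_pathMass w src hf hxx q).symm
      · simp [h3]
    · simp [h2]
  · simp [h1]

/-! ### Kernels that realize an uncoded query given the past -/

/-- The kernel of the scheme at time `t` draws, given the past queries `q`, the uncoded query `v q`
for a version `c q` of the conditional law of the present request. The version has the least cost,
so that the bound holds for every other version as well. -/
structure UncodedScheme.OptimalAt {N : ℕ} (w : UncodedScheme N) (src : MarkovSource N)
    (f : ℕ → Bool) (t : ℕ) (c : (Fin t → Finset (Fin N)) → Fin N → Fin N → ℝ)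
    (v : (Fin t → Finset (Fin N)) → Fin N → Finset (Fin N) → Fin N → ℝ) : Prop where
  version : ∀ q u x, w.pathProb src f t (fun ω => ω (lastOn (status f t)) = u) q * c q u x =
    w.pathProb src f t (fun ω => ω (Fin.last t) = x ∧ ω (lastOn (status f t)) = u) q
  row_mem : ∀ q u, c q u ∈ stdSimplex ℝ (Fin N)
  query : ∀ q, IsUncodedQuery (c q) (v q)
  kernel_eq : ∀ u x q y, c q u x * w.kernel t (status f t) u x q y = v q u y x
  contains : ∀ u x q y, x ∉ y → w.kernel t (status f t) u x q y = 0
  minimal : ∀ q c', (∀ u, c' u ∈ stdSimplex ℝ (Fin N)) →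
    (∀ u x, w.pathProb src f t (fun ω => ω (lastOn (status f t)) = u) q * c' u x =
      w.pathProb src f t (fun ω => ω (Fin.last t) = x ∧ ω (lastOn (status f t)) = u) q) →
    innerCost (c q) ≤ innerCost c'

theorem exists_isUncodedQuery {N : ℕ} {p : Fin N → Fin N → ℝ}
    (hp : ∀ u, p u ∈ stdSimplex ℝ (Fin N)) : ∃ w, IsUncodedQuery p w :=
  ⟨_, (queryProg_spec hp).2⟩

/-- Where the conditioning event is null, the rows of a version are free; the cost is continuous
and the simplices are compact, so some version has the least cost. -/
theorem exists_minimal_version {N : ℕ} {P : Fin N → ℝ} {J : Fin N → Fin N → ℝ}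
    (hJ : ∀ u x, 0 ≤ J u x) (hP : ∀ u, ∑ x, J u x = P u) :
    ∃ c : Fin N → Fin N → ℝ, (∀ u, c u ∈ stdSimplex ℝ (Fin N)) ∧ (∀ u x, P u * c u x = J u x) ∧
      ∀ c' : Fin N → Fin N → ℝ, (∀ u, c' u ∈ stdSimplex ℝ (Fin N)) →
        (∀ u x, P u * c' u x = J u x) → innerCost c ≤ innerCost c' := by
  classical
  set V : Set (Fin N → Fin N → ℝ) :=
    (Set.univ.pi fun _ => stdSimplex ℝ (Fin N)) ∩ {c | ∀ u x, P u * c u x = J u x} with hV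
  have hcomp : IsCompact V := by
    refine (isCompact_univ_pi fun _ => isCompact_stdSimplex ℝ (Fin N)).inter_right ?_
    simp only [Set.ofPred_forall]
    exact isClosed_iInter fun u => isClosed_iInter fun x =>
      isClosed_eq (by fun_prop) continuous_const
  have hne : V.Nonempty := by
    refine ⟨fun u x => if P u = 0 then if x = u then 1 else 0 else J u x / P u, ?_, ?_⟩
    · rintro u -
      by_cases h : P u = 0
      · simp only [h, if_true]
        refine ⟨fun x => ?_, by simp⟩
        dsimp only
        split_ifs <;> simp
      · simp only [h, if_false]
        refine ⟨fun x => div_nonneg (hJ u x) ?_, ?_⟩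
        · rw [← hP]
          exact Finset.sum_nonneg fun x _ => hJ u x
        · rw [← Finset.sum_div, hP, div_self h]
    · intro u x
      by_cases h : P u = 0
      · have h0 := hP u
        rw [h, Finset.sum_eq_zero_iff_of_nonneg fun x _ => hJ u x] at h0
        simp [h, h0 x (Finset.mem_univ x)]
      · simp only [h, if_false]
        exact mul_div_cancel₀ _ h
  obtain ⟨c, hc, hmin⟩ := hcomp.exists_isMinOn hne continuous_innerCost.continuousOn
  exact ⟨c, fun u => hc.1 u (Set.mem_univ u), hc.2, fun c' h1 h2 =>
    hmin ⟨fun u _ => h1 u, h2⟩⟩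

/-- The conditional law of the query given the request. Where the request has no mass it is the
query for this request alone. -/
theorem exists_kernel {N : ℕ} {p : Fin N → Fin N → ℝ}
    {v : Fin N → Finset (Fin N) → Fin N → ℝ} (hp : ∀ u x, 0 ≤ p u x) (h : IsUncodedQuery p v) :
    ∃ k : Fin N → Fin N → Finset (Fin N) → ℝ, (∀ u x, k u x ∈ stdSimplex ℝ (Finset (Fin N))) ∧
      (∀ u x y, p u x * k u x y = v u y x) ∧ ∀ u x y, x ∉ y → k u x y = 0 := by
  refine ⟨fun u x y => if p u x = 0 then if y = {x} then 1 else 0 else v u y x / p u x,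
    fun u x => ?_, fun u x y => ?_, fun u x y hx => ?_⟩
  · by_cases h0 : p u x = 0
    · simp only [h0, if_true]
      refine ⟨fun y => ?_, by simp⟩
      dsimp only
      split_ifs <;> simp
    · simp only [h0, if_false]
      refine ⟨fun y => div_nonneg (h.nonneg u y x) (hp u x), ?_⟩
      rw [← Finset.sum_div, h.marginal, div_self h0]
  · by_cases h0 : p u x = 0
    · have h1 := h.marginal u x
      rw [h0, Finset.sum_eq_zero_iff_of_nonneg fun y _ => h.nonneg u y x] at h1
      simp [h0, h1 y (Finset.mem_univ y)]
    · simp only [h0, if_false]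
      exact mul_div_cancel₀ _ h0
  · have : y ≠ {x} := by
      rintro rfl
      exact hx (Finset.mem_singleton_self x)
    simp [this, h.contains u y x hx]

section Optimal

variable {N L : ℕ} {w : UncodedScheme N} {src : MarkovSource N} {f : ℕ → Bool} {t : ℕ}
  {c : (Fin t → Finset (Fin N)) → Fin N → Fin N → ℝ}
  {v : (Fin t → Finset (Fin N)) → Fin N → Finset (Fin N) → Fin N → ℝ}

/-- A version of the conditional law given `X_τ` is also one given all requests up to `τ(t)`. -/
theorem UncodedScheme.OptimalAt.pathProb_and (h : w.OptimalAt src f t c v) (hf : f 0 = true)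
    {E : (Fin (t + 1) → Fin N) → Prop} {u : Fin N}
    (hE : ∀ x, E x → x (lastOn (status f t)) = u)
    (hdep : ∀ x x', (∀ i ≤ lastOn (status f t), x i = x' i) → E x → E x')
    (z : Fin N) (q : Fin t → Finset (Fin N)) :
    w.pathProb src f t (fun x => E x ∧ x (Fin.last t) = z) q =
      w.pathProb src f t E q * c q u z := by
  have hm := pathProb_markov w src hf hE hdep z q
  rw [← h.version] at hm
  by_cases h0 : w.pathProb src f t (fun x => x (lastOn (status f t)) = u) q = 0
  · have h1 : w.pathProb src f t E q = 0 :=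
      le_antisymm (h0 ▸ pathProb_mono hE q) (pathProb_nonneg E q)
    have h2 : w.pathProb src f t (fun x => E x ∧ x (Fin.last t) = z) q = 0 :=
      le_antisymm (h1 ▸ pathProb_mono (fun x hx => hx.1) q) (pathProb_nonneg _ q)
    rw [h1, h2, zero_mul]
  · apply mul_right_cancel₀ h0
    rw [hm]
    ring

/-- The present query depends on the requests up to `τ(t)` only through the past queries. -/
theorem UncodedScheme.OptimalAt.queryProb_eq (h : w.OptimalAt src f t c v) (hf : f 0 = true)
    {E : (Fin (t + 1) → Fin N) → Prop} {u : Fin N}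
    (hE : ∀ x, E x → x (lastOn (status f t)) = u)
    (hdep : ∀ x x', (∀ i ≤ lastOn (status f t), x i = x' i) → E x → E x')
    (q : Fin t → Finset (Fin N)) (y : Finset (Fin N)) :
    w.queryProb src f t E q y = w.pathProb src f t E q * ∑ z, v q u y z := by
  rw [← sum_queryProb_and E (fun x => x (Fin.last t)), Finset.mul_sum]
  refine Finset.sum_congr rfl fun z _ => ?_
  rw [← h.kernel_eq, ← mul_assoc, ← h.pathProb_and hf hE hdep, UncodedScheme.queryProb,
    UncodedScheme.pathProb, Finset.sum_mul]
  refine Finset.sum_congr rfl fun x _ => ?_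
  split_ifs with hx
  · rw [hE x hx.1, hx.2]
  · rw [zero_mul]

/-- The sum `∑ z, v q u y z` does not depend on `u`: it is the law of the query given the past
queries. -/
theorem UncodedScheme.OptimalAt.queryProb_true (h : w.OptimalAt src f t c v) (hf : f 0 = true)
    (u : Fin N) (q : Fin t → Finset (Fin N)) (y : Finset (Fin N)) :
    w.queryProb src f t (fun _ => True) q y =
      w.pathProb src f t (fun _ => True) q * ∑ z, v q u y z := by
  rw [← sum_queryProb_and _ (fun x => x (lastOn (status f t))),
    ← sum_pathProb_and _ (fun x => x (lastOn (status f t))), Finset.sum_mul]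
  refine Finset.sum_congr rfl fun a _ => ?_
  rw [h.queryProb_eq hf (u := a) (fun x hx => hx.2), (h.query q).indep y u a]
  rintro x x' hxx ⟨-, hx⟩
  exact ⟨trivial, (hxx _ le_rfl).symm.trans hx⟩

theorem UncodedScheme.OptimalAt.privateAt (h : w.OptimalAt src f t c v) (hf : f 0 = true) :
    (w.system L).PrivateAt src f t := by
  unfold System.PrivateAt condMutualInfo
  refine Finset.sum_eq_zero ?_
  rintro ⟨a, (s : Fin (t + 1) → Finset (Fin N))⟩ -
  set E : (Fin (t + 1) → Fin N) → Prop := fun x =>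
    (fun i : {i // i ∈ onTimes (status f t)} => x i) =
      fun i : {i // i ∈ onTimes (status f t)} => a i with hEdef
  have hE : ∀ x, E x → x (lastOn (status f t)) = a (lastOn (status f t)) := fun x hx =>
    congrFun hx ⟨_, status_lastOn hf t⟩
  have hdep : ∀ x x', (∀ i ≤ lastOn (status f t), x i = x' i) → E x → E x' := by
    intro x x' hxx hx
    funext i
    exact (hxx i (le_lastOn i.2)).symm.trans (congrFun hx i)
  have e1 := prob_mass w L src f t E (Fin.init s) (s (Fin.last t))
  have e2 := prob_mass_past w L src f t (fun _ => True) (Fin.init s)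
  have e3 := prob_mass_past w L src f t E (Fin.init s)
  have e4 := prob_mass w L src f t (fun _ => True) (Fin.init s) (s (Fin.last t))
  simp only [true_and] at e2 e4
  rw [h.queryProb_eq hf hE hdep] at e1
  rw [h.queryProb_true hf (a (lastOn (status f t)))] at e4
  have hlog : ∀ r r' : ℝ, r = r' → Real.log (r / r') = 0 := by
    rintro r _ rfl
    by_cases h0 : r = 0
    · simp [h0]
    · rw [div_self h0, Real.log_one]
  refine mul_eq_zero_of_right _ (hlog _ _ ?_)
  refine (congrArg₂ (· * ·) e1 e2).trans (Eq.trans ?_ (congrArg₂ (· * ·) e3 e4).symm)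
  ring

/-- The position that the decoder reads is the one at which the encoder has put the message of
`x`. -/
theorem decode_answer (w : UncodedScheme N) (t : ℕ) {q : Finset (Fin N)} (W : Fin N → Fin L → Bool)
    {x : Fin N} (hx : x ∈ q) :
    (w.system L).decode t (List.ofFn ((w.system L).answer t q W)) x q = W x := by
  funext j
  change (if h : x ∈ q then _ else false) = W x j
  rw [dif_pos hx, List.getD_eq_getElem _ _ 
    (by rw [List.length_ofFn]; exact (finProdFinEquiv _).isLt)]
  simp only [List.getElem_ofFn]
  change W (q.orderEmbOfFin rfl (finProdFinEquiv.symm (finProdFinEquiv _)).1)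
    (finProdFinEquiv.symm (finProdFinEquiv _)).2 = W x j
  rw [Equiv.symm_apply_apply]
  congr 1
  simp [Finset.orderEmbOfFin]

theorem UncodedScheme.OptimalAt.decodableAt (h : w.OptimalAt src f t c v) :
    (w.system L).DecodableAt src f t := by
  unfold System.DecodableAt System.errorProb
  refine Finset.sum_eq_zero ?_
  rintro ⟨x, (s : Fin (t + 1) → Finset (Fin N))⟩ -
  refine Finset.sum_eq_zero fun W _ => ?_
  by_cases hx : x (Fin.last t) ∈ s (Fin.last t)
  · exact if_neg (not_not.2 (decode_answer w t W hx))
  · have : (w.system L).mass src f t (x, s) = 0 :=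
      (mass_eq w L src f t x s).trans (by rw [h.contains _ _ _ _ hx, mul_zero])
    rw [this, zero_mul, ite_self]

theorem avgLength_eq (w : UncodedScheme N) (L : ℕ) (src : MarkovSource N) (f : ℕ → Bool) (t : ℕ) :
    (w.system L).avgLength src f t =
      ∑ q, ∑ y, w.queryProb src f t (fun _ => True) q y * (y.card * L) := by
  change (∑ ω : (Fin (t + 1) → Fin N) × (Fin (t + 1) → Finset (Fin N)),
    w.pathMass src f t ω.1 (Fin.init ω.2) * w.kernel t (status f t) (ω.1 (lastOn (status f t)))
      (ω.1 (Fin.last t)) (Fin.init ω.2) (ω.2 (Fin.last t)) *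
      (((ω.2 (Fin.last t)).card * L : ℕ) : ℝ)) = _
  rw [Fintype.sum_prod_type, Finset.sum_comm, sum_snoc]
  refine Finset.sum_congr rfl fun q _ => Finset.sum_congr rfl fun y _ => ?_
  simp [UncodedScheme.queryProb, Finset.sum_mul]

theorem UncodedScheme.OptimalAt.avgLength_eq (h : w.OptimalAt src f t c v) (hf : f 0 = true)
    (u : Fin N) : (w.system L).avgLength src f t =
      ∑ q, w.pathProb src f t (fun _ => True) q *
        ((∑ y : Finset (Fin N), (y.card : ℝ) * ∑ z, v q u y z) * L) := by
  rw [OnOff.avgLength_eq]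
  refine Finset.sum_congr rfl fun q _ => ?_
  rw [Finset.sum_mul, Finset.mul_sum]
  refine Finset.sum_congr rfl fun y _ => ?_
  rw [h.queryProb_true hf u]
  ring

/-- A query contains the request, so it is not empty. -/
theorem UncodedScheme.OptimalAt.avgLength_pos (h : w.OptimalAt src f t c v) (hf : f 0 = true)
    (hL : 0 < L) (u : Fin N) : 0 < (w.system L).avgLength src f t := by
  have hL' : (0 : ℝ) < L := Nat.cast_pos.2 hL
  refine hL'.trans_le ?_
  rw [h.avgLength_eq hf u]
  calc (L : ℝ) = ∑ q, w.pathProb src f t (fun _ => True) q * (1 * L) := by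
        rw [← Finset.sum_mul, sum_pathProb_true, one_mul, one_mul]
    _ ≤ _ := by
        refine Finset.sum_le_sum fun q _ => mul_le_mul_of_nonneg_left
          (mul_le_mul_of_nonneg_right ?_ hL'.le) (pathProb_nonneg _ q)
        have h1 : ∑ y, ∑ z, v q u y z = 1 := by
          rw [Finset.sum_comm, Finset.sum_congr rfl fun z _ => (h.query q).marginal u z]
          exact (h.row_mem q u).2
        rw [← h1]
        refine Finset.sum_le_sum fun y _ => ?_
        have h2 : 0 ≤ ∑ z, v q u y z := Finset.sum_nonneg fun z _ => (h.query q).nonneg u y z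
        rcases y.eq_empty_or_nonempty with rfl | hy
        · rw [Finset.sum_eq_zero fun z _ => (h.query q).contains u ∅ z (Finset.notMem_empty z)]
          simp
        · exact le_mul_of_one_le_left h2 (by exact_mod_cast hy.card_pos)

/-- The scheme meets the bound for any version `c'` of the conditional law, not only for its own.
-/
theorem UncodedScheme.OptimalAt.avgLength_le (h : w.OptimalAt src f t c v) (hf : f 0 = true)
    (u : Fin N) {c' : (Fin t → Finset (Fin N)) → Fin N → Fin N → ℝ}
    (hc' : (w.system L).IsLikelihood src f t c') :
    (w.system L).avgLength src f t ≤ (w.system L).innerBound src f t c' * L := by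
  have hb : (w.system L).innerBound src f t c' =
      ∑ q, w.pathProb src f t (fun _ => True) q * innerCost (c' q) := by
    refine Finset.sum_congr rfl fun q _ => ?_
    have := prob_priorMass w L src f t (fun _ => True) q
    simp only [true_and] at this
    exact congrArg (· * _) this
  rw [h.avgLength_eq hf u, hb, Finset.sum_mul]
  refine Finset.sum_le_sum fun q _ => ?_
  rw [mul_assoc]
  refine mul_le_mul_of_nonneg_left (mul_le_mul_of_nonneg_right ?_ (Nat.cast_nonneg L))
    (pathProb_nonneg _ q)
  refine ((h.query q).mean u).trans (h.minimal q (c' q) (hc'.1 q) fun a x => ?_)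
  have e1 := prob_priorMass w L src f t (fun ω => ω (lastOn (status f t)) = a) q
  have e2 := prob_priorMass w L src f t
    (fun ω => ω (Fin.last t) = x ∧ ω (lastOn (status f t)) = a) q
  simp only [and_assoc] at e2
  rw [← e1, ← e2]
  exact hc'.2 q a x

end Optimal

/-! ### Extending a scheme -/

theorem pathMass_congr {N : ℕ} {w w' : UncodedScheme N} {f f' : ℕ → Bool} {t : ℕ}
    (hw : ∀ i < t, w.kernel i = w'.kernel i) (hf : ∀ i < t, f i = f' i) (src : MarkovSource N) :
    w.pathMass src f t = w'.pathMass src f' t := by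
  funext x q
  unfold UncodedScheme.pathMass
  congr 1
  refine Finset.prod_congr rfl fun i _ => ?_
  have : status f i = status f' i := funext fun j => hf j (by have := j.isLt; have := i.isLt; omega)
  rw [hw i i.isLt, this]

theorem pathProb_congr {N : ℕ} {w w' : UncodedScheme N} {f f' : ℕ → Bool} {t : ℕ}
    (hw : ∀ i < t, w.kernel i = w'.kernel i) (hf : ∀ i < t, f i = f' i) (src : MarkovSource N) :
    w.pathProb src f t = w'.pathProb src f' t := by
  funext E q
  unfold UncodedScheme.pathProb
  rw [pathMass_congr hw hf]

theorem mass_congr {N : ℕ} {w w' : UncodedScheme N} {t : ℕ}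
    (hw : ∀ i ≤ t, w.kernel i = w'.kernel i) (L : ℕ) (src : MarkovSource N) (f : ℕ → Bool) :
    (w.system L).mass src f t = (w'.system L).mass src f t := by
  funext ⟨x, s⟩
  refine (mass_eq w L src f t x s).trans (Eq.trans ?_ (mass_eq w' L src f t x s).symm)
  rw [pathMass_congr (fun i hi => hw i (Nat.le_of_lt hi)) fun _ _ => rfl, hw t le_rfl]

theorem decodableAt_congr {N : ℕ} {w w' : UncodedScheme N} {t : ℕ}
    (hw : ∀ i ≤ t, w.kernel i = w'.kernel i) (L : ℕ) (src : MarkovSource N) (f : ℕ → Bool) :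
    (w.system L).DecodableAt src f t ↔ (w'.system L).DecodableAt src f t := by
  unfold System.DecodableAt System.errorProb
  rw [mass_congr hw]
  rfl

theorem privateAt_congr {N : ℕ} {w w' : UncodedScheme N} {t : ℕ}
    (hw : ∀ i ≤ t, w.kernel i = w'.kernel i) (L : ℕ) (src : MarkovSource N) (f : ℕ → Bool) :
    (w.system L).PrivateAt src f t ↔ (w'.system L).PrivateAt src f t := by
  unfold System.PrivateAt
  rw [mass_congr hw]
  rfl

theorem avgLength_congr {N : ℕ} {w w' : UncodedScheme N} {t : ℕ}
    (hw : ∀ i ≤ t, w.kernel i = w'.kernel i) (L : ℕ) (src : MarkovSource N) (f : ℕ → Bool) :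
    (w.system L).avgLength src f t = (w'.system L).avgLength src f t := by
  unfold System.avgLength
  rw [mass_congr hw]
  rfl

/-- The status sequence that continues `F` by OFF. -/
def extendStatus {t : ℕ} (F : Fin (t + 1) → Bool) : ℕ → Bool :=
  fun i => if h : i < t + 1 then F ⟨i, h⟩ else false

theorem status_extendStatus {t : ℕ} (F : Fin (t + 1) → Bool) : status (extendStatus F) t = F := by
  funext i
  exact dif_pos i.isLt

/-- A kernel for the time `t` that is optimal for every scheme with the same past as `w`. The laws
of the past depend on the status sequence only up to the time `t`. -/
theorem exists_optimal_kernel {N : ℕ} (w : UncodedScheme N) (src : MarkovSource N) (t : ℕ)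
    (F : Fin (t + 1) → Bool) :
    ∃ k : Fin N → Fin N → (Fin t → Finset (Fin N)) → Finset (Fin N) → ℝ,
      (∀ u x q, k u x q ∈ stdSimplex ℝ (Finset (Fin N))) ∧
      ∀ (w' : UncodedScheme N) (f : ℕ → Bool), (∀ i < t, w'.kernel i = w.kernel i) →
        status f t = F → w'.kernel t F = k → ∃ c v, w'.OptimalAt src f t c v := by
  set g := extendStatus F with hg
  have h1 := fun q : Fin t → Finset (Fin N) => exists_minimal_version
    (P := fun u => w.pathProb src g t (fun ω => ω (lastOn F) = u) q)
    (J := fun u x => w.pathProb src g t (fun ω => ω (Fin.last t) = x ∧ ω (lastOn F) = u) q)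
    (fun u x => pathProb_nonneg _ q) (fun u => by
      rw [← sum_pathProb_and _ (fun ω => ω (Fin.last t))]
      simp only [and_comm])
  choose c hc1 hc2 hc3 using h1
  choose v hv using fun q => exists_isUncodedQuery (hc1 q)
  choose k hk1 hk2 hk3 using fun q => exists_kernel (fun u => (hc1 q u).1) (hv q)
  refine ⟨fun u x q => k q u x, fun u x q => hk1 q u x, fun w' f hw hf hk => ⟨c, v, ?_⟩⟩
  have hP : w'.pathProb src f t = w.pathProb src g t := by
    refine pathProb_congr hw (fun i hi => ?_) src
    have := congrFun (hf.trans (status_extendStatus F).symm) ⟨i, by omega⟩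
    exact this
  subst hf
  refine ⟨?_, hc1, hv, ?_, ?_, ?_⟩
  · rw [hP]
    exact hc2
  · rw [hk]
    exact fun u x q y => hk2 q u x y
  · rw [hk]
    exact fun u x q y => hk3 q u x y
  · rw [hP]
    exact hc3

/-- The scheme with an optimal kernel at time `t` given its own past. -/
noncomputable def UncodedScheme.improve {N : ℕ} (w : UncodedScheme N) (src : MarkovSource N)
    (t : ℕ) : UncodedScheme N where
  kernel := Function.update w.kernel t fun F => (exists_optimal_kernel w src t F).choose
  kernel_mem s F u x q := by
    by_cases h : s = t
    · subst h
      rw [Function.update_self]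
      exact (exists_optimal_kernel w src s F).choose_spec.1 u x q
    · rw [Function.update_of_ne h]
      exact w.kernel_mem s F u x q

/-- The scheme that has been improved successively at the times from `t₀` to `n - 1`. -/
noncomputable def UncodedScheme.stage {N : ℕ} (w : UncodedScheme N) (src : MarkovSource N)
    (t₀ : ℕ) : ℕ → UncodedScheme N
  | 0 => w
  | n + 1 => if t₀ ≤ n then (w.stage src t₀ n).improve src n else w.stage src t₀ n

theorem stage_succ_kernel {N : ℕ} (w : UncodedScheme N) (src : MarkovSource N) (t₀ : ℕ) {n s : ℕ}
    (h : s ≠ n) : (w.stage src t₀ (n + 1)).kernel s = (w.stage src t₀ n).kernel s := by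
  rw [UncodedScheme.stage]
  split_ifs
  · exact Function.update_of_ne h _ _
  · rfl

theorem stage_kernel_of_lt {N : ℕ} (w : UncodedScheme N) (src : MarkovSource N) (t₀ : ℕ) {n s : ℕ}
    (h : s < n) : (w.stage src t₀ n).kernel s = (w.stage src t₀ (s + 1)).kernel s := by
  induction n, h using Nat.le_induction with
  | base => rfl
  | succ n hn ih => rw [stage_succ_kernel w src t₀ (Nat.ne_of_lt hn), ih]

theorem stage_kernel_of_lt_start {N : ℕ} (w : UncodedScheme N) (src : MarkovSource N) {t₀ : ℕ}
    (n : ℕ) {s : ℕ} (h : s < t₀) : (w.stage src t₀ n).kernel s = w.kernel s := by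
  induction n with
  | zero => rfl
  | succ n ih =>
    rw [UncodedScheme.stage]
    split_ifs with hn
    · exact (Function.update_of_ne (h.trans_le hn).ne _ _).trans ih
    · exact ih

/-- The scheme that is improved at all times from `t₀` on. -/
noncomputable def UncodedScheme.extension {N : ℕ} (w : UncodedScheme N) (src : MarkovSource N)
    (t₀ : ℕ) : UncodedScheme N where
  kernel t := (w.stage src t₀ (t + 1)).kernel t
  kernel_mem t := (w.stage src t₀ (t + 1)).kernel_mem t

theorem extension_optimalAt {N : ℕ} (w : UncodedScheme N) (src : MarkovSource N) {t₀ t : ℕ}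
    (ht : t₀ ≤ t) (f : ℕ → Bool) : ∃ c v, (w.extension src t₀).OptimalAt src f t c v := by
  refine (exists_optimal_kernel (w.stage src t₀ t) src t (status f t)).choose_spec.2 _ f
    (fun i hi => (stage_kernel_of_lt w src t₀ hi).symm) rfl ?_
  change (w.stage src t₀ (t + 1)).kernel t (status f t) = _
  rw [UncodedScheme.stage, if_pos ht]
  change Function.update (w.stage src t₀ t).kernel t
    (fun F => (exists_optimal_kernel (w.stage src t₀ t) src t F).choose) t (status f t) = _
  rw [Function.update_self]

theorem exists_extension {N L : ℕ} (hL : 0 < L) (src : MarkovSource N) (t₀ : ℕ)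
    (w : UncodedScheme N)
    (hw : ∀ f : ℕ → Bool, f 0 = true → ∀ t < t₀,
      (w.system L).DecodableAt src f t ∧ (w.system L).PrivateAt src f t) :
    ∃ w' : UncodedScheme N, (∀ t < t₀, w'.kernel t = w.kernel t) ∧
      (w'.system L).Admissible src ∧
      ∀ f : ℕ → Bool, f 0 = true → ∀ R : ℕ → ℝ,
        (∀ t < t₀, R t ≤ (L : ℝ) / (w.system L).avgLength src f t) →
        (∀ t, t₀ ≤ t → 0 < R t ∧ ∃ c, (w'.system L).IsLikelihood src f t c ∧
          (w'.system L).innerBound src f t c ≤ 1 / R t) →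
        (w'.system L).Achieves src f R ∧ Achievable src f R := by
  have hker : ∀ t < t₀, (w.extension src t₀).kernel t = w.kernel t := fun t ht =>
    stage_kernel_of_lt_start w src (t + 1) ht
  have hadm : ((w.extension src t₀).system L).Admissible src := by
    intro f hf t
    by_cases ht : t < t₀
    · have h : ∀ i ≤ t, (w.extension src t₀).kernel i = w.kernel i := fun i hi =>
        hker i (hi.trans_lt ht)
      exact ⟨(decodableAt_congr h L src f).2 (hw f hf t ht).1,
        (privateAt_congr h L src f).2 (hw f hf t ht).2⟩
    · obtain ⟨c, v, h⟩ := extension_optimalAt w src (not_lt.1 ht) f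
      exact ⟨h.decodableAt, h.privateAt hf⟩
  refine ⟨w.extension src t₀, hker, hadm, fun f hf R h1 h2 => ?_⟩
  have hach : ((w.extension src t₀).system L).Achieves src f R := by
    refine ⟨hadm, fun t => ?_⟩
    by_cases ht : t < t₀
    · rw [avgLength_congr fun i hi => hker i (hi.trans_lt ht)]
      exact h1 t ht
    · obtain ⟨c, v, h⟩ := extension_optimalAt w src (not_lt.1 ht) f
      obtain ⟨hR, c', hc', hb⟩ := h2 t (not_lt.1 ht)
      -- the initial law is a probability, so there is a source
      obtain ⟨u⟩ : Nonempty (Fin N) := by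
        by_contra hN
        rw [not_nonempty_iff] at hN
        have := src.init_mem.2
        simp at this
      rw [le_div_iff₀ (h.avgLength_pos hf hL u)]
      have h3 := (h.avgLength_le (L := L) hf u hc').trans
        (mul_le_mul_of_nonneg_right hb (Nat.cast_nonneg L))
      rw [one_div, ← div_eq_inv_mul, le_div_iff₀ hR] at h3
      linarith
  exact ⟨hach, L, hL, _, hach⟩

end OnOff

open OnOff in
theorem theorem2 :
    -- the polynomial time construction of the uncoded query
    (∃ (prog : Prog) (T : Polynomial ℕ), ∀ (N : ℕ) (p : Fin N → Fin N → ℝ),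
      (∀ u, p u ∈ stdSimplex ℝ (Fin N)) →
        (prog.run (inputStore p)).2 ≤ T.eval N ∧
        (prog.run (inputStore p)).1.numRecords ≤ T.eval N ∧
        IsUncodedQuery p ((prog.run (inputStore p)).1.output N)) ∧
    -- the inner bound, for all times `t ≥ t₀` after any given admissible past
    (∀ (N L : ℕ), 0 < L → ∀ (src : MarkovSource N) (t₀ : ℕ) (w : UncodedScheme N),
      (∀ f : ℕ → Bool, f 0 = true → ∀ t < t₀,
        (w.system L).DecodableAt src f t ∧ (w.system L).PrivateAt src f t) →
      ∃ w' : UncodedScheme N, (∀ t < t₀, w'.kernel t = w.kernel t) ∧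
        (w'.system L).Admissible src ∧
        ∀ f : ℕ → Bool, f 0 = true → ∀ R : ℕ → ℝ,
          (∀ t < t₀, R t ≤ (L : ℝ) / (w.system L).avgLength src f t) →
          (∀ t, t₀ ≤ t → 0 < R t ∧ ∃ c, (w'.system L).IsLikelihood src f t c ∧
            (w'.system L).innerBound src f t c ≤ 1 / R t) →
          (w'.system L).Achieves src f R ∧ Achievable src f R) :=
  ⟨⟨queryProg, queryProg_polynomial⟩, fun _ _ hL src t₀ w hw => exists_extension hL src t₀ w hw⟩
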